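/- **Existence of minimizers.** Let $\mu\in\mathbb R$, $0\le T<\infty$, and let $V\in L^{3/2}(\mathbb R^3)$ be real-valued and even, $V(-x)=V(x)$ for almost every $x$. Fourier transforms are taken in the unitary convention, $\hat f(p)=(2\pi)^{-3/2}\int_{\mathbb R^3} f(x)e^{-ip\cdot x}\,dx$, extended to $L^2$ and to $L^{3/2}$ as usual, i.e. in the sense of tempered distributions; in particular $\hat V\in L^3(\mathbb R^3)$. Let $\mathcal D$ be the set of all states $\Gamma=(\gamma,\alpha)$, given by $\hat\gamma:\mathbb R^3\to\mathbb R$ with $\hat\gamma\in L^1(\mathbb R^3,(1+p^2)\,dp)$ and $\alpha\in H^1(\mathbb R^3,dx)$ with $\hat\alpha(-p)=\hat\alpha(p)$, such that the matrix $$\Gamma(p)=\begin{pmatrix}\hat\gamma(p)&\hat\alpha(p)\\ \overline{\hat\alpha(p)}&1-\hat\gamma(-p)\end{pmatrix}$$ satisfies $0\le\Gamma(p)\le1$ for almost every $p\in\mathbb R^3$. Define $$\mathcal F(\Gamma)=\int_{\mathbb R^3}(p^2-\mu)\hat\gamma(p)\,dp+\int_{\mathbb R^3}|\alpha(x)|^2V(x)\,dx-T\,S(\Gamma),\qquad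 S(\Gamma)=-\int_{\mathbb R^3}\mathrm{Tr}_{\mathbb C^2}\big[\Gamma(p)\ln\Gamma(p)\big]\,dp .$$ Then the integrals defining $\mathcal F$ and $S$ converge absolutely on $\mathcal D$, $\mathcal F$ is bounded from below on $\mathcal D$, and it attains its minimum on $\mathcal D$. Moreover, for every $\Gamma\in\mathcal D$ the integral $$\Delta(p)=\frac{2}{(2\pi)^{3/2}}\int_{\mathbb R^3}\hat V(p-q)\,\hat\alpha(q)\,dq$$ converges absolutely for every $p\in\mathbb R^3$, and if $\Gamma$ is a minimizer of $\mathcal F$ on $\mathcal D$, then $\Delta$ satisfies the BCS gap equation $$\frac1{(2\pi)^{3/2}}\int_{\mathbb R^3}\hat V(p-q)\,\frac{\Delta(q)}{K_T^\Delta(q)}\,dq=-\Delta(p)\qquad\text{for every }p\in\mathbb R^3,$$ the integral being absolutely convergent. Here $E_\Delta(p)=\sqrt{(p^2-\mu)^2+|\Delta(p)|^2}$, and $K_T^\Delta(p)=E_\Delta(p)/\tanh\big(E_\Delta(p)/(2T)\big)$ for $T>0$ (read as $2T$ where $E_\Delta(p)=0$), while $K_0^\Delta=E_\Delta$. -/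

import Mathlib

namespace BCS

noncomputable section

open MeasureTheory
open scoped FourierTransform SchwartzMap ComplexConjugate ComplexOrder

/-- Three-dimensional Euclidean space. -/
abbrev Space : Type := EuclideanSpace ℝ (Fin 3)

/-- Mathlib's Fourier transform is `∫ exp(-2πi x·ξ) f(x) dx`. If `g` is that transform of `f`, then
`toUnitary g` is the transform `(2π)^(-3/2) ∫ exp(-i p·x) f(x) dx` in the unitary convention. -/
def toUnitary (g : Space → ℂ) (p : Space) : ℂ :=
  (((2 * Real.pi) ^ (-(3 / 2) : ℝ) : ℝ) : ℂ) * g ((2 * Real.pi)⁻¹ • p)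

/-- `Vhat ∈ L³` is the Fourier transform (unitary convention, in the sense of tempered
distributions) of the function `V`. For `V ∈ L^(3/2)` there is at most one such `Vhat`, up to
equality almost everywhere, and all the integrands are integrable. -/
def IsFourierTransform (V : Space → ℝ) (Vhat : Space → ℂ) : Prop :=
  MemLp Vhat 3 volume ∧
    ∀ φ : 𝓢(Space, ℂ),
      ∫ p, Vhat p * φ p = ∫ x, (V x : ℂ) * toUnitary (𝓕 φ : 𝓢(Space, ℂ)) x

/-- The data of a translation-invariant state: the momentum distribution `γ̂` and the Cooper-pair
wave function `α`, a square-integrable function of the relative position. -/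
structure State where
  gammaHat : Space → ℝ
  alpha : Lp ℂ 2 (volume : Measure Space)

/-- `α̂`, the (unitary, `L²`) Fourier transform of the pair wave function. -/
def State.alphaHat (Γ : State) : Space → ℂ :=
  toUnitary (𝓕 Γ.alpha : Lp ℂ 2 (volume : Measure Space))

/-- The Hermitian `2 × 2` matrix `Γ(p)`. -/
def State.matrix (Γ : State) (p : Space) : Matrix (Fin 2) (Fin 2) ℂ :=
  !![(Γ.gammaHat p : ℂ), Γ.alphaHat p;
     conj (Γ.alphaHat p), 1 - (Γ.gammaHat (-p) : ℂ)]

/-- The domain `𝒟`: `γ̂ ∈ L¹((1 + p²) dp)`, `α ∈ H¹`, `α̂(-p) = α̂(p)` and `0 ≤ Γ(p) ≤ 1`. -/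
def domain : Set State :=
  {Γ | Integrable (fun p => (1 + ‖p‖ ^ 2) * Γ.gammaHat p) ∧
    TemperedDistribution.MemSobolev 1 2 (Lp.toTemperedDistribution Γ.alpha) ∧
    (∀ᵐ p, Γ.alphaHat (-p) = Γ.alphaHat p) ∧
    ∀ᵐ p, (Γ.matrix p).PosSemidef ∧ (1 - Γ.matrix p).PosSemidef}

/-- `-Tr[Γ(p) ln Γ(p)]`, where `t ln t` is applied to the Hermitian matrix `Γ(p)` by the functional
calculus and `0 ln 0 = 0`. -/
def State.entropyDensity (Γ : State) (p : Space) : ℝ :=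
  -(Matrix.trace (cfc (fun t : ℝ => t * Real.log t) (Γ.matrix p))).re

/-- The entropy `S(Γ)`. -/
def State.entropy (Γ : State) : ℝ := ∫ p, Γ.entropyDensity p

/-- The translation-invariant BCS functional. -/
def functional (V : Space → ℝ) (μ T : ℝ) (Γ : State) : ℝ :=
  (∫ p, (‖p‖ ^ 2 - μ) * Γ.gammaHat p) + (∫ x, ‖Γ.alpha x‖ ^ 2 * V x) - T * Γ.entropy

/-- `Γ` minimizes the BCS functional on the domain. -/
def IsMinimizer (V : Space → ℝ) (μ T : ℝ) (Γ : State) : Prop :=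
  Γ ∈ domain ∧ ∀ Γ' ∈ domain, functional V μ T Γ ≤ functional V μ T Γ'

/-- The gap function `Δ = 2 (2π)^(-3/2) V̂ * α̂`. -/
def gap (Vhat : Space → ℂ) (Γ : State) (p : Space) : ℂ :=
  ((2 / (2 * Real.pi) ^ (3 / 2 : ℝ) : ℝ) : ℂ) * ∫ q, Vhat (p - q) * Γ.alphaHat q

/-- `E_Δ(p) = √((p² - μ)² + |Δ(p)|²)`. -/
def energy (μ : ℝ) (Δ : Space → ℂ) (p : Space) : ℝ :=
  Real.sqrt ((‖p‖ ^ 2 - μ) ^ 2 + ‖Δ p‖ ^ 2)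

/-- `K_T^Δ = E_Δ / tanh(E_Δ / (2T))`, with its limiting values `E_Δ` at `T = 0` and `2T` at
`E_Δ = 0`. -/
def K (μ T : ℝ) (Δ : Space → ℂ) (p : Space) : ℝ :=
  if T = 0 then energy μ Δ p
  else if energy μ Δ p = 0 then 2 * T
  else energy μ Δ p / Real.tanh (energy μ Δ p / (2 * T))

/-- `Δ` satisfies the BCS gap equation `(2π)^(-3/2) ∫ V̂(p - q) Δ(q) / K_T^Δ(q) dq = -Δ(p)` at every
`p`, the integral being absolutely convergent. -/
def GapEquation (Vhat : Space → ℂ) (μ T : ℝ) (Δ : Space → ℂ) : Prop :=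
  ∀ p, Integrable (fun q => Vhat (p - q) * (Δ q / (K μ T Δ q : ℂ))) ∧
    ((1 / (2 * Real.pi) ^ (3 / 2 : ℝ) : ℝ) : ℂ) *
      ∫ q, Vhat (p - q) * (Δ q / (K μ T Δ q : ℂ)) = -Δ p

end

end BCS

namespace BCS

noncomputable section

open MeasureTheory Filter Topology
open scoped FourierTransform SchwartzMap ComplexConjugate ComplexOrder ENNReal NNReal

/-! Everything is done in momentum space. The constraint `0 ≤ Γ(p) ≤ 1` forces `|α̂|² ≤ γ̂`, so `α̂`
inherits the decay of `γ̂`. The entropy is integrable because `-t ln t ≤ k t + exp(-k)` may be used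
with `k` proportional to `p²`.

A potential in `L^(3/2)` is a bounded, compactly supported potential plus a remainder of small norm.
By the Sobolev inequality the remainder costs a small multiple of the kinetic energy. Hence `∫ |α|²
V` is form bounded with arbitrarily small relative bound, which makes the functional coercive, and
it is weakly continuous where the kinetic energy is bounded. Sobolev and Hausdorff-Young both come
from one layer-cake argument, `lintegral_norm_rpow_le_of_distribution`.

For existence, replacing `γ̂` by its even part lowers the functional. On even states the entropy
density is the binary entropy of `1/2 + r`, with `r` the Euclidean norm of `(γ̂ - 1/2, α̂)`. It is
jointly concave, so the free energy is convex. After adding an integrable function its density is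
nonnegative, and its sublevel sets are convex and, by Fatou, closed in `L²`; hence they are weakly
closed. The direct method then applies (`exists_isMinimizer`).

For the gap equation, symmetrizing a minimizer gives a minimizer with the same `α`. Convexity of the
free part turns minimality into nonnegativity of the variation of a functional linear in the
interaction, with field `Δ = 2 (Vα)^`. That functional is minimized point by point: Cauchy-Schwarz
fixes the direction of `(γ̂ - 1/2, α̂)` and the strict Gibbs inequality its length. Comparing with
the pointwise minimizer inside balls gives `α̂ = -Δ / (2 K)` almost everywhere
(`IsMinimizer.alpha_eq`), and convolution with `V̂` gives the equation at every `p`. -/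

/-- Square-integrable functions on `Space`. -/
abbrev L2 : Type := Lp ℂ 2 (volume : Measure Space)

/-! ### The unitary Fourier transform on `L²`. -/

/-- The normalizing constant `(2π)^(-3/2)` of the unitary Fourier transform. -/
def fourierConst : ℝ := (2 * Real.pi) ^ (-(3 / 2) : ℝ)

lemma fourierConst_pos : 0 < fourierConst := by
  unfold fourierConst; positivity

lemma fourierConst_sq : fourierConst ^ 2 * (2 * Real.pi) ^ 3 = 1 := by
  unfold fourierConst
  rw [← Real.rpow_natCast, ← Real.rpow_natCast, ← Real.rpow_mul (by positivity),
    ← Real.rpow_add (by positivity)]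
  norm_num

lemma toUnitary_def (g : Space → ℂ) (p : Space) :
    toUnitary g p = (fourierConst : ℂ) * g ((2 * Real.pi)⁻¹ • p) := rfl

lemma two_pi_inv_ne : ((2 * Real.pi)⁻¹ : ℝ) ≠ 0 := by positivity

lemma lintegral_comp_inv_two_pi_smul (f : Space → ℝ≥0∞) :
    ∫⁻ p, f ((2 * Real.pi)⁻¹ • p) = ENNReal.ofReal ((2 * Real.pi) ^ 3) * ∫⁻ ξ, f ξ := by
  have hemb : MeasurableEmbedding (fun p : Space => (2 * Real.pi)⁻¹ • p) :=
    (Homeomorph.smulOfNeZero _ two_pi_inv_ne).measurableEmbedding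
  rw [← hemb.lintegral_map, Measure.map_addHaar_smul _ two_pi_inv_ne, lintegral_smul_measure,
    smul_eq_mul]
  congr 2
  rw [finrank_euclideanSpace_fin, inv_pow, inv_inv, abs_of_pos (by positivity)]

lemma toUnitary_congr_ae {f g : Space → ℂ} (h : f =ᵐ[volume] g) :
    toUnitary f =ᵐ[volume] toUnitary g := by
  have := (Measure.quasiMeasurePreserving_smul (μ := (volume : Measure Space))
    two_pi_inv_ne).ae_eq h
  filter_upwards [this] with p hp
  simp only [toUnitary_def]
  exact congrArg _ hp

lemma aestronglyMeasurable_toUnitary {g : Space → ℂ} (hg : AEStronglyMeasurable g volume) :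
    AEStronglyMeasurable (toUnitary g) volume := by
  have := hg.comp_quasiMeasurePreserving (Measure.quasiMeasurePreserving_smul
    (μ := (volume : Measure Space)) two_pi_inv_ne)
  exact this.const_mul _

lemma enorm_fourierConst_sq_mul :
    ‖(fourierConst : ℂ)‖ₑ ^ 2 * ENNReal.ofReal ((2 * Real.pi) ^ 3) = 1 := by
  rw [← ofReal_norm, Complex.norm_real, Real.norm_of_nonneg fourierConst_pos.le,
    ← ENNReal.ofReal_pow fourierConst_pos.le, ← ENNReal.ofReal_mul (by positivity),
    fourierConst_sq, ENNReal.ofReal_one]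

lemma lintegral_toUnitary_sq (g : Space → ℂ) :
    ∫⁻ p, ‖toUnitary g p‖ₑ ^ 2 = ∫⁻ ξ, ‖g ξ‖ₑ ^ 2 := by
  simp only [toUnitary_def, enorm_mul, mul_pow]
  rw [lintegral_const_mul' _ _ (by finiteness),
    lintegral_comp_inv_two_pi_smul (fun ξ => ‖g ξ‖ₑ ^ 2), ← mul_assoc,
    enorm_fourierConst_sq_mul, one_mul]

lemma eLpNorm_two_eq (g : Space → ℂ) :
    eLpNorm g 2 volume = (∫⁻ ξ, ‖g ξ‖ₑ ^ 2) ^ (1 / 2 : ℝ) := by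
  rw [eLpNorm_eq_lintegral_rpow_enorm_toReal (by norm_num) (by norm_num)]
  simp

lemma eLpNorm_toUnitary (g : Space → ℂ) :
    eLpNorm (toUnitary g) 2 volume = eLpNorm g 2 volume := by
  rw [eLpNorm_two_eq, eLpNorm_two_eq, lintegral_toUnitary_sq]

lemma memLp_toUnitary {g : Space → ℂ} (hg : MemLp g 2 volume) : MemLp (toUnitary g) 2 volume :=
  ⟨aestronglyMeasurable_toUnitary hg.1, by rw [eLpNorm_toUnitary]; exact hg.2⟩

/-- The dilation `toUnitary` as an isometry of `L²`. -/
def dilation : L2 →ₗᵢ[ℂ] L2 where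
  toFun g := (memLp_toUnitary (Lp.memLp g)).toLp _
  map_add' f g := by
    rw [← MemLp.toLp_add]
    refine MemLp.toLp_congr _ _ ((toUnitary_congr_ae (Lp.coeFn_add f g)).trans ?_)
    refine Eventually.of_forall fun p => ?_
    simp [toUnitary_def, mul_add]
  map_smul' c g := by
    rw [RingHom.id_apply, ← MemLp.toLp_const_smul]
    refine MemLp.toLp_congr _ _ ((toUnitary_congr_ae (Lp.coeFn_smul c g)).trans ?_)
    refine Eventually.of_forall fun p => ?_
    simp [toUnitary_def, mul_left_comm]
  norm_map' g := by
    change ‖(memLp_toUnitary (Lp.memLp g)).toLp _‖ = ‖g‖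
    rw [Lp.norm_toLp, eLpNorm_toUnitary, Lp.norm_def]

lemma coeFn_dilation (g : L2) : dilation g =ᵐ[volume] toUnitary g :=
  MemLp.coeFn_toLp (memLp_toUnitary (Lp.memLp g))

/-- The inverse of `toUnitary`. -/
def ofUnitary (h : Space → ℂ) (ξ : Space) : ℂ :=
  (fourierConst : ℂ)⁻¹ * h ((2 * Real.pi) • ξ)

lemma toUnitary_ofUnitary (h : Space → ℂ) : toUnitary (ofUnitary h) = h := by
  ext p
  have h1 : (fourierConst : ℂ) ≠ 0 := by exact_mod_cast fourierConst_pos.ne'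
  have h2 : (2 * Real.pi) • (2 * Real.pi)⁻¹ • p = p := by
    rw [smul_smul, mul_inv_cancel₀ (by positivity), one_smul]
  simp only [toUnitary_def, ofUnitary, h2]
  rw [mul_inv_cancel_left₀ h1]

lemma memLp_ofUnitary {h : Space → ℂ} (hh : MemLp h 2 volume) : MemLp (ofUnitary h) 2 volume := by
  refine ⟨?_, ?_⟩
  · exact (hh.1.comp_quasiMeasurePreserving (Measure.quasiMeasurePreserving_smul
      (μ := (volume : Measure Space)) (r := 2 * Real.pi) (by positivity))).const_mul _
  · rw [← eLpNorm_toUnitary, toUnitary_ofUnitary]; exact hh.2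

lemma dilation_surjective : Function.Surjective dilation := by
  intro h
  refine ⟨(memLp_ofUnitary (Lp.memLp h)).toLp _, ?_⟩
  refine Lp.ext ((coeFn_dilation _).trans ?_)
  refine (toUnitary_congr_ae (MemLp.coeFn_toLp _)).trans ?_
  rw [toUnitary_ofUnitary]

/-- The Fourier transform in the unitary convention, as a unitary operator on `L²`. -/
def unitaryFourier : L2 ≃ₗᵢ[ℂ] L2 :=
  (Lp.fourierTransformₗᵢ Space ℂ).trans (LinearIsometryEquiv.ofSurjective dilation
    dilation_surjective)

lemma coeFn_unitaryFourier (α : L2) :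
    unitaryFourier α =ᵐ[volume] toUnitary (𝓕 α : L2) := coeFn_dilation _

lemma alphaHat_ae_eq (Γ : State) : Γ.alphaHat =ᵐ[volume] unitaryFourier Γ.alpha :=
  (coeFn_unitaryFourier _).symm

/-! ### Fourier integrals, Parseval and inversion. -/

/-- The plane wave `x ↦ exp(i p·x)`. -/
def planeWave (p x : Space) : ℂ := Complex.exp (Complex.I * (inner ℝ p x : ℝ))

lemma norm_planeWave (p x : Space) : ‖planeWave p x‖ = 1 := by
  rw [planeWave, mul_comm, Complex.norm_exp_ofReal_mul_I]

@[fun_prop]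
lemma continuous_planeWave : Continuous fun z : Space × Space => planeWave z.1 z.2 := by
  unfold planeWave; fun_prop

lemma conj_planeWave (p x : Space) : conj (planeWave p x) = planeWave (-p) x := by
  rw [planeWave, planeWave, ← Complex.exp_conj]
  simp

lemma planeWave_add (p q x : Space) : planeWave (p + q) x = planeWave p x * planeWave q x := by
  rw [planeWave, planeWave, planeWave, ← Complex.exp_add, inner_add_left]
  push_cast; ring_nf

/-- The unitary Fourier transform of an integrable function, as an integral. -/
def fourierIntegral (f : Space → ℂ) (p : Space) : ℂ :=
  (fourierConst : ℂ) * ∫ x, planeWave (-p) x * f x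

lemma integrable_planeWave_mul {f : Space → ℂ} (hf : Integrable f) (p : Space) :
    Integrable fun x => planeWave p x * f x := by
  refine hf.bdd_mul (c := 1) ?_ (Eventually.of_forall fun x => (norm_planeWave p x).le)
  exact (by fun_prop : Continuous fun x => planeWave p x).aestronglyMeasurable

lemma toUnitary_fourier (f : Space → ℂ) (p : Space) :
    toUnitary (𝓕 f) p = fourierIntegral f p := by
  rw [toUnitary_def, fourierIntegral, Real.fourier_eq']
  congr 2
  ext x
  rw [planeWave, smul_eq_mul, inner_smul_right, inner_neg_left, real_inner_comm]
  congr 2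
  push_cast
  field_simp

lemma fourierIntegral_congr {f g : Space → ℂ} (h : f =ᵐ[volume] g) (p : Space) :
    fourierIntegral f p = fourierIntegral g p := by
  unfold fourierIntegral
  congr 1
  refine integral_congr_ae ?_
  filter_upwards [h] with x hx
  rw [hx]

/-- Both sides are tested against smooth compactly supported functions. Compatibility of the `L²`
transform with tempered distributions moves `𝓕` onto the test function, and Fubini moves it back
onto `f`. -/
lemma fourier_toLp_ae_eq {f : Space → ℂ} (h1 : Integrable f) (h2 : MemLp f 2 volume) :
    ((𝓕 (h2.toLp f) : L2) : Space → ℂ) =ᵐ[volume] 𝓕 f := by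
  have hcont : Continuous (𝓕 f) :=
    VectorFourier.fourierIntegral_continuous Real.continuous_fourierChar
      (by exact continuous_inner) h1
  refine ae_eq_of_integral_contDiff_smul_eq ((Lp.memLp _).locallyIntegrable (by norm_num))
    hcont.locallyIntegrable fun g g_smooth g_cpt => ?_
  have hg₁ : HasCompactSupport (Complex.ofRealCLM ∘ g) := g_cpt.comp_left rfl
  have hg₂ : ContDiff ℝ ((⊤ : ℕ∞) : WithTop ℕ∞) (Complex.ofRealCLM ∘ g) := by fun_prop
  set φ : 𝓢(Space, ℂ) := hg₁.toSchwartzMap hg₂ with hφ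
  have hφg : ∀ x, φ x = (g x : ℂ) := fun x => by simp [hφ]
  have key := congrArg (fun D => D φ) (Lp.fourier_toTemperedDistribution_eq (h2.toLp f))
  simp only [TemperedDistribution.fourier_apply, Lp.toTemperedDistribution_apply, smul_eq_mul,
    hφg] at key
  simp only [Complex.real_smul]
  rw [← key]
  have h3 : ∫ x, (𝓕 φ : 𝓢(Space, ℂ)) x * (h2.toLp f) x = ∫ x, (𝓕 φ : 𝓢(Space, ℂ)) x * f x := by
    refine integral_congr_ae ?_
    filter_upwards [h2.coeFn_toLp] with x hx
    rw [hx]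
  rw [h3]
  have h4 := VectorFourier.integral_fourierIntegral_smul_eq_flip (L := innerₗ Space)
    (μ := volume) (ν := volume) Real.continuous_fourierChar continuous_inner
    (φ.integrable (μ := volume)) h1
  simp only [smul_eq_mul, hφg] at h4
  simpa using! h4

lemma unitaryFourier_toLp_ae_eq {f : Space → ℂ} (h1 : Integrable f) (h2 : MemLp f 2 volume) :
    (unitaryFourier (h2.toLp f) : Space → ℂ) =ᵐ[volume] fourierIntegral f := by
  refine (coeFn_unitaryFourier _).trans ((toUnitary_congr_ae (fourier_toLp_ae_eq h1 h2)).trans ?_)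
  exact Eventually.of_forall fun p => toUnitary_fourier f p

lemma unitaryFourier_ae_eq {α : L2} (h1 : Integrable (α : Space → ℂ)) :
    (unitaryFourier α : Space → ℂ) =ᵐ[volume] fourierIntegral α := by
  have := unitaryFourier_toLp_ae_eq h1 (Lp.memLp α)
  rwa [Lp.toLp_coeFn] at this

lemma integral_fourierIntegral_mul {f h : Space → ℂ} (hf : Integrable f) (hh : Integrable h) :
    ∫ p, fourierIntegral f p * h p = ∫ x, f x * fourierIntegral h x := by
  have h1 : ∀ p, fourierIntegral f p * h p
      = (fourierConst : ℂ) * ∫ x, planeWave (-p) x * (f x * h p) := fun p => by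
    rw [fourierIntegral, mul_assoc, ← integral_mul_const]
    simp only [mul_assoc]
  have h2 : ∀ x, f x * fourierIntegral h x
      = (fourierConst : ℂ) * ∫ p, planeWave (-p) x * (f x * h p) := fun x => by
    rw [fourierIntegral, mul_left_comm, ← integral_const_mul]
    congr 2
    ext p
    have : planeWave (-x) p = planeWave (-p) x := by
      simp [planeWave, real_inner_comm]
    rw [this]; ring
  simp only [h1, h2, integral_const_mul]
  congr 1
  refine integral_integral_swap ?_
  have h3 : Integrable (fun z : Space × Space => h z.1 * f z.2) (volume.prod volume) :=
    hh.mul_prod hf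
  have h4 : Integrable (fun z : Space × Space => f z.2 * h z.1) (volume.prod volume) :=
    h3.congr (Eventually.of_forall fun z => mul_comm _ _)
  refine h4.bdd_mul (c := 1) ?_ (Eventually.of_forall fun z => (norm_planeWave _ _).le)
  exact (by fun_prop : Continuous fun z : Space × Space => planeWave (-z.1) z.2)
    |>.aestronglyMeasurable

lemma continuous_fourierIntegral {f : Space → ℂ} (hf : Integrable f) :
    Continuous (fourierIntegral f) := by
  unfold fourierIntegral
  refine continuous_const.mul ?_
  refine continuous_of_dominated (bound := fun x => ‖f x‖) (fun p => ?_) (fun p => ?_) hf.norm ?_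
  · exact (integrable_planeWave_mul hf (-p)).aestronglyMeasurable
  · exact Eventually.of_forall fun x => by rw [norm_mul, norm_planeWave, one_mul]
  · exact Eventually.of_forall fun x => by fun_prop

lemma norm_fourierIntegral_le (f : Space → ℂ) (p : Space) :
    ‖fourierIntegral f p‖ ≤ fourierConst * ∫ x, ‖f x‖ := by
  rw [fourierIntegral, norm_mul, Complex.norm_real, Real.norm_of_nonneg fourierConst_pos.le]
  gcongr
  · exact fourierConst_pos.le
  · refine (norm_integral_le_integral_norm _).trans (le_of_eq ?_)
    simp [norm_planeWave]

lemma conj_fourierIntegral (f : Space → ℂ) (p : Space) :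
    conj (fourierIntegral f p) = fourierIntegral (fun x => conj (f x)) (-p) := by
  rw [fourierIntegral, fourierIntegral, map_mul, Complex.conj_ofReal, ← integral_conj]
  simp only [map_mul, conj_planeWave]

lemma L2_inner_eq (f g : L2) : inner ℂ f g = ∫ x, conj (f x) * g x := by
  rw [L2.inner_def]
  refine integral_congr_ae (Eventually.of_forall fun x => ?_)
  simp [mul_comm]

/-- Parseval's identity. -/
lemma integral_conj_unitaryFourier_mul (f g : L2) :
    ∫ p, conj (unitaryFourier f p) * unitaryFourier g p = ∫ x, conj (f x) * g x := by
  rw [← L2_inner_eq, ← L2_inner_eq, LinearIsometryEquiv.inner_map_map]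

/-- Fourier inversion for square-integrable functions with integrable Fourier transform. -/
lemma ae_eq_fourierIntegral_neg {α : L2} (h : Integrable (unitaryFourier α : Space → ℂ)) :
    (α : Space → ℂ) =ᵐ[volume] fun x => fourierIntegral (unitaryFourier α) (-x) := by
  refine ae_eq_of_integral_contDiff_smul_eq ((Lp.memLp α).locallyIntegrable (by norm_num))
    (((continuous_fourierIntegral h).comp continuous_neg).locallyIntegrable)
    fun g g_smooth g_cpt => ?_
  have hg1 : Integrable (fun x => (g x : ℂ)) :=
    (Complex.continuous_ofReal.comp g_smooth.continuous).integrable_of_hasCompactSupport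
      (g_cpt.comp_left rfl)
  have hg2 : MemLp (fun x => (g x : ℂ)) 2 volume :=
    (Complex.continuous_ofReal.comp g_smooth.continuous).memLp_of_hasCompactSupport
      (g_cpt.comp_left rfl)
  -- Parseval moves the test function to momentum space; since `α̂` is integrable, the
  -- multiplication formula brings it back. Conjugation of the transform of a real function is the
  -- reflection that appears as `-x`.
  have key := integral_conj_unitaryFourier_mul (hg2.toLp _) α
  have e1 : ∫ x, conj (hg2.toLp _ x) * α x = ∫ x, g x • α x := by
    refine integral_congr_ae ?_
    filter_upwards [hg2.coeFn_toLp] with x hx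
    simp [hx]
  have e2 : ∫ p, conj (unitaryFourier (hg2.toLp _) p) * unitaryFourier α p =
      ∫ p, fourierIntegral (fun x => (g x : ℂ)) (-p) * unitaryFourier α p := by
    refine integral_congr_ae ?_
    filter_upwards [unitaryFourier_toLp_ae_eq hg1 hg2] with x hx
    rw [hx, conj_fourierIntegral]
    simp
  have e3 : ∫ p, fourierIntegral (fun x => (g x : ℂ)) (-p) * unitaryFourier α p =
      ∫ p, fourierIntegral (fun x => (g x : ℂ)) p * unitaryFourier α (-p) := by
    rw [← integral_neg_eq_self]; simp
  rw [← e1, ← key, e2, e3, integral_fourierIntegral_mul hg1 h.comp_neg]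
  refine integral_congr_ae (Eventually.of_forall fun x => ?_)
  simp only [Complex.real_smul]
  congr 1
  unfold fourierIntegral
  rw [← integral_neg_eq_self]
  simp only [neg_neg]
  simp only [planeWave, inner_neg_left, inner_neg_right, neg_neg]

lemma memLp_two_iff_integrable_norm_sq {f : Space → ℂ} (hf : AEStronglyMeasurable f volume) :
    MemLp f 2 volume ↔ Integrable fun x => ‖f x‖ ^ 2 :=
  memLp_two_iff_integrable_sq_norm hf

/-- A square-integrable function whose Fourier transform has enough decay lies in `H¹`. -/
lemma memSobolev_of_integrable {α : L2}
    (h : Integrable fun p => (1 + ‖p‖ ^ 2) * ‖unitaryFourier α p‖ ^ 2) :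
    TemperedDistribution.MemSobolev 1 2 (Lp.toTemperedDistribution α) := by
  rw [TemperedDistribution.memSobolev_iff_exists_smulLeftCLM_fourier,
    Lp.fourier_toTemperedDistribution_eq]
  set w : Space → ℂ := fun x => ((1 + ‖x‖ ^ 2) ^ ((1 : ℝ) / 2) : ℝ) with hw
  have hwc : Continuous w := by
    rw [hw]
    refine Complex.continuous_ofReal.comp ?_
    exact Continuous.rpow_const (by fun_prop) fun x => Or.inl (by positivity)
  set f : Space → ℂ := fun x => w x * (𝓕 α : L2) x with hf
  have hfm : AEStronglyMeasurable f volume :=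
    hwc.aestronglyMeasurable.mul (Lp.memLp (𝓕 α : L2)).1
  have hnw : ∀ x, ‖w x‖ ^ 2 = 1 + ‖x‖ ^ 2 := fun x => by
    rw [hw]
    simp only [Complex.norm_real, Real.norm_eq_abs, sq_abs]
    rw [← Real.sqrt_eq_rpow, Real.sq_sqrt (by positivity)]
  have hmem : MemLp f 2 volume := by
    rw [memLp_two_iff_integrable_norm_sq hfm]
    have h' : Integrable fun p : Space => (1 + ‖(2 * Real.pi) • p‖ ^ 2) *
        ‖unitaryFourier α ((2 * Real.pi) • p)‖ ^ 2 :=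
      (integrable_comp_smul_iff volume (fun p => (1 + ‖p‖ ^ 2) * ‖unitaryFourier α p‖ ^ 2)
        (by positivity : (2 * Real.pi) ≠ 0)).2 h
    have hae := (Measure.quasiMeasurePreserving_smul (μ := (volume : Measure Space))
      (by positivity : (2 * Real.pi) ≠ 0)).ae_eq (coeFn_unitaryFourier α)
    refine (h'.const_mul ((fourierConst ^ 2)⁻¹)).mono' (by fun_prop) ?_
    filter_upwards [hae] with p hp
    have h3 : (unitaryFourier α : Space → ℂ) ((2 * Real.pi) • p)
        = fourierConst * (𝓕 α : L2) p := by
      refine Eq.trans hp ?_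
      change toUnitary (𝓕 α : L2) ((2 * Real.pi) • p) = _
      rw [toUnitary_def]
      congr 2
      rw [smul_smul, inv_mul_cancel₀ (by positivity), one_smul]
    rw [h3, hf, norm_mul, norm_mul, mul_pow, mul_pow, hnw, Complex.norm_real, norm_smul]
    have hc := fourierConst_pos
    simp only [Real.norm_eq_abs, sq_abs, mul_pow, abs_mul, abs_pow, abs_norm]
    rw [abs_of_pos (by positivity)]
    -- The Sobolev weight refers to the frequency `p/(2π)`; rescaling to momentum only enlarges it,
    -- because `2π ≥ 1`.
    have : (1 + ‖p‖ ^ 2) ≤ 1 + (2 ^ 2 * Real.pi ^ 2) * ‖p‖ ^ 2 := by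
      have : 1 ≤ 2 ^ 2 * Real.pi ^ 2 := by nlinarith [Real.pi_gt_three]
      nlinarith [sq_nonneg ‖p‖]
    calc _ ≤ (1 + (2 ^ 2 * Real.pi ^ 2) * ‖p‖ ^ 2) * ‖(𝓕 α : L2) p‖ ^ 2 := by gcongr
      _ = _ := by
        field_simp
  refine ⟨hmem.toLp _, ?_⟩
  ext u
  have hwt : w.HasTemperateGrowth := by
    rw [hw]; fun_prop
  simp only [TemperedDistribution.smulLeftCLM_apply_apply, Lp.toTemperedDistribution_apply]
  refine integral_congr_ae ?_
  filter_upwards [hmem.coeFn_toLp] with x hx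
  rw [hx, SchwartzMap.smulLeftCLM_apply_apply hwt]
  simp only [smul_eq_mul, hf]
  ring

/-! ### Real interpolation and the Hausdorff-Young inequality. -/

/-- Chebyshev's inequality for a function that is bounded by a small constant plus a
square-integrable function. -/
lemma measure_lt_norm_le {g h : Space → ℂ} (hh : AEStronglyMeasurable h volume) {t : ℝ}
    (ht : 0 < t) (hgh : ∀ᵐ x, ‖g x‖ ≤ t / 2 + ‖h x‖) :
    volume {x | t < ‖g x‖} ≤ ENNReal.ofReal (4 / t ^ 2) * ∫⁻ x, ‖h x‖ₑ ^ 2 := by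
  have h1 : volume {x | t < ‖g x‖} ≤ volume {x | ENNReal.ofReal ((t / 2) ^ 2) ≤ ‖h x‖ₑ ^ 2} := by
    refine measure_mono_ae ?_
    filter_upwards [hgh] with x hx hlt
    have hlt' : t < ‖g x‖ := hlt
    change ENNReal.ofReal ((t / 2) ^ 2) ≤ ‖h x‖ₑ ^ 2
    rw [← ofReal_norm, ENNReal.ofReal_pow (by positivity)]
    gcongr
    linarith
  refine h1.trans ((meas_ge_le_lintegral_div (hh.enorm.pow_const 2) ?_ ?_).trans (le_of_eq ?_))
  · simp only [ne_eq, ENNReal.ofReal_eq_zero, not_le]; positivity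
  · exact ENNReal.ofReal_ne_top
  · rw [ENNReal.div_eq_inv_mul, ← ENNReal.ofReal_inv_of_pos (by positivity)]
    congr 2
    field_simp
    norm_num

/-- A real-interpolation bound: control of the distribution function of `g` by the weight `w` on
the superlevel sets of `ρ` gives control of a moment of `g`. -/
lemma lintegral_norm_rpow_le_of_distribution {g : Space → ℂ} (hg : AEStronglyMeasurable g volume)
    {w : Space → ℝ≥0∞} (hw : AEMeasurable w volume)
    {ρ : Space → ℝ} (hρ : AEMeasurable ρ volume) (hρ0 : ∀ x, 0 ≤ ρ x) {q : ℝ} (hq : 2 < q)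
    (h : ∀ t > 0, volume {x | t < ‖g x‖} ≤
      ENNReal.ofReal (4 / t ^ 2) * volume.withDensity w {p | t < ρ p}) :
    ∫⁻ x, ENNReal.ofReal (‖g x‖ ^ q) ≤
      ENNReal.ofReal (4 * q / (q - 2)) * ∫⁻ p, w p * ENNReal.ofReal (ρ p ^ (q - 2)) := by
  set ν := volume.withDensity w with hν
  have hρν : AEMeasurable ρ ν := hρ.mono_ac (withDensity_absolutelyContinuous _ _)
  -- Layer cake on both sides: for `‖g‖ ^ q` under Lebesgue measure and for `ρ ^ (q - 2)` under `w
  -- dp`. The factor `4 / t²` of the hypothesis accounts for the shift of the exponent by two.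
  have e1 := lintegral_rpow_eq_lintegral_meas_lt_mul (μ := volume) (f := fun x => ‖g x‖)
    (Eventually.of_forall fun x => norm_nonneg _) hg.norm.aemeasurable (p := q) (by linarith)
  have e2 := lintegral_rpow_eq_lintegral_meas_lt_mul (μ := ν) (f := ρ)
    (Eventually.of_forall fun x => hρ0 x) hρν (p := q - 2) (by linarith)
  have e3 : ∫⁻ p, w p * ENNReal.ofReal (ρ p ^ (q - 2)) = ∫⁻ p, ENNReal.ofReal (ρ p ^ (q - 2)) ∂ν := by
    rw [hν, lintegral_withDensity_eq_lintegral_mul₀ hw (by fun_prop)]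
    rfl
  rw [e1, e3, e2, ← mul_assoc, ← ENNReal.ofReal_mul (by
    have : 0 < q - 2 := by linarith
    positivity)]
  have hq2 : q - 2 ≠ 0 := by linarith
  have e4 : 4 * q / (q - 2) * (q - 2) = q * 4 := by field_simp
  rw [e4, ENNReal.ofReal_mul (by linarith), mul_assoc]
  gcongr
  rw [← lintegral_const_mul' _ _ (by finiteness)]
  refine lintegral_mono_ae ?_
  filter_upwards [ae_restrict_mem measurableSet_Ioi] with t ht
  have ht : 0 < t := ht
  calc _ ≤ (ENNReal.ofReal (4 / t ^ 2) * ν {p | t < ρ p}) * ENNReal.ofReal (t ^ (q - 1)) := by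
        gcongr; exact h t ht
    _ = ν {p | t < ρ p} * (ENNReal.ofReal (4 / t ^ 2) * ENNReal.ofReal (t ^ (q - 1))) := by ring
    _ = ν {p | t < ρ p} * (ENNReal.ofReal 4 * ENNReal.ofReal (t ^ (q - 2 - 1))) := by
        rw [← ENNReal.ofReal_mul (by positivity), ← ENNReal.ofReal_mul (by positivity)]
        congr 2
        have : t ^ (q - 1) = t ^ (q - 2 - 1) * t ^ 2 := by
          rw [← Real.rpow_natCast, ← Real.rpow_add ht]; congr 1; push_cast; ring
        rw [this]; field_simp
    _ ≤ _ := le_of_eq (by ring)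

lemma fourierConst_le_one : fourierConst ≤ 1 :=
  Real.rpow_le_one_of_one_le_of_nonpos (by nlinarith [Real.pi_gt_three]) (by norm_num)

lemma fourierIntegral_add {f g : Space → ℂ} (hf : Integrable f) (hg : Integrable g) (p : Space) :
    fourierIntegral (f + g) p = fourierIntegral f p + fourierIntegral g p := by
  simp only [fourierIntegral, Pi.add_apply, mul_add]
  rw [integral_add (integrable_planeWave_mul hf _) (integrable_planeWave_mul hg _), mul_add]

lemma fourierIntegral_sub {f g : Space → ℂ} (hf : Integrable f) (hg : Integrable g) (p : Space) :
    fourierIntegral (f - g) p = fourierIntegral f p - fourierIntegral g p := by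
  simp only [fourierIntegral, Pi.sub_apply, mul_sub]
  rw [integral_sub (integrable_planeWave_mul hf _) (integrable_planeWave_mul hg _), mul_sub]

lemma lintegral_fourierIntegral_sq {f : Space → ℂ} (h1 : Integrable f) (h2 : MemLp f 2 volume) :
    ∫⁻ p, ‖fourierIntegral f p‖ₑ ^ 2 = ∫⁻ x, ‖f x‖ₑ ^ 2 := by
  have e := (unitaryFourier).norm_map (h2.toLp f)
  rw [Lp.norm_def, Lp.norm_toLp, eLpNorm_congr_ae (unitaryFourier_toLp_ae_eq h1 h2),
    ENNReal.toReal_eq_toReal_iff' _ h2.2.ne, eLpNorm_two_eq, eLpNorm_two_eq] at e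
  · exact ENNReal.rpow_left_injective (by norm_num) e
  · rw [← eLpNorm_congr_ae (unitaryFourier_toLp_ae_eq h1 h2)]
    exact (Lp.memLp _).2.ne

lemma lintegral_unitaryFourier_sq (α : L2) :
    ∫⁻ p, ‖unitaryFourier α p‖ₑ ^ 2 = ∫⁻ x, ‖α x‖ₑ ^ 2 := by
  have e := (unitaryFourier).norm_map α
  rw [Lp.norm_def, Lp.norm_def, ENNReal.toReal_eq_toReal_iff' (Lp.memLp _).2.ne (Lp.memLp _).2.ne,
    eLpNorm_two_eq, eLpNorm_two_eq] at e
  exact ENNReal.rpow_left_injective (by norm_num) e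

/-- At level `t`, cut `f` at height `(r/t)²`. The large part has `L¹` norm at most `(t/r) ∫
‖f‖^(3/2) ≤ t/2`, so its transform never exceeds `t/2`; Chebyshev and Plancherel control the rest.
The condition `‖f‖ < (r/t)²` reads `t < r ‖f‖^(-1/2)`, which is the choice of `ρ`. Keeping `r` free
allows `r = 1` when `∫ ‖f‖^(3/2)` vanishes. -/
lemma lintegral_fourierIntegral_cube_le_aux {f : Space → ℂ} (h1 : Integrable f)
    (h2 : MemLp f 2 volume) (h3 : Integrable fun x => ‖f x‖ ^ (3 / 2 : ℝ)) {r : ℝ} (hr : 0 < r)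
    (hrN : 2 * ∫ x, ‖f x‖ ^ (3 / 2 : ℝ) ≤ r) :
    ∫⁻ p, ENNReal.ofReal (‖fourierIntegral f p‖ ^ (3 : ℝ)) ≤
      ENNReal.ofReal (12 * r) * ∫⁻ x, ENNReal.ofReal (‖f x‖ ^ (3 / 2 : ℝ)) := by
  set N := ∫ x, ‖f x‖ ^ (3 / 2 : ℝ) with hN
  have key := lintegral_norm_rpow_le_of_distribution (g := fourierIntegral f)
    (continuous_fourierIntegral h1).aestronglyMeasurable (w := fun x => ‖f x‖ₑ ^ 2)
    (h1.1.enorm.pow_const 2) (ρ := fun x => r * ‖f x‖ ^ (-(1 / 2) : ℝ))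
    ((h1.1.norm.aemeasurable.pow_const _).const_mul r) (fun x => by positivity)
    (q := 3) (by norm_num) ?_
  · refine key.trans (le_of_eq ?_)
    rw [show (4 * 3 / (3 - 2) : ℝ) = 12 by norm_num, ENNReal.ofReal_mul (by norm_num), mul_assoc]
    congr 1
    rw [← lintegral_const_mul' _ _ (by finiteness)]
    refine lintegral_congr fun x => ?_
    rw [show (3 - 2 : ℝ) = 1 by norm_num, Real.rpow_one, ENNReal.ofReal_mul hr.le, mul_left_comm,
      ← ofReal_norm, ← ENNReal.ofReal_pow (norm_nonneg _), ← ENNReal.ofReal_mul (by positivity)]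
    congr 2
    rcases eq_or_lt_of_le (norm_nonneg (f x)) with h0 | h0
    · rw [← h0, Real.zero_rpow (by norm_num)]; norm_num
    · rw [← Real.rpow_natCast, ← Real.rpow_add h0]; norm_num
  · intro t ht
    set s : Set Space := {x | r ^ 2 / t ^ 2 ≤ ‖f x‖} with hs
    have hsm : NullMeasurableSet s volume :=
      nullMeasurableSet_le aemeasurable_const h1.1.norm.aemeasurable
    -- The superlevel set is only null measurable; its measurable hull differs from it by a null
    -- set.
    set S := toMeasurable volume s with hS
    have hSm : MeasurableSet S := measurableSet_toMeasurable _ _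
    have hSs : S =ᵐ[volume] s := hsm.toMeasurable_ae_eq
    have hdec : f = S.indicator f + Sᶜ.indicator f := (Set.indicator_self_add_compl S f).symm
    have hbig : Integrable (S.indicator f) := h1.indicator hSm
    have hsmall1 : Integrable (Sᶜ.indicator f) := h1.indicator hSm.compl
    have hsmall2 : MemLp (Sᶜ.indicator f) 2 volume := h2.indicator hSm.compl
    have hb : ∫ x, ‖S.indicator f x‖ ≤ t / 2 := by
      calc _ ≤ ∫ x, (t / r) * ‖f x‖ ^ (3 / 2 : ℝ) := by
            refine integral_mono_ae hbig.norm (h3.const_mul _) ?_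
            filter_upwards [hSs.mem_iff] with x hx
            by_cases hxS : x ∈ S
            · have hxs : r ^ 2 / t ^ 2 ≤ ‖f x‖ := hx.1 hxS
              simp only [Set.indicator_of_mem hxS]
              have hpos : 0 < ‖f x‖ := lt_of_lt_of_le (by positivity) hxs
              have : r / t ≤ ‖f x‖ ^ (1 / 2 : ℝ) := by
                rw [← Real.sqrt_eq_rpow]
                refine Real.le_sqrt_of_sq_le ?_
                rw [div_pow]; exact hxs
              have e : ‖f x‖ ^ (3 / 2 : ℝ) = ‖f x‖ * ‖f x‖ ^ (1 / 2 : ℝ) := by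
                nth_rewrite 2 [← Real.rpow_one ‖f x‖]
                rw [← Real.rpow_add hpos]; norm_num
              rw [e]
              calc ‖f x‖ = (t / r) * (‖f x‖ * (r / t)) := by field_simp
                _ ≤ _ := by gcongr
            · simp only [Set.indicator_of_notMem hxS, norm_zero]; positivity
        _ = (t / r) * N := by rw [integral_const_mul]
        _ ≤ (t / r) * (r / 2) := by gcongr; linarith
        _ = t / 2 := by field_simp
    refine (measure_lt_norm_le (h := fourierIntegral (Sᶜ.indicator f))
      (continuous_fourierIntegral hsmall1).aestronglyMeasurable ht
      (Eventually.of_forall fun p => ?_)).trans ?_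
    · rw [hdec, fourierIntegral_add hbig hsmall1, ← hdec]
      refine (norm_add_le _ _).trans ?_
      gcongr
      refine (norm_fourierIntegral_le _ _).trans ?_
      calc _ ≤ 1 * ∫ x, ‖S.indicator f x‖ := by
            gcongr
            exact fourierConst_le_one
        _ ≤ _ := by rw [one_mul]; exact hb
    · gcongr
      rw [lintegral_fourierIntegral_sq hsmall1 hsmall2]
      have hT : NullMeasurableSet {p | t < r * ‖f p‖ ^ (-(1 / 2) : ℝ)} volume :=
        nullMeasurableSet_lt aemeasurable_const
          ((h1.1.norm.aemeasurable.pow_const _).const_mul r)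
      rw [withDensity_apply₀ _ hT, ← lintegral_indicator₀ hT]
      refine lintegral_mono_ae ?_
      filter_upwards [hSs.mem_iff] with x hx
      by_cases hxS : x ∈ S
      · rw [Set.indicator_of_notMem (by simpa using hxS)]; simp
      · rw [Set.indicator_of_mem (by simpa using hxS)]
        have hxs : ‖f x‖ < r ^ 2 / t ^ 2 := by
          by_contra hcon
          exact hxS (hx.2 (not_lt.1 hcon))
        rcases eq_or_lt_of_le (norm_nonneg (f x)) with h0 | h0
        -- Here `ρ` has the conventional value `0` instead of infinity, which is harmless because
        -- the weight vanishes.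
        · rw [← ofReal_norm, ← h0]; simp
        · rw [Set.indicator_of_mem]
          change t < r * ‖f x‖ ^ (-(1 / 2) : ℝ)
          rw [Real.rpow_neg h0.le, ← Real.sqrt_eq_rpow, ← div_eq_mul_inv, lt_div_iff₀
            (Real.sqrt_pos.2 h0), mul_comm, ← lt_div_iff₀ ht]
          rw [Real.sqrt_lt' (by positivity), div_pow]
          exact hxs

/-- The Hausdorff-Young inequality from `L^(3/2)` to `L³`, up to the constant. -/
lemma eLpNorm_fourierIntegral_le {f : Space → ℂ} (h1 : Integrable f) (h2 : MemLp f 2 volume)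
    (h3 : MemLp f (3 / 2) volume) :
    eLpNorm (fourierIntegral f) 3 volume ≤ 24 * eLpNorm f (3 / 2) volume := by
  have e32 : ((3 / 2 : ℝ≥0∞)).toReal = 3 / 2 := by simp
  have h3' : Integrable fun x => ‖f x‖ ^ (3 / 2 : ℝ) := by
    have := h3.integrable_norm_rpow (by norm_num) (by finiteness)
    rwa [e32] at this
  set N := ∫ x, ‖f x‖ ^ (3 / 2 : ℝ) with hN
  have hN0 : 0 ≤ N := integral_nonneg fun x => by positivity
  have eN : ∫⁻ x, ENNReal.ofReal (‖f x‖ ^ (3 / 2 : ℝ)) = ENNReal.ofReal N :=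
    (ofReal_integral_eq_lintegral_ofReal h3' (Eventually.of_forall fun x => by positivity)).symm
  have hmain : ∫⁻ p, ENNReal.ofReal (‖fourierIntegral f p‖ ^ (3 : ℝ)) ≤
      ENNReal.ofReal (24 * N ^ 2) := by
    rcases eq_or_lt_of_le hN0 with h0 | h0
    · have := lintegral_fourierIntegral_cube_le_aux h1 h2 h3' one_pos (by rw [← hN, ← h0]; norm_num)
      rw [eN, ← h0] at this
      rw [← h0]
      simpa using this
    · have := lintegral_fourierIntegral_cube_le_aux h1 h2 h3' (r := 2 * N) (by positivity) le_rfl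
      rw [eN, ← ENNReal.ofReal_mul (by positivity)] at this
      refine this.trans (le_of_eq ?_)
      congr 1; ring
  have eF : eLpNorm (fourierIntegral f) 3 volume =
      (∫⁻ p, ENNReal.ofReal (‖fourierIntegral f p‖ ^ (3 : ℝ))) ^ (1 / 3 : ℝ) := by
    rw [eLpNorm_eq_lintegral_rpow_enorm_toReal (by norm_num) (by norm_num)]
    simp only [ENNReal.toReal_ofNat]
    congr 1
    refine lintegral_congr fun p => ?_
    rw [← ofReal_norm, ENNReal.ofReal_rpow_of_nonneg (norm_nonneg _) (by norm_num)]
  have ef : eLpNorm f (3 / 2) volume = ENNReal.ofReal (N ^ (2 / 3 : ℝ)) := by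
    rw [eLpNorm_eq_lintegral_rpow_enorm_toReal (by norm_num) (by finiteness), e32,
      ← ENNReal.ofReal_rpow_of_nonneg hN0 (by norm_num), ← eN]
    congr 1
    · refine lintegral_congr fun p => ?_
      rw [← ofReal_norm, ENNReal.ofReal_rpow_of_nonneg (norm_nonneg _) (by norm_num)]
    · norm_num
  rw [eF, ef]
  calc _ ≤ (ENNReal.ofReal (24 * N ^ 2)) ^ (1 / 3 : ℝ) := by gcongr
    _ = ENNReal.ofReal (24 ^ (1 / 3 : ℝ) * N ^ (2 / 3 : ℝ)) := by
      rw [ENNReal.ofReal_rpow_of_nonneg (by positivity) (by norm_num),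
        Real.mul_rpow (by norm_num) (by positivity), ← Real.rpow_natCast, ← Real.rpow_mul hN0]
      norm_num
    _ ≤ ENNReal.ofReal (24 * N ^ (2 / 3 : ℝ)) := by
      gcongr
      calc (24 : ℝ) ^ (1 / 3 : ℝ) ≤ 24 ^ (1 : ℝ) :=
            Real.rpow_le_rpow_of_exponent_le (by norm_num) (by norm_num)
        _ = 24 := Real.rpow_one _
    _ = _ := by rw [ENNReal.ofReal_mul (by norm_num)]; norm_num

/-! ### Momentum cutoffs and the Sobolev inequality. -/

/-- The closed ball of momenta of size at most `A`. -/
abbrev momentumBall (A : ℝ) : Set Space := Metric.closedBall 0 A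

/-- The part of `α` with momenta in `s`. -/
def momentumRestrict (s : Set Space) (hs : MeasurableSet s) (α : L2) : L2 :=
  unitaryFourier.symm (((Lp.memLp (unitaryFourier α)).indicator hs).toLp _)

lemma unitaryFourier_momentumRestrict (s : Set Space) (hs : MeasurableSet s) (α : L2) :
    unitaryFourier (momentumRestrict s hs α) =ᵐ[volume] s.indicator (unitaryFourier α) := by
  rw [momentumRestrict, LinearIsometryEquiv.apply_symm_apply]
  exact MemLp.coeFn_toLp _

lemma momentumRestrict_add_compl (s : Set Space) (hs : MeasurableSet s) (α : L2) :
    momentumRestrict s hs α + momentumRestrict sᶜ hs.compl α = α := by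
  apply unitaryFourier.injective
  rw [map_add]
  refine Lp.ext ((Lp.coeFn_add _ _).trans ?_)
  filter_upwards [unitaryFourier_momentumRestrict s hs α,
    unitaryFourier_momentumRestrict sᶜ hs.compl α] with p h1 h2
  rw [Pi.add_apply, h1, h2, ← Pi.add_apply, Set.indicator_self_add_compl]

lemma lintegral_momentumRestrict_sq (s : Set Space) (hs : MeasurableSet s) (α : L2) :
    ∫⁻ x, ‖momentumRestrict s hs α x‖ₑ ^ 2 = ∫⁻ p in s, ‖unitaryFourier α p‖ₑ ^ 2 := by
  rw [← lintegral_unitaryFourier_sq, ← lintegral_indicator hs]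
  refine lintegral_congr_ae ?_
  filter_upwards [unitaryFourier_momentumRestrict s hs α] with p hp
  rw [hp]
  by_cases h : p ∈ s <;> simp [h]

lemma integrable_indicator_momentumBall (α : L2) (A : ℝ) :
    Integrable ((momentumBall A).indicator (unitaryFourier α : Space → ℂ)) := by
  rw [integrable_indicator_iff measurableSet_closedBall]
  exact ((Lp.memLp (unitaryFourier α)).locallyIntegrable (by norm_num)).integrableOn_isCompact
    (isCompact_closedBall 0 A)

lemma momentumRestrict_ball_ae_eq (α : L2) (A : ℝ) :
    momentumRestrict (momentumBall A) measurableSet_closedBall α =ᵐ[volume]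
      fun x => fourierIntegral ((momentumBall A).indicator (unitaryFourier α)) (-x) := by
  have h := unitaryFourier_momentumRestrict (momentumBall A) measurableSet_closedBall α
  refine (ae_eq_fourierIntegral_neg
    ((integrable_indicator_momentumBall α A).congr h.symm)).trans ?_
  exact Eventually.of_forall fun x => fourierIntegral_congr h _

/-- The integral of `|p|⁻²` over the unit ball, plus one. -/
def newtonConst : ℝ := (∫ p in momentumBall 1, ((‖p‖ ^ 2)⁻¹ : ℝ)) + 1

/-- The added one in `newtonConst` gives positivity without evaluating the integral. -/
lemma newtonConst_pos : 0 < newtonConst := by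
  have : 0 ≤ ∫ p in momentumBall 1, ((‖p‖ ^ 2)⁻¹ : ℝ) := integral_nonneg fun p => by positivity
  unfold newtonConst; linarith

lemma integrableOn_inv_norm_sq (A : ℝ) :
    IntegrableOn (fun p : Space => ((‖p‖ ^ 2)⁻¹ : ℝ)) (momentumBall A) := by
  refine (integrableOn_ball_of_norm_le_rpow (μ := (volume : Measure Space)) (C := 1) (α := 2)
    (r := A + 1) (by simp) (by simp; norm_num) (Eventually.of_forall fun p => ?_)
    (by fun_prop)).mono_set
    (Metric.closedBall_subset_ball (by linarith))
  rw [Real.norm_of_nonneg (by positivity), one_mul, Real.rpow_neg (norm_nonneg _)]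
  norm_num

open scoped Pointwise in
-- Scaling: dilation by `A` contributes `A³` from the volume and `A⁻²` from the integrand.
lemma setIntegral_inv_norm_sq_le {A : ℝ} (hA : 0 < A) :
    ∫ p in momentumBall A, ((‖p‖ ^ 2)⁻¹ : ℝ) ≤ newtonConst * A := by
  have h := Measure.setIntegral_comp_smul_of_pos (volume : Measure Space)
    (fun p : Space => ((‖p‖ ^ 2)⁻¹ : ℝ)) (momentumBall 1) hA
  have e : A • momentumBall 1 = momentumBall A := by
    rw [smul_closedBall _ _ zero_le_one]; simp [abs_of_pos hA]
  rw [e, finrank_euclideanSpace_fin] at h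
  simp only [norm_smul, Real.norm_of_nonneg hA.le, mul_pow, mul_inv, smul_eq_mul] at h
  rw [integral_const_mul] at h
  have h2 : ∫ p in momentumBall A, ((‖p‖ ^ 2)⁻¹ : ℝ) =
      A * ∫ p in momentumBall 1, ((‖p‖ ^ 2)⁻¹ : ℝ) := by
    field_simp at h
    simpa only [one_div] using h.symm
  rw [h2, newtonConst]
  nlinarith

lemma ae_ne_zero : ∀ᵐ p : Space, p ≠ 0 := by
  have : (volume : Measure Space) {0} = 0 := measure_singleton 0
  exact compl_mem_ae_iff.2 this

/-- The (unsquared) kinetic energy of a pair wave function. -/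
def kinetic (α : L2) : ℝ := ∫ p, ‖p‖ ^ 2 * ‖unitaryFourier α p‖ ^ 2

lemma kinetic_nonneg (α : L2) : 0 ≤ kinetic α := integral_nonneg fun p => by positivity

/-- The sup norm is at most the `L¹` norm of the cut-off `α̂`. Integrate `|α̂| ≤ τ/(2|p|²) +
|p|²|α̂|²/(2τ)` over the ball, where `|p|⁻²` is integrable in dimension three. The parameter `τ`
remains free for optimization. -/
lemma norm_fourierIntegral_indicator_le {α : L2}
    (hα : Integrable fun p => ‖p‖ ^ 2 * ‖unitaryFourier α p‖ ^ 2) {A τ : ℝ} (hA : 0 < A)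
    (hτ : 0 < τ) (x : Space) :
    ‖fourierIntegral ((momentumBall A).indicator (unitaryFourier α)) x‖ ≤
      (τ * (newtonConst * A) + kinetic α / τ) / 2 := by
  have h0 : 0 ≤ ∫ p, ‖(momentumBall A).indicator (unitaryFourier α : Space → ℂ) p‖ :=
    integral_nonneg fun p => norm_nonneg _
  have h1 : Integrable ((momentumBall A).indicator fun p : Space => ((‖p‖ ^ 2)⁻¹ : ℝ)) :=
    (integrable_indicator_iff measurableSet_closedBall).2 (integrableOn_inv_norm_sq A)
  calc _ ≤ 1 * ∫ p, ‖(momentumBall A).indicator (unitaryFourier α : Space → ℂ) p‖ :=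
        (norm_fourierIntegral_le _ _).trans (by gcongr; exact fourierConst_le_one)
    _ = ∫ p, ‖(momentumBall A).indicator (unitaryFourier α : Space → ℂ) p‖ := one_mul _
    _ ≤ ∫ p, (τ / 2 * (momentumBall A).indicator (fun p : Space => ((‖p‖ ^ 2)⁻¹ : ℝ)) p +
          (1 / (2 * τ)) * (‖p‖ ^ 2 * ‖unitaryFourier α p‖ ^ 2)) := by
        refine integral_mono_ae (integrable_indicator_momentumBall α A).norm
          ((h1.const_mul _).add (hα.const_mul _)) ?_
        filter_upwards [ae_ne_zero] with p hp
        have hp' : 0 < ‖p‖ := norm_pos_iff.2 hp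
        by_cases hpA : p ∈ momentumBall A
        · simp only [Set.indicator_of_mem hpA]
          set a := ‖unitaryFourier α p‖
          have := sq_nonneg (τ * ‖p‖⁻¹ - ‖p‖ * a)
          have e : τ / 2 * (‖p‖ ^ 2)⁻¹ + (1 / (2 * τ)) * (‖p‖ ^ 2 * a ^ 2) - a =
            (1 / (2 * τ)) * (τ * ‖p‖⁻¹ - ‖p‖ * a) ^ 2 := by field_simp; ring
          have : 0 ≤ (1 / (2 * τ)) * (τ * ‖p‖⁻¹ - ‖p‖ * a) ^ 2 := by positivity
          linarith
        · simp only [Set.indicator_of_notMem hpA, norm_zero]; positivity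
    _ = τ / 2 * (∫ p in momentumBall A, ((‖p‖ ^ 2)⁻¹ : ℝ)) + (1 / (2 * τ)) * kinetic α := by
        rw [integral_add (h1.const_mul _) (hα.const_mul _), integral_const_mul,
          integral_const_mul, integral_indicator measurableSet_closedBall, kinetic]
    _ ≤ τ / 2 * (newtonConst * A) + (1 / (2 * τ)) * kinetic α := by
        gcongr; exact setIntegral_inv_norm_sq_le hA
    _ = _ := by field_simp

/-- The interpolation scheme again, now cutting in momentum at `A = t²/r`. The low momenta give a
function bounded by `t/2` and the high ones are controlled by Plancherel. The condition `|p| > A`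
reads `t < √(r|p|)`, so `ρ⁴ = r²|p|²` produces the kinetic energy. -/
lemma lintegral_norm_pow_six_le_aux {α : L2}
    (hα : Integrable fun p => ‖p‖ ^ 2 * ‖unitaryFourier α p‖ ^ 2) {r : ℝ} (hr : 0 < r)
    (hrK : 4 * newtonConst * kinetic α ≤ r) :
    ∫⁻ x, ENNReal.ofReal (‖α x‖ ^ (6 : ℝ)) ≤ ENNReal.ofReal (6 * r ^ 2 * kinetic α) := by
  have hN := newtonConst_pos
  have key := lintegral_norm_rpow_le_of_distribution (g := (α : Space → ℂ)) (Lp.memLp α).1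
    (w := fun p => ‖unitaryFourier α p‖ₑ ^ 2) ((Lp.memLp (unitaryFourier α)).1.enorm.pow_const 2)
    (ρ := fun p => Real.sqrt (r * ‖p‖)) (by fun_prop) (fun p => Real.sqrt_nonneg _)
    (q := 6) (by norm_num) ?_
  · refine key.trans (le_of_eq ?_)
    rw [show (4 * 6 / (6 - 2) : ℝ) = 6 by norm_num, mul_assoc, ENNReal.ofReal_mul (by norm_num)]
    congr 1
    rw [kinetic, ← integral_const_mul, ofReal_integral_eq_lintegral_ofReal (hα.const_mul _)
      (Eventually.of_forall fun p => by positivity)]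
    refine lintegral_congr fun p => ?_
    rw [← ofReal_norm, ← ENNReal.ofReal_pow (norm_nonneg _), ← ENNReal.ofReal_mul (by positivity)]
    congr 1
    have : Real.sqrt (r * ‖p‖) ^ (6 - 2 : ℝ) = (r * ‖p‖) ^ 2 := by
      rw [show (6 - 2 : ℝ) = ((4 : ℕ) : ℝ) by norm_num, Real.rpow_natCast,
        show (4 : ℕ) = 2 * 2 by norm_num, pow_mul, Real.sq_sqrt (by positivity)]
    rw [this]; ring
  · intro t ht
    set A := t ^ 2 / r with hA
    have hA0 : 0 < A := by positivity
    set lo := momentumRestrict (momentumBall A) measurableSet_closedBall α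
    set hi := momentumRestrict (momentumBall A)ᶜ measurableSet_closedBall.compl α
    have hsum : lo + hi = α := momentumRestrict_add_compl _ _ _
    refine (measure_lt_norm_le (h := (hi : Space → ℂ)) (Lp.memLp hi).1 ht ?_).trans ?_
    · have hadd := Lp.coeFn_add lo hi
      rw [hsum] at hadd
      filter_upwards [hadd, momentumRestrict_ball_ae_eq α A] with x hx hlo
      rw [hx]
      refine (norm_add_le _ _).trans ?_
      gcongr
      rw [hlo]
      -- This `τ` makes the first term exactly `t/4`; the lower bound on `r` makes the second at
      -- most `t/4`.
      refine (norm_fourierIntegral_indicator_le hα hA0 (τ := t / (2 * (newtonConst * A)))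
        (by positivity) _).trans ?_
      have e : (t / (2 * (newtonConst * A)) * (newtonConst * A) +
          kinetic α / (t / (2 * (newtonConst * A)))) / 2 =
          t / 4 + t / 4 * (4 * newtonConst * kinetic α / r) := by
        rw [hA]; field_simp; ring
      rw [e]
      have : 4 * newtonConst * kinetic α / r ≤ 1 := (div_le_one hr).2 hrK
      nlinarith
    · gcongr
      have hT : MeasurableSet {p : Space | t < Real.sqrt (r * ‖p‖)} :=
        measurableSet_lt measurable_const (by fun_prop)
      rw [lintegral_momentumRestrict_sq, withDensity_apply _ hT]
      refine lintegral_mono_set fun p hp => ?_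
      have hp' : A < ‖p‖ := by simpa using hp
      change t < Real.sqrt (r * ‖p‖)
      rw [Real.lt_sqrt ht.le]
      rw [hA, div_lt_iff₀ hr] at hp'
      linarith

/-- The Sobolev inequality `‖α‖₆ ≤ C ‖∇α‖₂` in three dimensions. -/
lemma lintegral_norm_pow_six_le {α : L2}
    (hα : Integrable fun p => ‖p‖ ^ 2 * ‖unitaryFourier α p‖ ^ 2) :
    ∫⁻ x, ENNReal.ofReal (‖α x‖ ^ (6 : ℝ)) ≤
      ENNReal.ofReal (96 * newtonConst ^ 2 * kinetic α ^ 3) := by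
  have hN := newtonConst_pos
  rcases eq_or_lt_of_le (kinetic_nonneg α) with h0 | h0
  · have := lintegral_norm_pow_six_le_aux hα one_pos (by rw [← h0]; norm_num)
    rw [← h0] at this ⊢
    simpa using this
  · refine (lintegral_norm_pow_six_le_aux hα (r := 4 * newtonConst * kinetic α)
      (by positivity) le_rfl).trans (le_of_eq ?_)
    congr 1; ring

/-! ### Form bounds and truncation of the potential. -/

/-- The constant in the form bound of `V ∈ L^(3/2)` by the kinetic energy. -/
def sobolevConst : ℝ := (96 * newtonConst ^ 2) ^ (1 / 3 : ℝ)

lemma sobolevConst_pos : 0 < sobolevConst := by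
  have := newtonConst_pos
  unfold sobolevConst; positivity

/-- The `L^(3/2)` norm of a potential. -/
def potentialNorm (V : Space → ℝ) : ℝ := (eLpNorm V (3 / 2) volume).toReal

lemma potentialNorm_nonneg (V : Space → ℝ) : 0 ≤ potentialNorm V := ENNReal.toReal_nonneg

/-- Hölder with exponents `3` and `3/2`, followed by the Sobolev inequality for `‖|α|²‖₃ = ‖α‖₆²`.
-/
lemma lintegral_norm_sq_mul_le {V : Space → ℝ} (hV : MemLp V (3 / 2) volume) {α : L2}
    (hα : Integrable fun p => ‖p‖ ^ 2 * ‖unitaryFourier α p‖ ^ 2) :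
    ∫⁻ x, ‖‖α x‖ ^ 2 * V x‖ₑ ≤ ENNReal.ofReal (sobolevConst * potentialNorm V * kinetic α) := by
  have hN := newtonConst_pos
  have hK := kinetic_nonneg α
  have hconj : (3 : ℝ).HolderConjugate (3 / 2) := by
    rw [Real.holderConjugate_iff]; norm_num
  have h := ENNReal.lintegral_mul_le_Lp_mul_Lq (volume : Measure Space) hconj
    (f := fun x => ENNReal.ofReal (‖α x‖ ^ 2)) (g := fun x => ‖V x‖ₑ)
    ((Lp.memLp α).1.norm.aemeasurable.pow_const 2).ennreal_ofReal hV.1.enorm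
  have e1 : ∀ x, ‖‖α x‖ ^ 2 * V x‖ₑ = ((fun x => ENNReal.ofReal (‖α x‖ ^ 2)) * fun x => ‖V x‖ₑ) x :=
    fun x => by
      rw [enorm_mul, Pi.mul_apply]
      congr 1
      rw [← ofReal_norm, Real.norm_of_nonneg (by positivity)]
  simp only [e1]
  refine h.trans ?_
  have e2 : (∫⁻ x, ENNReal.ofReal (‖α x‖ ^ 2) ^ (3 : ℝ)) ^ (1 / 3 : ℝ) ≤
      ENNReal.ofReal (sobolevConst * kinetic α) := by
    have e3 : ∫⁻ x, ENNReal.ofReal (‖α x‖ ^ 2) ^ (3 : ℝ) =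
        ∫⁻ x, ENNReal.ofReal (‖α x‖ ^ (6 : ℝ)) := by
      refine lintegral_congr fun x => ?_
      rw [ENNReal.ofReal_rpow_of_nonneg (by positivity) (by norm_num)]
      congr 1
      rw [← Real.rpow_natCast, ← Real.rpow_mul (norm_nonneg _)]
      norm_num
    rw [e3]
    calc _ ≤ (ENNReal.ofReal (96 * newtonConst ^ 2 * kinetic α ^ 3)) ^ (1 / 3 : ℝ) := by
          gcongr; exact lintegral_norm_pow_six_le hα
      _ = _ := by
          rw [ENNReal.ofReal_rpow_of_nonneg (by positivity) (by norm_num),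
            Real.mul_rpow (by positivity) (by positivity), ← Real.rpow_natCast (kinetic α),
            ← Real.rpow_mul hK, sobolevConst]
          norm_num
  have e4 : (∫⁻ x, ‖V x‖ₑ ^ (3 / 2 : ℝ)) ^ (1 / (3 / 2) : ℝ) = ENNReal.ofReal (potentialNorm V) := by
    rw [potentialNorm, ENNReal.ofReal_toReal hV.2.ne,
      eLpNorm_eq_lintegral_rpow_enorm_toReal (by norm_num) (by finiteness)]
    simp
  rw [e4]
  calc _ ≤ ENNReal.ofReal (sobolevConst * kinetic α) * ENNReal.ofReal (potentialNorm V) := by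
        gcongr
    _ = _ := by
        rw [← ENNReal.ofReal_mul (mul_nonneg sobolevConst_pos.le hK)]
        congr 1; ring

lemma integrable_norm_sq_mul {V : Space → ℝ} (hV : MemLp V (3 / 2) volume) {α : L2}
    (hα : Integrable fun p => ‖p‖ ^ 2 * ‖unitaryFourier α p‖ ^ 2) :
    Integrable fun x => ‖α x‖ ^ 2 * V x :=
  ⟨((Lp.memLp α).1.norm.pow 2).mul hV.1,
    (lintegral_norm_sq_mul_le hV hα).trans_lt ENNReal.ofReal_lt_top⟩

/-- The potential energy `∫ |α|² V`. -/
def potentialEnergy (V : Space → ℝ) (α : L2) : ℝ := ∫ x, ‖α x‖ ^ 2 * V x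

lemma abs_potentialEnergy_le {V : Space → ℝ} (hV : MemLp V (3 / 2) volume) {α : L2}
    (hα : Integrable fun p => ‖p‖ ^ 2 * ‖unitaryFourier α p‖ ^ 2) :
    |potentialEnergy V α| ≤ sobolevConst * potentialNorm V * kinetic α := by
  rw [← Real.norm_eq_abs, potentialEnergy]
  refine (norm_integral_le_lintegral_norm _).trans ?_
  refine ENNReal.toReal_le_of_le_ofReal (mul_nonneg (mul_nonneg sobolevConst_pos.le
    (potentialNorm_nonneg V)) (kinetic_nonneg α)) ?_
  simp only [ofReal_norm]
  exact lintegral_norm_sq_mul_le hV hα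

/-- The truncation of a potential to where both it and the position are bounded by `n`. -/
def truncation (V : Space → ℝ) (n : ℕ) : Space → ℝ :=
  (momentumBall n ∩ {x | ‖V x‖ ≤ n}).indicator V

lemma norm_truncation_le (V : Space → ℝ) (n : ℕ) (x : Space) : ‖truncation V n x‖ ≤ n := by
  unfold truncation
  by_cases h : x ∈ momentumBall n ∩ {x | ‖V x‖ ≤ n}
  · rw [Set.indicator_of_mem h]; exact h.2
  · rw [Set.indicator_of_notMem h, norm_zero]; positivity

lemma norm_sub_truncation_le (V : Space → ℝ) (n : ℕ) (x : Space) :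
    ‖V x - truncation V n x‖ ≤ ‖V x‖ := by
  unfold truncation
  by_cases h : x ∈ momentumBall n ∩ {x | ‖V x‖ ≤ n}
  · rw [Set.indicator_of_mem h]; simp
  · rw [Set.indicator_of_notMem h, sub_zero]

lemma aestronglyMeasurable_truncation {V : Space → ℝ} (hV : AEStronglyMeasurable V volume)
    (n : ℕ) : AEStronglyMeasurable (truncation V n) volume :=
  hV.indicator₀ (measurableSet_closedBall.nullMeasurableSet.inter
    (nullMeasurableSet_le hV.norm.aemeasurable aemeasurable_const))

lemma tendsto_truncation (V : Space → ℝ) (x : Space) :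
    ∀ᶠ n : ℕ in atTop, truncation V n x = V x := by
  obtain ⟨N, hN⟩ := exists_nat_ge (max ‖x‖ ‖V x‖)
  filter_upwards [eventually_ge_atTop N] with n hn
  have hn' : (N : ℝ) ≤ n := by exact_mod_cast hn
  refine Set.indicator_of_mem (s := momentumBall n ∩ {x | ‖V x‖ ≤ n}) ⟨?_, ?_⟩ V
  · simpa using (le_max_left _ _).trans (hN.trans hn')
  · exact (le_max_right _ _).trans (hN.trans hn')

lemma memLp_truncation {V : Space → ℝ} (hV : AEStronglyMeasurable V volume) (n : ℕ) (p : ℝ≥0∞) :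
    MemLp (truncation V n) p volume := by
  have h : MemLp ((momentumBall n).indicator fun _ => (n : ℝ)) p volume :=
    memLp_indicator_const p measurableSet_closedBall _
      (Or.inr (isCompact_closedBall _ _).measure_lt_top.ne)
  refine h.mono (aestronglyMeasurable_truncation hV n) (Eventually.of_forall fun x => ?_)
  by_cases hx : x ∈ momentumBall (n : ℝ)
  · rw [Set.indicator_of_mem hx]
    simpa using norm_truncation_le V n x
  · rw [truncation, Set.indicator_of_notMem (fun h => hx h.1)]
    simp

lemma memLp_sub_truncation {V : Space → ℝ} (hV : MemLp V (3 / 2) volume) (n : ℕ) :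
    MemLp (V - truncation V n) (3 / 2) volume := hV.sub (memLp_truncation hV.1 n _)

lemma tendsto_eLpNorm_sub_truncation {V : Space → ℝ} (hV : MemLp V (3 / 2) volume) :
    Tendsto (fun n => eLpNorm (V - truncation V n) (3 / 2) volume) atTop (𝓝 0) := by
  have e : ∀ n, eLpNorm (V - truncation V n) (3 / 2) volume =
      (∫⁻ x, ‖V x - truncation V n x‖ₑ ^ (3 / 2 : ℝ)) ^ (2 / 3 : ℝ) := fun n => by
    rw [eLpNorm_eq_lintegral_rpow_enorm_toReal (by norm_num) (by finiteness)]
    simp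
  simp only [e]
  have hfin : ∫⁻ x, ‖V x‖ₑ ^ (3 / 2 : ℝ) ≠ ∞ := by
    have := (eLpNorm_lt_top_iff_lintegral_rpow_enorm_lt_top (by norm_num) (by finiteness)).1 hV.2
    simpa using this.ne
  have h : Tendsto (fun n => ∫⁻ x, ‖V x - truncation V n x‖ₑ ^ (3 / 2 : ℝ)) atTop
      (𝓝 (∫⁻ _ : Space, 0)) := by
    refine tendsto_lintegral_of_dominated_convergence' (fun x => ‖V x‖ₑ ^ (3 / 2 : ℝ))
      (fun n => ?_) (fun n => Eventually.of_forall fun x => ?_) hfin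
      (Eventually.of_forall fun x => ?_)
    · exact (hV.1.sub (aestronglyMeasurable_truncation hV.1 n)).enorm.pow_const _
    · have := norm_sub_truncation_le V n x
      have : ‖V x - truncation V n x‖ₑ ≤ ‖V x‖ₑ := by
        rw [← ofReal_norm, ← ofReal_norm]; exact ENNReal.ofReal_le_ofReal this
      exact ENNReal.rpow_le_rpow this (by norm_num)
    · refine tendsto_const_nhds.congr' ?_
      filter_upwards [tendsto_truncation V x] with n hn
      rw [hn, sub_self]; simp
  rw [lintegral_zero] at h
  have h2 := (ENNReal.continuous_rpow_const (y := (2 / 3 : ℝ))).tendsto 0 |>.comp h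
  simpa [Function.comp_def] using h2

lemma tendsto_potentialNorm_sub_truncation {V : Space → ℝ} (hV : MemLp V (3 / 2) volume) :
    Tendsto (fun n => potentialNorm (V - truncation V n)) atTop (𝓝 0) := by
  have := (ENNReal.tendsto_toReal ENNReal.zero_ne_top).comp (tendsto_eLpNorm_sub_truncation hV)
  simpa using! this

lemma integrable_norm_sq (α : L2) : Integrable fun x => ‖α x‖ ^ 2 :=
  (memLp_two_iff_integrable_norm_sq (Lp.memLp α).1).1 (Lp.memLp α)

lemma norm_sq_eq_integral (α : L2) : ‖α‖ ^ 2 = ∫ x, ‖α x‖ ^ 2 := by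
  have h := @inner_self_eq_norm_sq ℂ L2 _ _ _ α
  rw [← h, L2_inner_eq]
  have : ∀ x, conj (α x) * α x = ((‖α x‖ ^ 2 : ℝ) : ℂ) := fun x => by
    rw [Complex.conj_mul']; push_cast; rfl
  simp only [this]
  rw [show ∫ x, ((‖α x‖ ^ 2 : ℝ) : ℂ) = ((∫ x, ‖α x‖ ^ 2 : ℝ) : ℂ) from integral_ofReal]
  simp

lemma integrable_norm_sq_mul_of_bounded {W : Space → ℝ} (hW : AEStronglyMeasurable W volume)
    {M : ℝ} (hM : ∀ x, ‖W x‖ ≤ M) (α : L2) : Integrable fun x => ‖α x‖ ^ 2 * W x :=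
  (integrable_norm_sq α).mul_bdd hW (Eventually.of_forall hM)

lemma abs_potentialEnergy_le_of_bounded {W : Space → ℝ}
    {M : ℝ} (hM : ∀ x, ‖W x‖ ≤ M) (α : L2) : |potentialEnergy W α| ≤ M * ‖α‖ ^ 2 := by
  rw [norm_sq_eq_integral, ← integral_const_mul, ← Real.norm_eq_abs]
  refine norm_integral_le_of_norm_le ((integrable_norm_sq α).const_mul _)
    (Eventually.of_forall fun x => ?_)
  rw [norm_mul, mul_comm, Real.norm_of_nonneg (sq_nonneg _)]
  gcongr
  exact hM x

lemma potentialEnergy_sub_truncation {V : Space → ℝ} (hV : MemLp V (3 / 2) volume) (n : ℕ)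
    {α : L2} (hα : Integrable fun p => ‖p‖ ^ 2 * ‖unitaryFourier α p‖ ^ 2) :
    potentialEnergy V α - potentialEnergy (truncation V n) α =
      potentialEnergy (V - truncation V n) α := by
  unfold potentialEnergy
  rw [← integral_sub (integrable_norm_sq_mul hV hα)
    (integrable_norm_sq_mul (memLp_truncation hV.1 n _) hα)]
  simp only [Pi.sub_apply, mul_sub]

/-- A potential in `L^(3/2)` is infinitesimally form bounded with respect to the kinetic energy. -/
lemma exists_potentialEnergy_bound {V : Space → ℝ} (hV : MemLp V (3 / 2) volume) {ε : ℝ}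
    (hε : 0 < ε) : ∃ C : ℝ, 0 ≤ C ∧ ∀ α : L2,
      (Integrable fun p => ‖p‖ ^ 2 * ‖unitaryFourier α p‖ ^ 2) →
      |potentialEnergy V α| ≤ ε * kinetic α + C * ‖α‖ ^ 2 := by
  have hS := sobolevConst_pos
  -- Truncate so far that the Sobolev bound on the remainder has constant below `ε`; the truncated
  -- potential is bounded by `n`, which serves as `C`.
  obtain ⟨n, hn⟩ := ((tendsto_potentialNorm_sub_truncation hV).eventually
    (gt_mem_nhds (show 0 < ε / sobolevConst by positivity))).exists
  refine ⟨n, by positivity, fun α hα => ?_⟩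
  have e := potentialEnergy_sub_truncation hV n hα
  have h1 := abs_potentialEnergy_le (memLp_sub_truncation hV n) hα
  have h2 := abs_potentialEnergy_le_of_bounded (norm_truncation_le V n) α
  have h3 : sobolevConst * potentialNorm (V - truncation V n) ≤ ε := by
    rw [lt_div_iff₀ hS] at hn; linarith
  have h4 := mul_le_mul_of_nonneg_right h3 (kinetic_nonneg α)
  calc |potentialEnergy V α| = |potentialEnergy (V - truncation V n) α +
        potentialEnergy (truncation V n) α| := by rw [← e]; ring_nf
    _ ≤ _ := (abs_add_le _ _).trans (by linarith)

/-! ### Weak continuity of the potential energy. -/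

/-- A limit can be checked along uniform approximations of the sequence. -/
lemma tendsto_of_uniform_approx {u : ℕ → ℝ} {a : ℝ}
    (h : ∀ ε > 0, ∃ v : ℕ → ℝ, ∃ b, Tendsto v atTop (𝓝 b) ∧ (∀ n, |u n - v n| ≤ ε) ∧ |a - b| ≤ ε) :
    Tendsto u atTop (𝓝 a) := by
  rw [Metric.tendsto_atTop]
  intro ε hε
  obtain ⟨v, b, hv, h1, h2⟩ := h (ε / 4) (by positivity)
  obtain ⟨N, hN⟩ := Metric.tendsto_atTop.1 hv (ε / 4) (by positivity)
  refine ⟨N, fun n hn => ?_⟩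
  have h3 := hN n hn
  have h4 := h1 n
  rw [Real.dist_eq] at h3 ⊢
  rw [abs_le] at h2 h4
  rw [abs_lt] at h3 ⊢
  constructor <;> linarith

lemma norm_momentumRestrict_le (s : Set Space) (hs : MeasurableSet s) (α : L2) :
    ‖momentumRestrict s hs α‖ ≤ ‖α‖ := by
  rw [momentumRestrict, LinearIsometryEquiv.norm_map, ← unitaryFourier.norm_map α, Lp.norm_toLp,
    Lp.norm_def]
  exact ENNReal.toReal_mono (Lp.memLp _).2.ne (eLpNorm_indicator_le _)

lemma norm_sq_momentumRestrict_compl_le {α : L2}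
    (hα : Integrable fun p => ‖p‖ ^ 2 * ‖unitaryFourier α p‖ ^ 2) {A : ℝ} (hA : 0 < A) :
    ‖momentumRestrict (momentumBall A)ᶜ measurableSet_closedBall.compl α‖ ^ 2 ≤
      kinetic α / A ^ 2 := by
  rw [← unitaryFourier.norm_map, norm_sq_eq_integral, kinetic, ← integral_div]
  refine integral_mono_ae (integrable_norm_sq _) (hα.div_const _) ?_
  filter_upwards [unitaryFourier_momentumRestrict (momentumBall A)ᶜ
    measurableSet_closedBall.compl α] with p hp
  rw [hp]
  by_cases h : p ∈ (momentumBall A)ᶜ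
  · rw [Set.indicator_of_mem h, le_div_iff₀ (by positivity), mul_comm]
    have : A < ‖p‖ := by simpa using h
    gcongr
  · rw [Set.indicator_of_notMem h, norm_zero, zero_pow two_ne_zero]
    positivity

/-- With `a` and `b` the sizes of the low and high momentum parts, the squares differ by at most
`2ab + b² ≤ a²/A + (1 + A) b²`. Since `∫ b²` is at most the kinetic energy over `A²`, the error is
of order `1/A`, uniformly on bounded sets. -/
lemma abs_potentialEnergy_sub_le {W : Space → ℝ} (hW : AEStronglyMeasurable W volume)
    {M : ℝ} (hM : ∀ x, ‖W x‖ ≤ M) {α : L2}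
    (hα : Integrable fun p => ‖p‖ ^ 2 * ‖unitaryFourier α p‖ ^ 2) {A : ℝ} (hA : 0 < A) :
    |potentialEnergy W α - potentialEnergy W
        (momentumRestrict (momentumBall A) measurableSet_closedBall α)| ≤
      M * (‖α‖ ^ 2 / A + (1 + A) * (kinetic α / A ^ 2)) := by
  set lo := momentumRestrict (momentumBall A) measurableSet_closedBall α with hlo
  set hi := momentumRestrict (momentumBall A)ᶜ measurableSet_closedBall.compl α with hhi
  have hM0 : 0 ≤ M := (norm_nonneg _).trans (hM 0)
  have hsum : lo + hi = α := momentumRestrict_add_compl _ _ _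
  have hadd := Lp.coeFn_add lo hi
  rw [hsum] at hadd
  have h1 : |potentialEnergy W α - potentialEnergy W lo| ≤
      ∫ x, M * (‖lo x‖ ^ 2 / A + (1 + A) * ‖hi x‖ ^ 2) := by
    unfold potentialEnergy
    rw [← integral_sub (integrable_norm_sq_mul_of_bounded hW hM _)
      (integrable_norm_sq_mul_of_bounded hW hM _), ← Real.norm_eq_abs]
    refine norm_integral_le_of_norm_le ((((integrable_norm_sq lo).div_const A).add
      ((integrable_norm_sq hi).const_mul (1 + A))).const_mul M) ?_
    filter_upwards [hadd] with x hx
    rw [hx, Pi.add_apply, ← sub_mul, norm_mul, mul_comm]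
    refine mul_le_mul (hM x) ?_ (norm_nonneg _) hM0
    have t1 : ‖lo x + hi x‖ ≤ ‖lo x‖ + ‖hi x‖ := norm_add_le _ _
    have t2 : ‖lo x‖ ≤ ‖lo x + hi x‖ + ‖hi x‖ := by
      simpa using norm_sub_le (lo x + hi x) (hi x)
    have n1 := norm_nonneg (lo x)
    have n2 := norm_nonneg (hi x)
    have n3 := norm_nonneg (lo x + hi x)
    set a := ‖lo x‖
    set b := ‖hi x‖
    set c := ‖lo x + hi x‖
    have am : 2 * a * b ≤ a ^ 2 / A + A * b ^ 2 := by
      have : a ^ 2 / A + A * b ^ 2 - 2 * a * b = (a - A * b) ^ 2 / A := by field_simp; ring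
      have : 0 ≤ (a - A * b) ^ 2 / A := by positivity
      linarith
    rw [Real.norm_eq_abs, abs_le]
    constructor <;> nlinarith [sq_nonneg b]
  refine h1.trans ?_
  rw [integral_const_mul, integral_add ((integrable_norm_sq lo).div_const A)
      ((integrable_norm_sq hi).const_mul (1 + A)), integral_div, integral_const_mul,
      ← norm_sq_eq_integral, ← norm_sq_eq_integral]
  gcongr
  · exact norm_momentumRestrict_le _ _ _
  · exact norm_sq_momentumRestrict_compl_le hα hA

/-- The value at `x` is an inner product with a plane wave cut off to the ball, which lies in `L²`.
Weak convergence therefore becomes pointwise convergence. -/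
lemma tendsto_fourierIntegral_indicator {α : ℕ → L2} {α₀ : L2}
    (hweak : ∀ f : L2, Tendsto (fun n => inner ℂ f (unitaryFourier (α n))) atTop
      (𝓝 (inner ℂ f (unitaryFourier α₀)))) (A : ℝ) (x : Space) :
    Tendsto (fun n => fourierIntegral ((momentumBall A).indicator (unitaryFourier (α n))) x) atTop
      (𝓝 (fourierIntegral ((momentumBall A).indicator (unitaryFourier α₀)) x)) := by
  have hf0 : Continuous fun p : Space => planeWave x p := by fun_prop
  have hf : MemLp ((momentumBall A).indicator fun p => planeWave x p) 2 volume := by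
    refine (memLp_indicator_const (E := ℂ) 2 (measurableSet_closedBall (x := (0 : Space)) (ε := A)) 1
      (Or.inr (isCompact_closedBall _ _).measure_lt_top.ne)).mono
      (hf0.aestronglyMeasurable.indicator measurableSet_closedBall)
      (Eventually.of_forall fun p => ?_)
    by_cases h : p ∈ momentumBall A <;> simp [h, norm_planeWave]
  have key : ∀ β : L2, fourierIntegral ((momentumBall A).indicator (unitaryFourier β)) x =
      fourierConst * inner ℂ (hf.toLp _) (unitaryFourier β) := fun β => by
    rw [L2_inner_eq, fourierIntegral]
    congr 1
    refine integral_congr_ae ?_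
    filter_upwards [hf.coeFn_toLp] with p hp
    rw [hp]
    by_cases h : p ∈ momentumBall A
    · simp [h, conj_planeWave]
    · simp [h]
  simp only [key]
  exact (hweak _).const_mul _

/-- For a bounded integrable potential the potential energy is weakly continuous on sets of bounded
kinetic energy. -/
lemma tendsto_potentialEnergy_of_bounded {W : Space → ℝ} (hW : Integrable W)
    {M : ℝ} (hM : ∀ x, ‖W x‖ ≤ M) {α : ℕ → L2} {α₀ : L2}
    (hweak : ∀ f : L2, Tendsto (fun n => inner ℂ f (unitaryFourier (α n))) atTop
      (𝓝 (inner ℂ f (unitaryFourier α₀))))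
    (hα : ∀ n, Integrable fun p => ‖p‖ ^ 2 * ‖unitaryFourier (α n) p‖ ^ 2)
    (hα₀ : Integrable fun p => ‖p‖ ^ 2 * ‖unitaryFourier α₀ p‖ ^ 2) {C : ℝ}
    (hC : ∀ n, ‖α n‖ ^ 2 ≤ C) (hC₀ : ‖α₀‖ ^ 2 ≤ C) (hK : ∀ n, kinetic (α n) ≤ C)
    (hK₀ : kinetic α₀ ≤ C) :
    Tendsto (fun n => potentialEnergy W (α n)) atTop (𝓝 (potentialEnergy W α₀)) := by
  have hM0 : 0 ≤ M := (norm_nonneg _).trans (hM 0)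
  have hC0 : 0 ≤ C := (sq_nonneg _).trans hC₀
  refine tendsto_of_uniform_approx fun ε hε => ?_
  have hlim : Tendsto (fun A : ℝ => M * (C / A + (1 + A) * (C / A ^ 2))) atTop (𝓝 0) := by
    have h1 : Tendsto (fun A : ℝ => A⁻¹) atTop (𝓝 0) := tendsto_inv_atTop_zero
    have h2 : Tendsto (fun A : ℝ => M * (C * A⁻¹ + (C * (A⁻¹ * A⁻¹) + C * A⁻¹))) atTop (𝓝 0) := by
      simpa using (((h1.const_mul C).add (((h1.mul h1).const_mul C).add (h1.const_mul C))).const_mul M)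
    refine h2.congr' ?_
    filter_upwards [eventually_gt_atTop 0] with A hA
    field_simp
  obtain ⟨A, hAε, hA⟩ := ((hlim.eventually (gt_mem_nhds hε)).and (eventually_gt_atTop 0)).exists
  have hbound : ∀ β : L2, (Integrable fun p => ‖p‖ ^ 2 * ‖unitaryFourier β p‖ ^ 2) →
      ‖β‖ ^ 2 ≤ C → kinetic β ≤ C → |potentialEnergy W β - potentialEnergy W
        (momentumRestrict (momentumBall A) measurableSet_closedBall β)| ≤ ε := by
    intro β hβ h1 h2
    refine (abs_potentialEnergy_sub_le hW.1 hM hβ hA).trans (le_trans ?_ hAε.le)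
    gcongr
  refine ⟨_, _, ?_, fun n => hbound (α n) (hα n) (hC n) (hK n), hbound α₀ hα₀ hC₀ hK₀⟩
  have hlo : ∀ β : L2, potentialEnergy W
      (momentumRestrict (momentumBall A) measurableSet_closedBall β) =
      ∫ x, ‖fourierIntegral ((momentumBall A).indicator (unitaryFourier β)) (-x)‖ ^ 2 * W x :=
    fun β => by
      refine integral_congr_ae ?_
      filter_upwards [momentumRestrict_ball_ae_eq β A] with x hx
      rw [hx]
  simp only [hlo]
  -- Uniform sup bound on the low momentum parts, from `norm_fourierIntegral_indicator_le` with `τ =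
  -- 1`; it supplies the dominating function.
  set B := (1 * (newtonConst * A) + C / 1) / 2 with hB
  refine tendsto_integral_of_dominated_convergence (fun x => B ^ 2 * ‖W x‖) (fun n => ?_)
    (hW.norm.const_mul _) (fun n => Eventually.of_forall fun x => ?_)
    (Eventually.of_forall fun x => ?_)
  · exact (((continuous_fourierIntegral (integrable_indicator_momentumBall _ A)).comp
      continuous_neg).norm.pow 2).aestronglyMeasurable.mul hW.1
  · rw [norm_mul, norm_pow, norm_norm]
    gcongr
    refine (norm_fourierIntegral_indicator_le (hα n) hA one_pos _).trans ?_
    rw [hB]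
    gcongr
    exact hK n
  · exact ((tendsto_fourierIntegral_indicator hweak A (-x)).norm.pow 2).mul_const _

/-- The potential energy of a potential in `L^(3/2)` is weakly continuous on sets of bounded
kinetic energy. -/
lemma tendsto_potentialEnergy {V : Space → ℝ} (hV : MemLp V (3 / 2) volume)
    {α : ℕ → L2} {α₀ : L2}
    (hweak : ∀ f : L2, Tendsto (fun n => inner ℂ f (unitaryFourier (α n))) atTop
      (𝓝 (inner ℂ f (unitaryFourier α₀))))
    (hα : ∀ n, Integrable fun p => ‖p‖ ^ 2 * ‖unitaryFourier (α n) p‖ ^ 2)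
    (hα₀ : Integrable fun p => ‖p‖ ^ 2 * ‖unitaryFourier α₀ p‖ ^ 2) {C : ℝ}
    (hC : ∀ n, ‖α n‖ ^ 2 ≤ C) (hC₀ : ‖α₀‖ ^ 2 ≤ C) (hK : ∀ n, kinetic (α n) ≤ C)
    (hK₀ : kinetic α₀ ≤ C) :
    Tendsto (fun n => potentialEnergy V (α n)) atTop (𝓝 (potentialEnergy V α₀)) := by
  have hS := sobolevConst_pos
  refine tendsto_of_uniform_approx fun ε hε => ?_
  have hlim : Tendsto (fun n => sobolevConst * potentialNorm (V - truncation V n) * C) atTop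
      (𝓝 0) := by
    simpa using ((tendsto_potentialNorm_sub_truncation hV).const_mul sobolevConst).mul_const C
  obtain ⟨m, hm⟩ := (hlim.eventually (gt_mem_nhds hε)).exists
  have hbound : ∀ β : L2, (Integrable fun p => ‖p‖ ^ 2 * ‖unitaryFourier β p‖ ^ 2) →
      kinetic β ≤ C → |potentialEnergy V β - potentialEnergy (truncation V m) β| ≤ ε := by
    intro β hβ h2
    rw [potentialEnergy_sub_truncation hV m hβ]
    refine (abs_potentialEnergy_le (memLp_sub_truncation hV m) hβ).trans (le_trans ?_ hm.le)
    have := potentialNorm_nonneg (V - truncation V m)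
    gcongr
  exact ⟨_, _, tendsto_potentialEnergy_of_bounded
    (memLp_one_iff_integrable.1 (memLp_truncation hV.1 m 1)) (norm_truncation_le V m) hweak hα hα₀
    hC hC₀ hK hK₀, fun n => hbound _ (hα n) (hK n), hbound _ hα₀ hK₀⟩

/-! ### The transform of the potential, the convolution formula and the gap field. -/

instance : ENNReal.HolderTriple 3 (3 / 2) 1 where
  inv_add_inv_eq_inv := by
    rw [ENNReal.inv_div (by simp) (by simp), div_eq_mul_inv]
    calc (3 : ℝ≥0∞)⁻¹ + 2 * 3⁻¹ = 3 * 3⁻¹ := by ring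
      _ = 1⁻¹ := by rw [ENNReal.mul_inv_cancel (by simp) (by simp), inv_one]

lemma integrable_mul_of_memLp {f g : Space → ℂ} (hf : MemLp f 3 volume)
    (hg : MemLp g (3 / 2) volume) : Integrable fun x => f x * g x :=
  memLp_one_iff_integrable.1 (hg.mul hf)

lemma norm_integral_mul_le {f g : Space → ℂ} (hf : MemLp f 3 volume)
    (hg : MemLp g (3 / 2) volume) :
    ‖∫ x, f x * g x‖ ≤ (eLpNorm f 3 volume).toReal * (eLpNorm g (3 / 2) volume).toReal := by
  rw [← ENNReal.toReal_mul]
  refine (norm_integral_le_lintegral_norm _).trans (ENNReal.toReal_mono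
    (ENNReal.mul_ne_top hf.2.ne hg.2.ne) ?_)
  have h := eLpNorm_smul_le_mul_eLpNorm (p := 3) (q := 3 / 2) (r := 1) hg.1 hf.1
  rw [eLpNorm_one_eq_lintegral_enorm] at h
  simpa only [ofReal_norm, Pi.smul_apply', smul_eq_mul] using h

lemma tendsto_integral_mul_left {F : ℕ → Space → ℂ} {f g : Space → ℂ}
    (hF : ∀ n, MemLp (F n) 3 volume) (hf : MemLp f 3 volume) (hg : MemLp g (3 / 2) volume)
    (h : Tendsto (fun n => eLpNorm (F n - f) 3 volume) atTop (𝓝 0)) :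
    Tendsto (fun n => ∫ x, F n x * g x) atTop (𝓝 (∫ x, f x * g x)) := by
  rw [tendsto_iff_norm_sub_tendsto_zero]
  have h' := ((ENNReal.tendsto_toReal ENNReal.zero_ne_top).comp h).mul_const
    (eLpNorm g (3 / 2) volume).toReal
  rw [ENNReal.toReal_zero, zero_mul] at h'
  refine squeeze_zero (fun n => norm_nonneg _) (fun n => ?_) h'
  rw [← integral_sub (integrable_mul_of_memLp (hF n) hg) (integrable_mul_of_memLp hf hg)]
  simp only [← sub_mul]
  exact norm_integral_mul_le ((hF n).sub hf) hg

lemma tendsto_integral_mul_right {G : ℕ → Space → ℂ} {f g : Space → ℂ}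
    (hG : ∀ n, MemLp (G n) (3 / 2) volume) (hf : MemLp f 3 volume) (hg : MemLp g (3 / 2) volume)
    (h : Tendsto (fun n => eLpNorm (G n - g) (3 / 2) volume) atTop (𝓝 0)) :
    Tendsto (fun n => ∫ x, f x * G n x) atTop (𝓝 (∫ x, f x * g x)) := by
  rw [tendsto_iff_norm_sub_tendsto_zero]
  have h' := ((ENNReal.tendsto_toReal ENNReal.zero_ne_top).comp h).const_mul
    (eLpNorm f 3 volume).toReal
  rw [ENNReal.toReal_zero, mul_zero] at h'
  refine squeeze_zero (fun n => norm_nonneg _) (fun n => ?_) h'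
  rw [← integral_sub (integrable_mul_of_memLp hf (hG n)) (integrable_mul_of_memLp hf hg)]
  simp only [← mul_sub]
  exact norm_integral_mul_le hf ((hG n).sub hg)

/-- The complex-valued truncation of a potential. -/
def complexTruncation (V : Space → ℝ) (n : ℕ) (x : Space) : ℂ := (truncation V n x : ℂ)

lemma memLp_complexTruncation {V : Space → ℝ} (hV : AEStronglyMeasurable V volume) (n : ℕ)
    (p : ℝ≥0∞) : MemLp (complexTruncation V n) p volume := (memLp_truncation hV n p).ofReal

lemma integrable_complexTruncation {V : Space → ℝ} (hV : AEStronglyMeasurable V volume) (n : ℕ) :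
    Integrable (complexTruncation V n) :=
  memLp_one_iff_integrable.1 (memLp_complexTruncation hV n 1)

lemma memLp_fourierIntegral {f : Space → ℂ} (h1 : Integrable f) (h2 : MemLp f 2 volume)
    (h3 : MemLp f (3 / 2) volume) : MemLp (fourierIntegral f) 3 volume :=
  ⟨(continuous_fourierIntegral h1).aestronglyMeasurable,
    (eLpNorm_fourierIntegral_le h1 h2 h3).trans_lt (ENNReal.mul_lt_top (by simp) h3.2)⟩

lemma eLpNorm_complexTruncation_sub (V : Space → ℝ) (n : ℕ) :
    eLpNorm (complexTruncation V n - fun x => (V x : ℂ)) (3 / 2) volume =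
      eLpNorm (V - truncation V n) (3 / 2) volume := by
  refine eLpNorm_congr_norm_ae (Eventually.of_forall fun x => ?_)
  simp only [Pi.sub_apply, complexTruncation]
  rw [← Complex.ofReal_sub, Complex.norm_real, norm_sub_rev]

lemma eLpNorm_fourierIntegral_sub_le {V : Space → ℝ} (hV : MemLp V (3 / 2) volume) (m n : ℕ) :
    eLpNorm (fourierIntegral (complexTruncation V m) - fourierIntegral (complexTruncation V n)) 3
      volume ≤ 24 * (eLpNorm (V - truncation V m) (3 / 2) volume +
        eLpNorm (V - truncation V n) (3 / 2) volume) := by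
  have hm := integrable_complexTruncation hV.1 m
  have hn := integrable_complexTruncation hV.1 n
  have e : fourierIntegral (complexTruncation V m) - fourierIntegral (complexTruncation V n) =
      fourierIntegral (complexTruncation V m - complexTruncation V n) := by
    ext p; rw [fourierIntegral_sub hm hn]; rfl
  rw [e]
  refine (eLpNorm_fourierIntegral_le (hm.sub hn)
    ((memLp_complexTruncation hV.1 m _).sub (memLp_complexTruncation hV.1 n _))
    ((memLp_complexTruncation hV.1 m _).sub (memLp_complexTruncation hV.1 n _))).trans ?_
  gcongr
  have e2 : complexTruncation V m - complexTruncation V n =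
      (complexTruncation V m - fun x => (V x : ℂ)) -
        (complexTruncation V n - fun x => (V x : ℂ)) := by
    ext x; simp
  have hVc : MemLp (fun x => (V x : ℂ)) (3 / 2) volume := hV.ofReal
  have h32 : (1 : ℝ≥0∞) ≤ 3 / 2 := by
    rw [ENNReal.le_div_iff_mul_le (by simp) (by simp)]; norm_num
  rw [e2]
  refine (eLpNorm_sub_le ((memLp_complexTruncation hV.1 m _).sub hVc).1
    ((memLp_complexTruncation hV.1 n _).sub hVc).1 h32).trans (le_of_eq ?_)
  rw [eLpNorm_complexTruncation_sub, eLpNorm_complexTruncation_sub]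

/-- The Fourier transform of a potential in `L^(3/2)`, as a limit of Fourier transforms of
truncations. -/
lemma exists_fourierTransform_limit {V : Space → ℝ} (hV : MemLp V (3 / 2) volume) :
    ∃ Vhat : Space → ℂ, MemLp Vhat 3 volume ∧
      Tendsto (fun n => eLpNorm (fourierIntegral (complexTruncation V n) - Vhat) 3 volume) atTop
        (𝓝 0) := by
  have : Fact ((1 : ℝ≥0∞) ≤ 3) := ⟨by norm_num⟩
  have hmem : ∀ n, MemLp (fourierIntegral (complexTruncation V n)) 3 volume := fun n =>
    memLp_fourierIntegral (integrable_complexTruncation hV.1 n) (memLp_complexTruncation hV.1 n _)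
      (memLp_complexTruncation hV.1 n _)
  set F : ℕ → Lp ℂ 3 (volume : Measure Space) := fun n => (hmem n).toLp _ with hF
  have hcauchy : CauchySeq F := by
    rw [EMetric.cauchySeq_iff]
    intro ε hε
    have hlim : Tendsto (fun n => 24 * eLpNorm (V - truncation V n) (3 / 2) volume) atTop (𝓝 0) := by
      simpa using ENNReal.Tendsto.const_mul (tendsto_eLpNorm_sub_truncation hV)
        (Or.inr (by simp : (24 : ℝ≥0∞) ≠ ∞))
    obtain ⟨N, hN⟩ := (hlim.eventually (gt_mem_nhds (ENNReal.half_pos hε.ne'))).exists_forall_of_atTop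
    refine ⟨N, fun m hm n hn => ?_⟩
    rw [hF, Lp.edist_toLp_toLp]
    refine (eLpNorm_fourierIntegral_sub_le hV m n).trans_lt ?_
    rw [mul_add, ← ENNReal.add_halves ε]
    exact ENNReal.add_lt_add (hN m hm) (hN n hn)
  obtain ⟨f, hf⟩ := cauchySeq_tendsto_of_complete hcauchy
  refine ⟨f, Lp.memLp f, ?_⟩
  have h2 := tendsto_iff_edist_tendsto_0.1 hf
  refine h2.congr fun n => ?_
  rw [Lp.edist_def]
  refine eLpNorm_congr_ae ?_
  filter_upwards [(hmem n).coeFn_toLp] with x hx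
  simp [hF, hx]

/-- The multiplication formula holds for the truncations. The left side converges by the `L³`
convergence paired with `φ ∈ L^(3/2)`, the right side by the `L^(3/2)` convergence paired with `φ̂ ∈
L³`. -/
lemma isFourierTransform_of_tendsto {V : Space → ℝ} (hV : MemLp V (3 / 2) volume)
    {Vhat : Space → ℂ} (hVhat : MemLp Vhat 3 volume)
    (h : Tendsto (fun n => eLpNorm (fourierIntegral (complexTruncation V n) - Vhat) 3 volume) atTop
        (𝓝 0)) : IsFourierTransform V Vhat := by
  refine ⟨hVhat, fun φ => ?_⟩
  have hφ1 : Integrable φ := φ.integrable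
  have hφ2 : MemLp φ 2 volume := φ.memLp 2
  have hφ3 : MemLp φ (3 / 2) volume := φ.memLp _
  have hmem : ∀ n, MemLp (fourierIntegral (complexTruncation V n)) 3 volume := fun n =>
    memLp_fourierIntegral (integrable_complexTruncation hV.1 n) (memLp_complexTruncation hV.1 n _)
      (memLp_complexTruncation hV.1 n _)
  have h1 := tendsto_integral_mul_left hmem hVhat hφ3 h
  have h2 : Tendsto (fun n => ∫ x, fourierIntegral φ x * complexTruncation V n x) atTop
      (𝓝 (∫ x, fourierIntegral φ x * (V x : ℂ))) := by
    refine tendsto_integral_mul_right (fun n => memLp_complexTruncation hV.1 n _)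
      (memLp_fourierIntegral hφ1 hφ2 hφ3) hV.ofReal ?_
    simp only [eLpNorm_complexTruncation_sub]
    exact tendsto_eLpNorm_sub_truncation hV
  have e : ∀ n, ∫ x, fourierIntegral (complexTruncation V n) x * φ x =
      ∫ x, fourierIntegral φ x * complexTruncation V n x := fun n => by
    rw [integral_fourierIntegral_mul (integrable_complexTruncation hV.1 n) hφ1]
    simp only [mul_comm]
  simp only [e] at h1
  rw [tendsto_nhds_unique h1 h2]
  refine integral_congr_ae (Eventually.of_forall fun x => ?_)
  simp only
  rw [mul_comm, ← toUnitary_fourier, SchwartzMap.fourier_coe]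

/-- Wave functions of finite kinetic energy have Fourier transform in `L^(3/2)`. -/
lemma memLp_unitaryFourier {α : L2}
    (hα : Integrable fun p => ‖p‖ ^ 2 * ‖unitaryFourier α p‖ ^ 2) :
    MemLp (unitaryFourier α) (3 / 2) volume := by
  have hm := (Lp.memLp (unitaryFourier α)).1
  have e32 : ((3 / 2 : ℝ≥0∞)).toReal = 3 / 2 := by simp
  rw [← integrable_norm_rpow_iff hm (by norm_num) (by finiteness), e32]
  have h1 : Integrable fun x : Space => (1 + ‖x‖ ^ 2) ^ (-6 / 2 : ℝ) :=
    integrable_rpow_neg_one_add_norm_sq (by simp; norm_num)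
  refine ((((integrable_norm_sq (unitaryFourier α)).add hα).const_mul (3 / 4)).add
    (h1.const_mul (1 / 4))).mono' (hm.norm.aemeasurable.pow_const _).aestronglyMeasurable
    (Eventually.of_forall fun p => ?_)
  have hnn : 0 ≤ ‖unitaryFourier α p‖ := norm_nonneg _
  rw [Real.norm_of_nonneg (by positivity)]
  simp only [Pi.add_apply]
  set a := ‖unitaryFourier α p‖
  set b : ℝ := 1 + ‖p‖ ^ 2 with hb
  have hb0 : 0 < b := by positivity
  -- Write `a^(3/2) = (b a²)^(3/4) (b⁻³)^(1/4)` with `b = 1 + p²`; the second factor is under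
  -- control because `(1 + p²)⁻³` is integrable on `ℝ³`.
  have key := Real.geom_mean_le_arith_mean2_weighted (w₁ := 3 / 4) (w₂ := 1 / 4) (p₁ := b * a ^ 2)
    (p₂ := b ^ (-6 / 2 : ℝ)) (by norm_num) (by norm_num) (by positivity) (by positivity)
    (by norm_num)
  have e1 : (b * a ^ 2) ^ (3 / 4 : ℝ) * (b ^ (-6 / 2 : ℝ)) ^ (1 / 4 : ℝ) = a ^ (3 / 2 : ℝ) := by
    rw [Real.mul_rpow hb0.le (by positivity), ← Real.rpow_mul hb0.le, ← Real.rpow_natCast a,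
      ← Real.rpow_mul hnn, mul_right_comm, ← Real.rpow_add hb0]
    norm_num
  rw [e1] at key
  calc _ ≤ _ := key
    _ = _ := by rw [hb]; ring

/-- Pointwise `|Vα| ≤ |V|^(3/2) + |α|² + |α|²|V|`: where `|V| ≤ 1` use `|Vα| ≤ |V|² + |α|²`, and
elsewhere `|α| ≤ 1 + |α|²`. -/
lemma integrable_potential_mul {V : Space → ℝ} (hV : MemLp V (3 / 2) volume) {α : L2}
    (hα : Integrable fun p => ‖p‖ ^ 2 * ‖unitaryFourier α p‖ ^ 2) :
    Integrable fun x => (V x : ℂ) * α x := by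
  have e32 : ((3 / 2 : ℝ≥0∞)).toReal = 3 / 2 := by simp
  have h3 := hV.integrable_norm_rpow (by norm_num) (by finiteness)
  rw [e32] at h3
  refine ((h3.add (integrable_norm_sq α)).add (integrable_norm_sq_mul hV hα).norm).mono'
    ((Complex.continuous_ofReal.comp_aestronglyMeasurable hV.1).mul (Lp.memLp α).1)
    (Eventually.of_forall fun x => ?_)
  simp only [Pi.add_apply]
  rw [norm_mul, Complex.norm_real, norm_mul, Real.norm_of_nonneg (sq_nonneg ‖α x‖)]
  have hv := norm_nonneg (V x)
  have ha := norm_nonneg (α x)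
  set v := ‖V x‖
  set a := ‖α x‖
  have hs : v ^ (3 / 2 : ℝ) = v * Real.sqrt v := by
    rcases eq_or_lt_of_le hv with h0 | h0
    · rw [← h0, Real.zero_rpow (by norm_num)]; simp
    · rw [Real.sqrt_eq_rpow]
      nth_rewrite 2 [← Real.rpow_one v]
      rw [← Real.rpow_add h0]; norm_num
  rw [hs]
  have hs2 := Real.sq_sqrt hv
  have hs0 := Real.sqrt_nonneg v
  set s := Real.sqrt v
  rw [← hs2]
  by_cases h1 : s ≤ 1
  · have : s ^ 2 * a ≤ s ^ 2 * (s ^ 2) + a ^ 2 := by nlinarith [sq_nonneg (s ^ 2 - a)]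
    have : s ^ 2 * s ^ 2 ≤ s ^ 2 * s := by
      gcongr; nlinarith
    nlinarith [mul_nonneg (sq_nonneg a) (sq_nonneg s)]
  · have h1' : 1 ≤ s := (not_le.1 h1).le
    have : s ^ 2 * a ≤ s ^ 2 * (1 + a ^ 2) := by gcongr; nlinarith [sq_nonneg (a - 1)]
    have : s ^ 2 * 1 ≤ s ^ 2 * s := by gcongr
    nlinarith [sq_nonneg a]

/-- This is Parseval for `α` against `exp(i p·x)` times the truncated potential: modulation becomes
translation by `p`, and reality of the potential turns conjugation into reflection. -/
lemma fourierIntegral_truncation_mul {V : Space → ℝ} (hV : AEStronglyMeasurable V volume) (n : ℕ)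
    (α : L2) (p : Space) :
    fourierIntegral (fun x => complexTruncation V n x * α x) p =
      fourierConst * ∫ q, fourierIntegral (complexTruncation V n) (p - q) * unitaryFourier α q := by
  have hcont : Continuous fun x : Space => planeWave p x := by fun_prop
  have hf1 := integrable_complexTruncation hV n
  have hg1 : Integrable fun x => planeWave p x * complexTruncation V n x :=
    integrable_planeWave_mul hf1 p
  have hg2 : MemLp (fun x => planeWave p x * complexTruncation V n x) 2 volume := by
    refine (memLp_complexTruncation hV n 2).mono hg1.1 (Eventually.of_forall fun x => ?_)
    rw [norm_mul, norm_planeWave, one_mul]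
  have key := integral_conj_unitaryFourier_mul (hg2.toLp _) α
  have hconj : ∀ x, conj (complexTruncation V n x) = complexTruncation V n x := fun x =>
    Complex.conj_ofReal _
  rw [fourierIntegral]
  congr 1
  have e1 : ∫ x, planeWave (-p) x * (complexTruncation V n x * α x) =
      ∫ x, conj (hg2.toLp _ x) * α x := by
    refine integral_congr_ae ?_
    filter_upwards [hg2.coeFn_toLp] with x hx
    rw [hx, map_mul, conj_planeWave, hconj, mul_assoc]
  rw [e1, ← key]
  refine integral_congr_ae ?_
  filter_upwards [unitaryFourier_toLp_ae_eq hg1 hg2] with q hq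
  rw [hq]
  congr 1
  have e2 : fourierIntegral (fun x => planeWave p x * complexTruncation V n x) q =
      fourierIntegral (complexTruncation V n) (q - p) := by
    rw [fourierIntegral, fourierIntegral]
    congr 1
    refine integral_congr_ae (Eventually.of_forall fun x => ?_)
    simp only
    rw [← mul_assoc, ← planeWave_add, neg_sub, neg_add_eq_sub]
  rw [e2, conj_fourierIntegral, neg_sub]
  simp only [hconj]

lemma memLp_comp_sub_left {f : Space → ℂ} {q : ℝ≥0∞} (hf : MemLp f q volume) (p : Space) :
    MemLp (fun x => f (p - x)) q volume :=
  hf.comp_measurePreserving (Measure.measurePreserving_sub_left volume p)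

lemma eLpNorm_comp_sub_left {f : Space → ℂ} {q : ℝ≥0∞} (hf : AEStronglyMeasurable f volume)
    (p : Space) : eLpNorm (fun x => f (p - x)) q volume = eLpNorm f q volume :=
  eLpNorm_comp_measurePreserving hf (Measure.measurePreserving_sub_left volume p)

lemma integrable_convolution_integrand {Vhat : Space → ℂ} (hVhat : MemLp Vhat 3 volume) {α : L2}
    (hα : Integrable fun p => ‖p‖ ^ 2 * ‖unitaryFourier α p‖ ^ 2) (p : Space) :
    Integrable fun q => Vhat (p - q) * unitaryFourier α q :=
  integrable_mul_of_memLp (memLp_comp_sub_left hVhat p) (memLp_unitaryFourier hα)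

/-- The Fourier transform of `V α` is the convolution of `V̂` and `α̂`. -/
lemma fourierIntegral_potential_mul {V : Space → ℝ} (hV : MemLp V (3 / 2) volume)
    {Vhat : Space → ℂ} (hVhat : MemLp Vhat 3 volume)
    (h : Tendsto (fun n => eLpNorm (fourierIntegral (complexTruncation V n) - Vhat) 3 volume) atTop
        (𝓝 0)) {α : L2}
    (hα : Integrable fun p => ‖p‖ ^ 2 * ‖unitaryFourier α p‖ ^ 2) (p : Space) :
    fourierIntegral (fun x => (V x : ℂ) * α x) p =
      fourierConst * ∫ q, Vhat (p - q) * unitaryFourier α q := by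
  have hmem : ∀ n, MemLp (fourierIntegral (complexTruncation V n)) 3 volume := fun n =>
    memLp_fourierIntegral (integrable_complexTruncation hV.1 n) (memLp_complexTruncation hV.1 n _)
      (memLp_complexTruncation hV.1 n _)
  -- Both sides of the identity for truncations converge at each fixed `p`, by Hölder here and by
  -- dominated convergence below. Hence it holds at every `p`, not just almost everywhere.
  have h1 : Tendsto (fun n => ∫ q, fourierIntegral (complexTruncation V n) (p - q) *
      unitaryFourier α q) atTop (𝓝 (∫ q, Vhat (p - q) * unitaryFourier α q)) := by
    refine tendsto_integral_mul_left (fun n => memLp_comp_sub_left (hmem n) p)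
      (memLp_comp_sub_left hVhat p) (memLp_unitaryFourier hα) ?_
    refine h.congr fun n => ?_
    rw [← eLpNorm_comp_sub_left ((hmem n).sub hVhat).1 p]
    rfl
  have h2 : Tendsto (fun n => fourierIntegral (fun x => complexTruncation V n x * α x) p) atTop
      (𝓝 (fourierIntegral (fun x => (V x : ℂ) * α x) p)) := by
    unfold fourierIntegral
    refine Tendsto.const_mul _ ?_
    have hVα := integrable_potential_mul hV hα
    refine tendsto_integral_of_dominated_convergence (fun x => ‖(V x : ℂ) * α x‖) (fun n => ?_)
      hVα.norm (fun n => Eventually.of_forall fun x => ?_) (Eventually.of_forall fun x => ?_)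
    · exact (by fun_prop : Continuous fun x : Space => planeWave (-p) x).aestronglyMeasurable.mul
        ((integrable_complexTruncation hV.1 n).1.mul (Lp.memLp α).1)
    · rw [norm_mul, norm_planeWave, one_mul, norm_mul, norm_mul, complexTruncation,
        Complex.norm_real, Complex.norm_real]
      gcongr
      exact norm_indicator_le_norm_self _ _
    · refine tendsto_const_nhds.congr' ?_
      filter_upwards [tendsto_truncation V x] with n hn
      rw [complexTruncation, hn]
  simp only [fourierIntegral_truncation_mul hV.1] at h2
  exact tendsto_nhds_unique h2 (h1.const_mul _)

/-- The gap function of a wave function is twice the Fourier transform of `V α`. -/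
def gapField (V : Space → ℝ) (α : L2) (p : Space) : ℂ :=
  2 * fourierIntegral (fun x => (V x : ℂ) * α x) p

lemma continuous_gapField {V : Space → ℝ} (hV : MemLp V (3 / 2) volume) {α : L2}
    (hα : Integrable fun p => ‖p‖ ^ 2 * ‖unitaryFourier α p‖ ^ 2) : Continuous (gapField V α) :=
  continuous_const.mul (continuous_fourierIntegral (integrable_potential_mul hV hα))

lemma integrable_conj_mul_potential {V : Space → ℝ} (hV : MemLp V (3 / 2) volume) {α β : L2}
    (hα : Integrable fun p => ‖p‖ ^ 2 * ‖unitaryFourier α p‖ ^ 2)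
    (hβ : Integrable fun p => ‖p‖ ^ 2 * ‖unitaryFourier β p‖ ^ 2) :
    Integrable fun x => conj (α x) * β x * (V x : ℂ) := by
  refine ((integrable_norm_sq_mul hV hα).norm.add (integrable_norm_sq_mul hV hβ).norm).mono'
    (((Complex.continuous_conj.comp_aestronglyMeasurable (Lp.memLp α).1).mul (Lp.memLp β).1).mul
      (Complex.continuous_ofReal.comp_aestronglyMeasurable hV.1)) (Eventually.of_forall fun x => ?_)
  simp only [Pi.add_apply]
  rw [norm_mul, norm_mul, norm_mul, norm_mul, Complex.norm_real, RCLike.norm_conj, norm_pow,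
    norm_pow, norm_norm, norm_norm, ← add_mul]
  gcongr
  nlinarith [sq_nonneg (‖α x‖ - ‖β x‖), norm_nonneg (α x), norm_nonneg (β x)]

/-- A Parseval identity for `Vα`, which is integrable but need not be in `L²`. It is obtained from
Fourier inversion for `β` and the multiplication formula, hence the integrability of `β̂`. -/
lemma integral_conj_mul_potential {V : Space → ℝ} (hV : MemLp V (3 / 2) volume) {α β : L2}
    (hα : Integrable fun p => ‖p‖ ^ 2 * ‖unitaryFourier α p‖ ^ 2)
    (hβ : Integrable (unitaryFourier β : Space → ℂ)) :
    2 * ∫ x, conj (α x) * β x * (V x : ℂ) = ∫ p, conj (gapField V α p) * unitaryFourier β p := by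
  have hVα := integrable_potential_mul hV hα
  have hconj : Integrable fun x => conj ((V x : ℂ) * α x) :=
    (Complex.conjCLE : ℂ →L[ℝ] ℂ).integrable_comp hVα
  have e1 : ∫ x, conj (α x) * β x * (V x : ℂ) =
      ∫ x, conj ((V x : ℂ) * α x) * fourierIntegral (unitaryFourier β) (-x) := by
    refine integral_congr_ae ?_
    filter_upwards [ae_eq_fourierIntegral_neg hβ] with x hx
    rw [← hx, map_mul, Complex.conj_ofReal]
    ring
  have e2 : ∫ x, conj ((V x : ℂ) * α x) * fourierIntegral (unitaryFourier β) (-x) =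
      ∫ x, (fun y => conj ((V (-y) : ℂ) * α (-y))) x * fourierIntegral (unitaryFourier β) x := by
    rw [← integral_neg_eq_self]; simp
  rw [e1, e2, ← integral_fourierIntegral_mul hconj.comp_neg hβ, ← integral_const_mul]
  refine integral_congr_ae (Eventually.of_forall fun p => ?_)
  simp only [gapField, map_mul, conj_fourierIntegral]
  rw [← mul_assoc, show conj (2 : ℂ) = 2 from Complex.conj_ofNat 2]
  congr 2
  rw [fourierIntegral, fourierIntegral, ← integral_neg_eq_self]
  simp [planeWave]

/-- Expansion of the potential energy along a line. -/
lemma potentialEnergy_add_smul {V : Space → ℝ} (hV : MemLp V (3 / 2) volume) {α β : L2}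
    (hα : Integrable fun p => ‖p‖ ^ 2 * ‖unitaryFourier α p‖ ^ 2)
    (hβ : Integrable fun p => ‖p‖ ^ 2 * ‖unitaryFourier β p‖ ^ 2)
    (hβ1 : Integrable (unitaryFourier β : Space → ℂ)) (t : ℝ) :
    potentialEnergy V (α + (t : ℂ) • β) = potentialEnergy V α +
      t * (∫ p, conj (gapField V α p) * unitaryFourier β p).re + t ^ 2 * potentialEnergy V β := by
  have hi := integrable_conj_mul_potential hV hα hβ
  have hre : (∫ p, conj (gapField V α p) * unitaryFourier β p).re =
      ∫ x, 2 * (conj (α x) * β x * (V x : ℂ)).re := by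
    rw [← integral_conj_mul_potential hV hα hβ1, integral_const_mul]
    have h := integral_re hi
    refine Eq.trans ?_ (congrArg (fun z => 2 * z) h.symm)
    simp
  have hire : Integrable fun x => 2 * (conj (α x) * β x * (V x : ℂ)).re := by
    exact hi.re.const_mul 2
  have ha := integrable_norm_sq_mul hV hα
  have hb := integrable_norm_sq_mul hV hβ
  rw [hre, potentialEnergy, potentialEnergy, potentialEnergy, ← integral_const_mul,
    ← integral_const_mul, ← integral_add ha (hire.const_mul t),
    ← integral_add (f := fun x => ‖α x‖ ^ 2 * V x + t * (2 * (conj (α x) * β x * (V x : ℂ)).re))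
      (ha.add (hire.const_mul t)) (hb.const_mul _)]
  refine integral_congr_ae ?_
  filter_upwards [Lp.coeFn_add α ((t : ℂ) • β), Lp.coeFn_smul (t : ℂ) β] with x h1 h2
  rw [h1, Pi.add_apply, h2, Pi.smul_apply, smul_eq_mul]
  simp only [Complex.sq_norm, Complex.normSq_apply, Complex.add_re, Complex.add_im,
    Complex.mul_re, Complex.mul_im, Complex.ofReal_re, Complex.ofReal_im, Complex.conj_re,
    Complex.conj_im]
  ring

/-! ### Eigenvalues and entropy of the two-by-two matrices. -/

/-- The matrix `Γ(p)` as a function of `γ̂(p)`, `γ̂(-p)` and `α̂(p)`. -/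
def pairMatrix (x y : ℝ) (a : ℂ) : Matrix (Fin 2) (Fin 2) ℂ :=
  !![(x : ℂ), a; conj a, 1 - (y : ℂ)]

/-- Half the distance between the eigenvalues of `Γ(p)`, where `g` is the even part of `γ̂`. -/
def spread (g : ℝ) (a : ℂ) : ℝ := Real.sqrt ((g - 1 / 2) ^ 2 + ‖a‖ ^ 2)

lemma spread_nonneg (g : ℝ) (a : ℂ) : 0 ≤ spread g a := Real.sqrt_nonneg _

lemma spread_sq (g : ℝ) (a : ℂ) : spread g a ^ 2 = (g - 1 / 2) ^ 2 + ‖a‖ ^ 2 :=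
  Real.sq_sqrt (by positivity)

lemma abs_sub_half_le_spread (g : ℝ) (a : ℂ) : |g - 1 / 2| ≤ spread g a := by
  rw [← Real.sqrt_sq_eq_abs]
  exact Real.sqrt_le_sqrt (by nlinarith [sq_nonneg ‖a‖])

lemma norm_le_spread (g : ℝ) (a : ℂ) : ‖a‖ ≤ spread g a := by
  refine Real.le_sqrt_of_sq_le ?_
  nlinarith [sq_nonneg (g - 1 / 2)]

lemma isHermitian_pairMatrix (x y : ℝ) (a : ℂ) : (pairMatrix x y a).IsHermitian := by
  ext i j
  fin_cases i <;> fin_cases j <;> simp [pairMatrix, Matrix.conjTranspose_apply]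

lemma one_sub_pairMatrix (x y : ℝ) (a : ℂ) :
    1 - pairMatrix x y a = pairMatrix (1 - x) (1 - y) (-a) := by
  ext i j
  fin_cases i <;> fin_cases j <;> simp [pairMatrix]

/-- The eigenvalues of `Γ(p)`. -/
lemma eigenvalues_pairMatrix (x y : ℝ) (a : ℂ) :
    ((isHermitian_pairMatrix x y a).eigenvalues 0 = 1 / 2 + (x - y) / 2 + spread ((x + y) / 2) a ∧
     (isHermitian_pairMatrix x y a).eigenvalues 1 = 1 / 2 + (x - y) / 2 - spread ((x + y) / 2) a) ∨
    ((isHermitian_pairMatrix x y a).eigenvalues 0 = 1 / 2 + (x - y) / 2 - spread ((x + y) / 2) a ∧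
     (isHermitian_pairMatrix x y a).eigenvalues 1 =
      1 / 2 + (x - y) / 2 + spread ((x + y) / 2) a) := by
  have hA := isHermitian_pairMatrix x y a
  have htr := hA.trace_eq_sum_eigenvalues
  have hdet := hA.det_eq_prod_eigenvalues
  rw [Fin.sum_univ_two, show (pairMatrix x y a).trace = x + (1 - y) by
    simp [pairMatrix, Matrix.trace_fin_two]] at htr
  rw [Fin.prod_univ_two, show (pairMatrix x y a).det = x * (1 - y) - ‖a‖ ^ 2 by
    simp [pairMatrix, Matrix.det_fin_two, Complex.mul_conj']] at hdet
  change _ = ((_ : ℝ) : ℂ) + ((_ : ℝ) : ℂ) at htr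
  change _ = ((_ : ℝ) : ℂ) * ((_ : ℝ) : ℂ) at hdet
  set u := hA.eigenvalues 0
  set v := hA.eigenvalues 1
  have h1 : x + (1 - y) = u + v := by exact_mod_cast htr
  have h2 : x * (1 - y) - ‖a‖ ^ 2 = u * v := by exact_mod_cast hdet
  have hr := spread_sq ((x + y) / 2) a
  set r := spread ((x + y) / 2) a
  -- Trace and determinant make `u` a root of the characteristic polynomial. They do not tell which
  -- root, whence the disjunction.
  have h3 : (u - (1 / 2 + (x - y) / 2 + r)) * (u - (1 / 2 + (x - y) / 2 - r)) = 0 := by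
    have hv : v = x + (1 - y) - u := by linarith
    rw [hv] at h2
    nlinarith
  rcases mul_eq_zero.1 h3 with h | h
  · left; constructor <;> linarith
  · right; constructor <;> linarith

lemma trace_cfc_pairMatrix (f : ℝ → ℝ) (x y : ℝ) (a : ℂ) :
    (Matrix.trace (cfc f (pairMatrix x y a))).re =
      f (1 / 2 + (x - y) / 2 + spread ((x + y) / 2) a) +
      f (1 / 2 + (x - y) / 2 - spread ((x + y) / 2) a) := by
  have hA := isHermitian_pairMatrix x y a
  have h : Matrix.trace (cfc f (pairMatrix x y a)) =
      ((f (hA.eigenvalues 0) + f (hA.eigenvalues 1) : ℝ) : ℂ) := by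
    rw [hA.cfc_eq, Matrix.IsHermitian.cfc, Unitary.conjStarAlgAut_apply, Matrix.trace_mul_comm,
      ← mul_assoc]
    simp
  rw [h, Complex.ofReal_re]
  rcases eigenvalues_pairMatrix x y a with ⟨h0, h1⟩ | ⟨h0, h1⟩ <;> rw [h0, h1]
  exact add_comm _ _

lemma posSemidef_pairMatrix_iff (x y : ℝ) (a : ℂ) :
    (pairMatrix x y a).PosSemidef ↔ spread ((x + y) / 2) a ≤ 1 / 2 + (x - y) / 2 := by
  have hr := spread_nonneg ((x + y) / 2) a
  rw [(isHermitian_pairMatrix x y a).posSemidef_iff_eigenvalues_nonneg, Pi.le_def, Fin.forall_fin_two]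
  simp only [Pi.zero_apply]
  rcases eigenvalues_pairMatrix x y a with ⟨h0, h1⟩ | ⟨h0, h1⟩ <;> rw [h0, h1] <;>
    constructor <;> intro h
  · linarith [h.2]
  · constructor <;> linarith
  · linarith [h.1]
  · constructor <;> linarith

lemma posSemidef_one_sub_pairMatrix_iff (x y : ℝ) (a : ℂ) :
    (1 - pairMatrix x y a).PosSemidef ↔ spread ((x + y) / 2) a ≤ 1 / 2 - (x - y) / 2 := by
  rw [one_sub_pairMatrix, posSemidef_pairMatrix_iff]
  have e : spread ((1 - x + (1 - y)) / 2) (-a) = spread ((x + y) / 2) a := by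
    unfold spread; rw [norm_neg]; congr 1; ring
  rw [e]
  constructor <;> intro h <;> linarith

/-- The entropy density as a function of `γ̂(p)`, `γ̂(-p)` and `α̂(p)`. -/
def pairEntropy (x y : ℝ) (a : ℂ) : ℝ :=
  Real.negMulLog (1 / 2 + (x - y) / 2 + spread ((x + y) / 2) a) +
    Real.negMulLog (1 / 2 + (x - y) / 2 - spread ((x + y) / 2) a)

lemma entropyDensity_eq (Γ : State) (p : Space) :
    Γ.entropyDensity p = pairEntropy (Γ.gammaHat p) (Γ.gammaHat (-p)) (Γ.alphaHat p) := by
  rw [State.entropyDensity, pairEntropy]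
  change -(Matrix.trace (cfc _ (pairMatrix _ _ _))).re = _
  rw [trace_cfc_pairMatrix]
  simp only [Real.negMulLog]
  ring

/-- The pointwise constraint `0 ≤ Γ(p) ≤ 1`. -/
def PairConstraint (x y : ℝ) (a : ℂ) : Prop :=
  spread ((x + y) / 2) a ≤ 1 / 2 + (x - y) / 2 ∧ spread ((x + y) / 2) a ≤ 1 / 2 - (x - y) / 2

lemma PairConstraint.nonneg_left {x y : ℝ} {a : ℂ} (h : PairConstraint x y a) : 0 ≤ x := by
  have := (abs_le.1 ((abs_sub_half_le_spread ((x + y) / 2) a).trans h.1)).1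
  linarith

lemma PairConstraint.swap {x y : ℝ} {a : ℂ} (h : PairConstraint x y a) : PairConstraint y x a := by
  have e : (y + x) / 2 = (x + y) / 2 := by ring
  constructor
  · rw [e]; linarith [h.2]
  · rw [e]; linarith [h.1]

lemma PairConstraint.le_one_left {x y : ℝ} {a : ℂ} (h : PairConstraint x y a) : x ≤ 1 := by
  have := (abs_le.1 ((abs_sub_half_le_spread ((x + y) / 2) a).trans h.2)).2
  linarith

/-- Nonnegativity of the determinant gives `|a|² ≤ x (1 - y) ≤ x`. This transfers the decay of `γ̂`
to `α̂`. -/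
lemma PairConstraint.norm_sq_le {x y : ℝ} {a : ℂ} (h : PairConstraint x y a) : ‖a‖ ^ 2 ≤ x := by
  have hr := spread_sq ((x + y) / 2) a
  have h0 := spread_nonneg ((x + y) / 2) a
  have h1 : spread ((x + y) / 2) a ^ 2 ≤ (1 / 2 + (x - y) / 2) ^ 2 := by
    gcongr; exact h.1
  have hx := h.nonneg_left
  have hy := h.swap.nonneg_left
  nlinarith [mul_nonneg hx hy]

lemma PairConstraint.pairEntropy_nonneg {x y : ℝ} {a : ℂ} (h : PairConstraint x y a) :
    0 ≤ pairEntropy x y a := by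
  have h0 := spread_nonneg ((x + y) / 2) a
  exact add_nonneg (Real.negMulLog_nonneg (by linarith [h.1]) (by linarith [h.2]))
    (Real.negMulLog_nonneg (by linarith [h.1]) (by linarith [h.2]))

/-- From `log u ≤ u - 1` at `u = exp(-k)/t`. The free slope `k` will grow like `p²`. -/
lemma negMulLog_le_mul_add_exp {t : ℝ} (ht : 0 ≤ t) (k : ℝ) :
    Real.negMulLog t ≤ k * t + Real.exp (-k) := by
  rcases eq_or_lt_of_le ht with h0 | h0
  · rw [← h0]; simp; positivity
  · have h := Real.log_le_sub_one_of_pos (div_pos (Real.exp_pos (-k)) h0)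
    rw [Real.log_div (Real.exp_pos _).ne' h0.ne', Real.log_exp] at h
    have h2 := mul_le_mul_of_nonneg_left h ht
    have e : t * (Real.exp (-k) / t - 1) = Real.exp (-k) - t := by field_simp
    rw [e] at h2
    rw [Real.negMulLog]
    linarith

lemma negMulLog_le_one_sub {t : ℝ} (ht : 0 ≤ t) : Real.negMulLog t ≤ 1 - t := by
  rcases eq_or_lt_of_le ht with h0 | h0
  · rw [← h0]; simp
  · have h := Real.one_sub_inv_le_log_of_pos h0
    have h2 := mul_le_mul_of_nonneg_left h ht
    have e : t * (1 - t⁻¹) = t - 1 := by field_simp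
    rw [e] at h2
    rw [Real.negMulLog]
    linarith

/-- The larger eigenvalue is within `y` of one, so its entropy is at most `y`. The smaller one is at
most `x` and is estimated with slope `k`. -/
lemma PairConstraint.pairEntropy_le {x y : ℝ} {a : ℂ} (h : PairConstraint x y a) {k : ℝ}
    (hk : 0 ≤ k) : pairEntropy x y a ≤ y + (k * x + Real.exp (-k)) := by
  have h0 := spread_nonneg ((x + y) / 2) a
  have h1 := abs_le.1 (abs_sub_half_le_spread ((x + y) / 2) a)
  have e1 := negMulLog_le_one_sub (t := 1 / 2 + (x - y) / 2 + spread ((x + y) / 2) a)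
    (by linarith [h.1])
  have e2 := negMulLog_le_mul_add_exp (t := 1 / 2 + (x - y) / 2 - spread ((x + y) / 2) a)
    (by linarith [h.1]) k
  have e3 : k * (1 / 2 + (x - y) / 2 - spread ((x + y) / 2) a) ≤ k * x := by
    gcongr; linarith [h1.1]
  unfold pairEntropy
  linarith [h1.2]

/-- The entropy density of an even state. -/
def evenEntropy (g : ℝ) (a : ℂ) : ℝ := Real.binEntropy (1 / 2 + spread g a)

lemma pairEntropy_self (g : ℝ) (a : ℂ) : pairEntropy g g a = evenEntropy g a := by
  rw [pairEntropy, evenEntropy, Real.binEntropy_eq_negMulLog_add_negMulLog_one_sub]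
  rw [show (g + g) / 2 = g by ring]
  congr 2 <;> ring

lemma pairConstraint_self_iff (g : ℝ) (a : ℂ) : PairConstraint g g a ↔ spread g a ≤ 1 / 2 := by
  rw [PairConstraint, show (g + g) / 2 = g by ring, sub_self, zero_div, add_zero, sub_zero, and_self]

lemma PairConstraint.spread_le {x y : ℝ} {a : ℂ} (h : PairConstraint x y a) :
    spread ((x + y) / 2) a ≤ 1 / 2 := by linarith [h.1, h.2]

/-- Symmetrizing `γ̂` increases the entropy. -/
lemma PairConstraint.pairEntropy_add_swap_le {x y : ℝ} {a : ℂ} (h : PairConstraint x y a) :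
    pairEntropy x y a + pairEntropy y x a ≤ 2 * evenEntropy ((x + y) / 2) a := by
  have h0 := spread_nonneg ((x + y) / 2) a
  have e : (y + x) / 2 = (x + y) / 2 := by ring
  unfold pairEntropy evenEntropy
  rw [e]
  obtain ⟨h1, h2⟩ := h
  set r := spread ((x + y) / 2) a
  set d := (x - y) / 2 with hd
  have hd' : (y - x) / 2 = -d := by rw [hd]; ring
  rw [hd']
  -- The four eigenvalues of the two matrices regroup into the distributions `(1/2 + r ± d, 1/2 - r
  -- ∓ d)`, whose midpoint is `(1/2 + r, 1/2 - r)`.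
  have c := Real.strictConcave_binEntropy.concaveOn.2
    (⟨by linarith, by linarith⟩ : 1 / 2 + r + d ∈ Set.Icc (0 : ℝ) 1)
    (⟨by linarith, by linarith⟩ : 1 / 2 + r - d ∈ Set.Icc (0 : ℝ) 1)
    (by norm_num : (0 : ℝ) ≤ 1 / 2) (by norm_num : (0 : ℝ) ≤ 1 / 2) (by norm_num)
  simp only [smul_eq_mul] at c
  rw [show 1 / 2 * (1 / 2 + r + d) + 1 / 2 * (1 / 2 + r - d) = 1 / 2 + r by ring] at c
  rw [Real.binEntropy_eq_negMulLog_add_negMulLog_one_sub (1 / 2 + r + d),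
    Real.binEntropy_eq_negMulLog_add_negMulLog_one_sub (1 / 2 + r - d)] at c
  rw [show 1 - (1 / 2 + r + d) = 1 / 2 + -d - r by ring,
    show 1 - (1 / 2 + r - d) = 1 / 2 + d - r by ring,
    show 1 / 2 + r + d = 1 / 2 + d + r by ring, show 1 / 2 + r - d = 1 / 2 + -d + r by ring] at c
  linarith

/-- Makes the convexity of the spread an instance of the triangle inequality. -/
lemma spread_eq_norm (g : ℝ) (a : ℂ) : spread g a = ‖WithLp.toLp 2 ((g - 1 / 2 : ℝ), a)‖ := by
  rw [WithLp.prod_norm_eq_of_L2, spread]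
  simp

lemma spread_convex {g g' : ℝ} {a a' : ℂ} {s t : ℝ} (hs : 0 ≤ s) (ht : 0 ≤ t) (hst : s + t = 1) :
    spread (s * g + t * g') (s * a + t * a') ≤ s * spread g a + t * spread g' a' := by
  rw [spread_eq_norm, spread_eq_norm, spread_eq_norm]
  have e : WithLp.toLp 2 ((s * g + t * g' - 1 / 2 : ℝ), (s * a + t * a' : ℂ)) =
      s • WithLp.toLp 2 ((g - 1 / 2 : ℝ), a) + t • WithLp.toLp 2 ((g' - 1 / 2 : ℝ), a') := by
    rw [← WithLp.toLp_smul, ← WithLp.toLp_smul, ← WithLp.toLp_add]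
    congr 1
    ext1
    · simp only [Prod.smul_mk, Prod.mk_add_mk, smul_eq_mul]
      have : t = 1 - s := by linarith
      rw [this]; ring
    · simp
  rw [e]
  refine (norm_add_le _ _).trans (le_of_eq ?_)
  rw [norm_smul, norm_smul, Real.norm_of_nonneg hs, Real.norm_of_nonneg ht]

/-- The entropy of even states is jointly concave. -/
lemma evenEntropy_concave {g g' : ℝ} {a a' : ℂ} (h : spread g a ≤ 1 / 2)
    (h' : spread g' a' ≤ 1 / 2) {s t : ℝ} (hs : 0 ≤ s) (ht : 0 ≤ t) (hst : s + t = 1) :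
    s * evenEntropy g a + t * evenEntropy g' a' ≤
      evenEntropy (s * g + t * g') (s * a + t * a') := by
  have h0 := spread_nonneg g a
  have h0' := spread_nonneg g' a'
  have h0'' := spread_nonneg (s * g + t * g') (s * a + t * a')
  have hc := spread_convex (g := g) (g' := g') (a := a) (a' := a') hs ht hst
  unfold evenEntropy
  have c := Real.strictConcave_binEntropy.concaveOn.2
    (⟨by linarith, by linarith⟩ : 1 / 2 + spread g a ∈ Set.Icc (0 : ℝ) 1)
    (⟨by linarith, by linarith⟩ : 1 / 2 + spread g' a' ∈ Set.Icc (0 : ℝ) 1) hs ht hst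
  simp only [smul_eq_mul] at c
  refine c.trans ?_
  have e : s * (1 / 2 + spread g a) + t * (1 / 2 + spread g' a') =
      1 / 2 + (s * spread g a + t * spread g' a') := by
    have : t = 1 - s := by linarith
    rw [this]; ring
  have hle : s * spread g a + t * spread g' a' ≤ 1 / 2 := by
    have : t = 1 - s := by linarith
    nlinarith
  rw [e]
  -- Binary entropy decreases on `[1/2, 1]`, so the convexity of the spread works in the right
  -- direction.
  refine Real.binEntropy_strictAntiOn.antitoneOn ⟨by norm_num; linarith, by linarith⟩
    ⟨by norm_num; linarith, by linarith⟩ (by linarith)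

/-! ### The domain in momentum space, and symmetrization. -/

lemma ae_comp_neg {P : Space → Prop} (h : ∀ᵐ p, P p) : ∀ᵐ p : Space, P (-p) :=
  (Measure.measurePreserving_neg (volume : Measure Space)).quasiMeasurePreserving.ae h

lemma mem_domain_iff (Γ : State) : Γ ∈ domain ↔
    Integrable (fun p => (1 + ‖p‖ ^ 2) * Γ.gammaHat p) ∧
    TemperedDistribution.MemSobolev 1 2 (Lp.toTemperedDistribution Γ.alpha) ∧
    (∀ᵐ p, unitaryFourier Γ.alpha (-p) = unitaryFourier Γ.alpha p) ∧
    ∀ᵐ p, PairConstraint (Γ.gammaHat p) (Γ.gammaHat (-p)) (unitaryFourier Γ.alpha p) := by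
  have h1 := alphaHat_ae_eq Γ
  have h2 := ae_comp_neg h1
  change (_ ∧ _ ∧ _ ∧ _) ↔ _
  refine and_congr Iff.rfl (and_congr Iff.rfl (and_congr ?_ ?_))
  · refine eventually_congr ?_
    filter_upwards [h1, h2] with p hp hp'
    rw [hp, hp']
  · refine eventually_congr ?_
    filter_upwards [h1] with p hp
    change ((pairMatrix _ _ _).PosSemidef ∧ (1 - pairMatrix _ _ _).PosSemidef) ↔ _
    rw [posSemidef_pairMatrix_iff, posSemidef_one_sub_pairMatrix_iff, hp]
    rfl

lemma aestronglyMeasurable_of_weighted {g : Space → ℝ}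
    (h : Integrable fun p => (1 + ‖p‖ ^ 2) * g p) : AEStronglyMeasurable g volume := by
  have h1 : Continuous fun p : Space => (1 + ‖p‖ ^ 2 : ℝ)⁻¹ :=
    Continuous.inv₀ (by fun_prop) fun p => by positivity
  refine (h1.aestronglyMeasurable.mul h.1).congr (Eventually.of_forall fun p => ?_)
  have : (1 + ‖p‖ ^ 2 : ℝ) ≠ 0 := by positivity
  simp only [Pi.mul_apply]
  rw [inv_mul_cancel_left₀ this]

lemma integrable_of_weighted {g : Space → ℝ}
    (h : Integrable fun p => (1 + ‖p‖ ^ 2) * g p) : Integrable g := by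
  refine h.mono (aestronglyMeasurable_of_weighted h) (Eventually.of_forall fun p => ?_)
  rw [norm_mul, Real.norm_of_nonneg (by positivity : (0 : ℝ) ≤ 1 + ‖p‖ ^ 2)]
  nlinarith [norm_nonneg (g p), mul_nonneg (sq_nonneg ‖p‖) (norm_nonneg (g p))]

lemma integrable_sq_mul_of_weighted {g : Space → ℝ}
    (h : Integrable fun p => (1 + ‖p‖ ^ 2) * g p) : Integrable fun p => ‖p‖ ^ 2 * g p := by
  refine (h.sub (integrable_of_weighted h)).congr (Eventually.of_forall fun p => ?_)
  simp only [Pi.sub_apply]; ring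

lemma integrable_dispersion_mul_of_weighted {g : Space → ℝ}
    (h : Integrable fun p => (1 + ‖p‖ ^ 2) * g p) (μ : ℝ) :
    Integrable fun p => (‖p‖ ^ 2 - μ) * g p := by
  refine ((integrable_sq_mul_of_weighted h).sub ((integrable_of_weighted h).const_mul μ)).congr
    (Eventually.of_forall fun p => ?_)
  simp only [Pi.sub_apply]; ring

lemma integrable_weighted_neg {g : Space → ℝ}
    (h : Integrable fun p => (1 + ‖p‖ ^ 2) * g p) :
    Integrable fun p => (1 + ‖p‖ ^ 2) * g (-p) := by
  simpa using h.comp_neg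

lemma integrable_weighted_norm_sq {g : Space → ℝ} {α : L2}
    (h : Integrable fun p => (1 + ‖p‖ ^ 2) * g p)
    (hle : ∀ᵐ p, ‖unitaryFourier α p‖ ^ 2 ≤ g p) :
    Integrable fun p => (1 + ‖p‖ ^ 2) * ‖unitaryFourier α p‖ ^ 2 := by
  refine h.mono' ((by fun_prop : Continuous fun p : Space => 1 + ‖p‖ ^ 2).aestronglyMeasurable.mul
    ((Lp.memLp (unitaryFourier α)).1.norm.pow 2)) ?_
  filter_upwards [hle] with p hp
  rw [Real.norm_of_nonneg (by positivity)]
  gcongr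

lemma integrable_kinetic_of_weighted {α : L2}
    (h : Integrable fun p => (1 + ‖p‖ ^ 2) * ‖unitaryFourier α p‖ ^ 2) :
    Integrable fun p => ‖p‖ ^ 2 * ‖unitaryFourier α p‖ ^ 2 :=
  integrable_sq_mul_of_weighted h

lemma norm_sq_eq_integral_unitaryFourier (α : L2) :
    ‖α‖ ^ 2 = ∫ p, ‖unitaryFourier α p‖ ^ 2 := by
  rw [← unitaryFourier.norm_map, norm_sq_eq_integral]

lemma integrable_exp_neg_mul_norm_sq {b : ℝ} (hb : 0 < b) :
    Integrable fun p : Space => Real.exp (-(b * ‖p‖ ^ 2)) := by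
  have h := (GaussianFourier.integrable_cexp_neg_mul_sq_norm_add (V := Space) (b := b)
    (by simpa using hb) 0 0).norm
  refine h.congr (Eventually.of_forall fun p => ?_)
  simp only [zero_mul, add_zero, Complex.norm_exp]
  congr 1
  have : (-(b : ℂ) * (‖p‖ : ℂ) ^ 2) = ((-(b * ‖p‖ ^ 2) : ℝ) : ℂ) := by push_cast; ring
  rw [this, Complex.ofReal_re]

lemma continuous_spread : Continuous fun z : ℝ × ℂ => spread z.1 z.2 := by
  unfold spread
  fun_prop

lemma continuous_evenEntropy : Continuous fun z : ℝ × ℂ => evenEntropy z.1 z.2 := by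
  unfold evenEntropy
  exact Real.binEntropy_continuous.comp (continuous_const.add continuous_spread)

lemma continuous_pairEntropy : Continuous fun z : ℝ × ℝ × ℂ => pairEntropy z.1 z.2.1 z.2.2 := by
  unfold pairEntropy
  have h : Continuous fun z : ℝ × ℝ × ℂ => spread ((z.1 + z.2.1) / 2) z.2.2 :=
    continuous_spread.comp (by fun_prop : Continuous fun z : ℝ × ℝ × ℂ =>
      ((z.1 + z.2.1) / 2, z.2.2))
  exact (Real.continuous_negMulLog.comp (by fun_prop)).add
    (Real.continuous_negMulLog.comp (by fun_prop))

lemma aestronglyMeasurable_comp_neg {g : Space → ℝ} (hg : AEStronglyMeasurable g volume) :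
    AEStronglyMeasurable (fun p => g (-p)) volume :=
  hg.comp_measurePreserving (Measure.measurePreserving_neg (volume : Measure Space))

/-- `PairConstraint.pairEntropy_le` with `k = p²` bounds the density by `g(-p) + p² g(p) +
exp(-p²)`. -/
lemma integrable_pairEntropy {g : Space → ℝ} {a : Space → ℂ}
    (h : Integrable fun p => (1 + ‖p‖ ^ 2) * g p) (ha : AEStronglyMeasurable a volume)
    (hc : ∀ᵐ p, PairConstraint (g p) (g (-p)) (a p)) :
    Integrable fun p => pairEntropy (g p) (g (-p)) (a p) := by
  have hg := aestronglyMeasurable_of_weighted h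
  have hbound := (integrable_of_weighted (integrable_weighted_neg h)).add
    ((integrable_sq_mul_of_weighted h).add (integrable_exp_neg_mul_norm_sq one_pos))
  have hz : AEStronglyMeasurable (fun p => (g p, g (-p), a p)) volume :=
    hg.prodMk ((aestronglyMeasurable_comp_neg hg).prodMk ha)
  have hm : AEStronglyMeasurable (fun p => pairEntropy (g p) (g (-p)) (a p)) volume :=
    continuous_pairEntropy.comp_aestronglyMeasurable (f := fun p => (g p, g (-p), a p)) hz
  refine Integrable.mono' hbound hm ?_
  filter_upwards [hc] with p hp
  rw [Real.norm_of_nonneg hp.pairEntropy_nonneg]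
  have := hp.pairEntropy_le (sq_nonneg ‖p‖)
  simp only [Pi.add_apply, one_mul]
  exact this

lemma entropyDensity_ae_eq (Γ : State) : Γ.entropyDensity =ᵐ[volume]
    fun p => pairEntropy (Γ.gammaHat p) (Γ.gammaHat (-p)) (unitaryFourier Γ.alpha p) := by
  filter_upwards [alphaHat_ae_eq Γ] with p hp
  rw [entropyDensity_eq, hp]

lemma integrable_entropyDensity {Γ : State} (hΓ : Γ ∈ domain) : Integrable Γ.entropyDensity := by
  obtain ⟨h1, -, -, h4⟩ := (mem_domain_iff Γ).1 hΓ
  exact (integrable_pairEntropy h1 (Lp.memLp _).1 h4).congr (entropyDensity_ae_eq Γ).symm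

lemma integrable_weighted_alpha {Γ : State} (hΓ : Γ ∈ domain) :
    Integrable fun p => (1 + ‖p‖ ^ 2) * ‖unitaryFourier Γ.alpha p‖ ^ 2 := by
  obtain ⟨h1, -, -, h4⟩ := (mem_domain_iff Γ).1 hΓ
  exact integrable_weighted_norm_sq h1 (h4.mono fun p hp => hp.norm_sq_le)

lemma integrable_kinetic {Γ : State} (hΓ : Γ ∈ domain) :
    Integrable fun p => ‖p‖ ^ 2 * ‖unitaryFourier Γ.alpha p‖ ^ 2 :=
  integrable_kinetic_of_weighted (integrable_weighted_alpha hΓ)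

/-- Even momentum distribution `g` and even pair wave function with `0 ≤ Γ(p) ≤ 1`. -/
structure IsEvenPair (g : Space → ℝ) (α : L2) : Prop where
  integrable_weighted : Integrable fun p => (1 + ‖p‖ ^ 2) * g p
  even_left : ∀ᵐ p, g (-p) = g p
  even_right : ∀ᵐ p, unitaryFourier α (-p) = unitaryFourier α p
  spread_le : ∀ᵐ p, spread (g p) (unitaryFourier α p) ≤ 1 / 2

namespace IsEvenPair

variable {g : Space → ℝ} {α : L2}

lemma pairConstraint (h : IsEvenPair g α) :
    ∀ᵐ p, PairConstraint (g p) (g p) (unitaryFourier α p) :=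
  h.spread_le.mono fun _ hp => (pairConstraint_self_iff _ _).2 hp

lemma weighted_alpha (h : IsEvenPair g α) :
    Integrable fun p => (1 + ‖p‖ ^ 2) * ‖unitaryFourier α p‖ ^ 2 :=
  integrable_weighted_norm_sq h.integrable_weighted (h.pairConstraint.mono fun _ hp => hp.norm_sq_le)

lemma kinetic_alpha (h : IsEvenPair g α) :
    Integrable fun p => ‖p‖ ^ 2 * ‖unitaryFourier α p‖ ^ 2 :=
  integrable_kinetic_of_weighted h.weighted_alpha

/-- The `H¹` condition is automatic, since `|α̂|² ≤ g`. -/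
lemma mem_domain (h : IsEvenPair g α) : (⟨g, α⟩ : State) ∈ domain := by
  refine (mem_domain_iff _).2 ⟨h.integrable_weighted, memSobolev_of_integrable h.weighted_alpha,
    h.even_right, ?_⟩
  filter_upwards [h.pairConstraint, h.even_left] with p hp hp'
  simp only [hp']
  exact hp

lemma integrable_evenEntropy (h : IsEvenPair g α) :
    Integrable fun p => evenEntropy (g p) (unitaryFourier α p) := by
  have hc : ∀ᵐ p, PairConstraint (g p) (g (-p)) (unitaryFourier α p) := by
    filter_upwards [h.pairConstraint, h.even_left] with p hp hp'
    rwa [hp']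
  refine (integrable_pairEntropy h.integrable_weighted (Lp.memLp (unitaryFourier α)).1 hc).congr ?_
  filter_upwards [h.even_left] with p hp'
  rw [hp', pairEntropy_self]

end IsEvenPair

/-- The convex part of the BCS functional on even states. -/
def freeDensity (μ T : ℝ) (p : Space) (g : ℝ) (a : ℂ) : ℝ :=
  (‖p‖ ^ 2 - μ) * g - T * evenEntropy g a

lemma IsEvenPair.integrable_freeDensity {g : Space → ℝ} {α : L2} (h : IsEvenPair g α) (μ T : ℝ) :
    Integrable fun p => freeDensity μ T p (g p) (unitaryFourier α p) :=
  (integrable_dispersion_mul_of_weighted h.integrable_weighted μ).sub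
    (h.integrable_evenEntropy.const_mul T)

lemma IsEvenPair.functional_eq {g : Space → ℝ} {α : L2} (h : IsEvenPair g α) (V : Space → ℝ)
    (μ T : ℝ) : functional V μ T ⟨g, α⟩ =
      (∫ p, freeDensity μ T p (g p) (unitaryFourier α p)) + potentialEnergy V α := by
  have e : State.entropy ⟨g, α⟩ = ∫ p, evenEntropy (g p) (unitaryFourier α p) := by
    refine integral_congr_ae ((entropyDensity_ae_eq _).trans ?_)
    filter_upwards [h.even_left] with p hp
    simp only [hp, pairEntropy_self]
  unfold freeDensity
  rw [functional, e, integral_sub (integrable_dispersion_mul_of_weighted h.integrable_weighted μ)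
    (h.integrable_evenEntropy.const_mul T), integral_const_mul, potentialEnergy]
  ring

/-- The even part of the momentum distribution. -/
def evenPart (g : Space → ℝ) (p : Space) : ℝ := (g p + g (-p)) / 2

lemma isEvenPair_evenPart {Γ : State} (hΓ : Γ ∈ domain) :
    IsEvenPair (evenPart Γ.gammaHat) Γ.alpha := by
  obtain ⟨h1, -, h3, h4⟩ := (mem_domain_iff Γ).1 hΓ
  refine ⟨?_, Eventually.of_forall fun p => ?_, h3, h4.mono fun p hp => hp.spread_le⟩
  · refine ((h1.add (integrable_weighted_neg h1)).div_const 2).congr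
      (Eventually.of_forall fun p => ?_)
    simp only [Pi.add_apply, evenPart]; ring
  · rw [evenPart, evenPart, neg_neg, add_comm]

/-- Symmetrization lowers the BCS functional. -/
lemma functional_evenPart_le {Γ : State} (hΓ : Γ ∈ domain) (V : Space → ℝ) (μ : ℝ) {T : ℝ}
    (hT : 0 ≤ T) : functional V μ T ⟨evenPart Γ.gammaHat, Γ.alpha⟩ ≤ functional V μ T Γ := by
  obtain ⟨h1, -, h3, h4⟩ := (mem_domain_iff Γ).1 hΓ
  have hE := isEvenPair_evenPart hΓ
  have hd := integrable_dispersion_mul_of_weighted h1 μ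
  have e1 : ∫ p, (‖p‖ ^ 2 - μ) * evenPart Γ.gammaHat p = ∫ p, (‖p‖ ^ 2 - μ) * Γ.gammaHat p := by
    have e2 : ∫ p, (‖p‖ ^ 2 - μ) * Γ.gammaHat (-p) = ∫ p, (‖p‖ ^ 2 - μ) * Γ.gammaHat p := by
      rw [← integral_neg_eq_self]; simp
    have hd' := integrable_dispersion_mul_of_weighted (integrable_weighted_neg h1) μ
    calc _ = ∫ p, ((‖p‖ ^ 2 - μ) * Γ.gammaHat p + (‖p‖ ^ 2 - μ) * Γ.gammaHat (-p)) / 2 := by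
          congr 1; ext p; rw [evenPart]; ring
      _ = _ := by rw [integral_div, integral_add hd hd', e2]; ring
  have hS := integrable_pairEntropy h1 (Lp.memLp (unitaryFourier Γ.alpha)).1 h4
  have e3 : Γ.entropy ≤ ∫ p, evenEntropy (evenPart Γ.gammaHat p) (unitaryFourier Γ.alpha p) := by
    have e4 : Γ.entropy =
        ∫ p, pairEntropy (Γ.gammaHat p) (Γ.gammaHat (-p)) (unitaryFourier Γ.alpha p) :=
      integral_congr_ae (entropyDensity_ae_eq Γ)
    -- The substitution `p ↦ -p` swaps the roles of `γ̂(p)` and `γ̂(-p)`; averaging both expressions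
    -- makes the pointwise inequality applicable.
    have e5 : Γ.entropy =
        ∫ p, pairEntropy (Γ.gammaHat (-p)) (Γ.gammaHat p) (unitaryFourier Γ.alpha p) := by
      rw [e4, ← integral_neg_eq_self]
      refine integral_congr_ae ?_
      filter_upwards [h3] with p hp
      rw [neg_neg, hp]
    have hS' : Integrable fun p =>
        pairEntropy (Γ.gammaHat (-p)) (Γ.gammaHat p) (unitaryFourier Γ.alpha p) := by
      refine hS.comp_neg.congr ?_
      filter_upwards [h3] with p hp
      rw [neg_neg, hp]
    have e6 : 2 * Γ.entropy ≤
        2 * ∫ p, evenEntropy (evenPart Γ.gammaHat p) (unitaryFourier Γ.alpha p) := by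
      rw [two_mul]
      nth_rewrite 1 [e4]
      rw [e5, ← integral_add hS hS', ← integral_const_mul]
      refine integral_mono_ae (hS.add hS') (hE.integrable_evenEntropy.const_mul 2) ?_
      filter_upwards [h4] with p hp
      exact hp.pairEntropy_add_swap_le
    linarith
  rw [hE.functional_eq]
  unfold freeDensity
  rw [integral_sub (integrable_dispersion_mul_of_weighted hE.integrable_weighted μ)
    (hE.integrable_evenEntropy.const_mul T), integral_const_mul, e1, functional, potentialEnergy]
  have := mul_le_mul_of_nonneg_left e3 hT
  linarith

/-! ### Lower bound on the free energy density. -/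

/-- An integrable function that compensates the negative part of the free energy density. -/
def freeBound (μ T : ℝ) (p : Space) : ℝ :=
  T * Real.exp (-((1 / (4 * T)) * ‖p‖ ^ 2)) +
    (momentumBall (2 * Real.sqrt (|μ| + T))).indicator (fun _ => |μ| + T) p

lemma integrable_freeBound (μ : ℝ) {T : ℝ} (hT : 0 ≤ T) : Integrable (freeBound μ T) := by
  refine Integrable.add ?_ ?_
  · rcases eq_or_lt_of_le hT with h0 | h0
    · rw [← h0]; simp
    · exact (integrable_exp_neg_mul_norm_sq (by positivity)).const_mul T
  · rw [integrable_indicator_iff measurableSet_closedBall]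
    exact integrableOn_const (isCompact_closedBall _ _).measure_lt_top.ne

/-- The entropy estimate with `k = p²/(4T)` costs a quarter of `p² g`, and half of it is kept. The
last quarter absorbs `(|μ| + T) g` outside the ball of radius `2√(|μ| + T)`; inside, `g ≤ 1` is
used. At `T = 0` the entropy term and the Gaussian are both multiplied by zero. -/
lemma freeDensity_add_freeBound_ge (μ : ℝ) {T : ℝ} (hT : 0 ≤ T) (p : Space) {g : ℝ} {a : ℂ}
    (h : spread g a ≤ 1 / 2) :
    ‖p‖ ^ 2 * g / 2 ≤ freeDensity μ T p g a + freeBound μ T p := by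
  have hc := (pairConstraint_self_iff g a).2 h
  have hg0 := hc.nonneg_left
  have hg1 := hc.le_one_left
  have hH : T * evenEntropy g a ≤ T * g + (‖p‖ ^ 2 / 4 * g +
      T * Real.exp (-((1 / (4 * T)) * ‖p‖ ^ 2))) := by
    rcases eq_or_lt_of_le hT with h0 | h0
    · rw [← h0]; simp only [zero_mul, zero_add]; positivity
    · have := hc.pairEntropy_le (k := (1 / (4 * T)) * ‖p‖ ^ 2) (by positivity)
      rw [pairEntropy_self] at this
      have h2 := mul_le_mul_of_nonneg_left this hT
      have e : T * (1 / (4 * T) * ‖p‖ ^ 2 * g) = ‖p‖ ^ 2 / 4 * g := by field_simp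
      rw [mul_add, mul_add, e] at h2
      exact h2
  have hμ : -(|μ| * g) ≤ -(μ * g) := by
    have := mul_le_mul_of_nonneg_right (le_abs_self μ) hg0
    linarith
  have hM : 0 ≤ |μ| + T := by positivity
  have hind : 0 ≤ ‖p‖ ^ 2 / 4 * g - (|μ| + T) * g +
      (momentumBall (2 * Real.sqrt (|μ| + T))).indicator (fun _ => |μ| + T) p := by
    by_cases hp : p ∈ momentumBall (2 * Real.sqrt (|μ| + T))
    · rw [Set.indicator_of_mem hp]
      have : 0 ≤ ‖p‖ ^ 2 / 4 * g := by positivity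
      nlinarith
    · rw [Set.indicator_of_notMem hp]
      have hp' : 2 * Real.sqrt (|μ| + T) < ‖p‖ := by simpa using hp
      have h4 : (2 * Real.sqrt (|μ| + T)) ^ 2 ≤ ‖p‖ ^ 2 := by gcongr
      rw [mul_pow, Real.sq_sqrt hM] at h4
      have : 0 ≤ (‖p‖ ^ 2 / 4 - (|μ| + T)) * g := mul_nonneg (by linarith) hg0
      linarith
  unfold freeDensity freeBound
  linarith

/-! ### Weak compactness and weakly closed sublevel sets. -/

section Hilbert

variable {X : Type*} [NormedAddCommGroup X] [InnerProductSpace ℝ X]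

/-- Bounded sequences in separable Hilbert spaces have weakly convergent subsequences. -/
lemma exists_weakly_convergent_subseq [CompleteSpace X] [TopologicalSpace.SeparableSpace X]
    {x : ℕ → X} {R : ℝ} (hx : ∀ n, ‖x n‖ ≤ R) :
    ∃ x₀ : X, ∃ φ : ℕ → ℕ, StrictMono φ ∧
      ∀ y, Tendsto (fun n => inner ℝ y (x (φ n))) atTop (𝓝 (inner ℝ y x₀)) := by
  let D := InnerProductSpace.toDual ℝ X
  have hmem : ∀ n, StrongDual.toWeakDual (D (x n)) ∈
      WeakDual.toStrongDual ⁻¹' Metric.closedBall (0 : StrongDual ℝ X) R := fun n => by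
    change D (x n) ∈ Metric.closedBall (0 : StrongDual ℝ X) R
    rw [mem_closedBall_zero_iff, LinearIsometryEquiv.norm_map]
    exact hx n
  -- Sequential Banach-Alaoglu in the dual, carried back by the Riesz isomorphism.
  obtain ⟨f, -, φ, hφ, hlim⟩ := WeakDual.isSeqCompact_closedBall ℝ X 0 R hmem
  refine ⟨D.symm (WeakDual.toStrongDual f), φ, hφ, fun y => ?_⟩
  have h1 := ((WeakDual.eval_continuous (𝕜 := ℝ) y).tendsto f).comp hlim
  have e : inner ℝ y (D.symm (WeakDual.toStrongDual f)) = f y := by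
    rw [real_inner_comm, InnerProductSpace.toDual_symm_apply]
    rfl
  rw [e]
  refine h1.congr fun n => ?_
  rw [real_inner_comm]
  exact InnerProductSpace.toDual_apply_apply

/-- Closed convex sets in a Hilbert space are weakly sequentially closed. -/
lemma mem_of_weakly_tendsto [CompleteSpace X] {C : Set X} (hC : IsClosed C) (hconv : Convex ℝ C)
    {x : ℕ → X} {x₀ : X} (hx : ∀ᶠ n in atTop, x n ∈ C)
    (hweak : ∀ y, Tendsto (fun n => inner ℝ y (x n)) atTop (𝓝 (inner ℝ y x₀))) : x₀ ∈ C := by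
  -- Project `x₀` to `v` in `C`. The variational inequality `⟪x₀ - v, x n - v⟫ ≤ 0` passes to the
  -- weak limit and gives `‖x₀ - v‖² ≤ 0`.
  obtain ⟨n, hn⟩ := hx.exists
  obtain ⟨v, hv, hmin⟩ := exists_norm_eq_iInf_of_complete_convex ⟨_, hn⟩ hC.isComplete hconv x₀
  have h := (norm_eq_iInf_iff_real_inner_le_zero hconv hv).1 hmin
  have hlim : Tendsto (fun n => inner ℝ (x₀ - v) (x n - v)) atTop
      (𝓝 (inner ℝ (x₀ - v) (x₀ - v))) := by
    simp only [inner_sub_right (x₀ - v)]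
    exact (hweak _).sub_const _
  have hle : inner ℝ (x₀ - v) (x₀ - v) ≤ 0 :=
    le_of_tendsto hlim (hx.mono fun n hn => h _ hn)
  have : x₀ - v = 0 := inner_self_eq_zero.1 (le_antisymm hle (real_inner_self_nonneg))
  rw [sub_eq_zero.1 this]
  exact hv

end Hilbert

instance : Fact ((2 : ℝ≥0∞) ≠ ∞) := ⟨by simp⟩

/-- The real Hilbert space of pairs `(α̂, γ̂)`. -/
abbrev PairSpace : Type := WithLp 2 (L2 × Lp ℝ 2 (volume : Measure Space))

instance : TopologicalSpace.SeparableSpace PairSpace :=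
  haveI : TopologicalSpace.SeparableSpace (Lp ℝ 2 (volume : Measure Space)) := inferInstance
  haveI : TopologicalSpace.SeparableSpace L2 := inferInstance
  haveI : TopologicalSpace.SeparableSpace (L2 × Lp ℝ 2 (volume : Measure Space)) :=
    TopologicalSpace.instSeparableSpaceProd
  (WithLp.toLp_surjective 2 (V := L2 × Lp ℝ 2 (volume : Measure Space))).denseRange.separableSpace
    (WithLp.prod_continuous_toLp 2 _ _)

lemma inner_L2_real_eq (f g : L2) : inner ℝ f g = (inner ℂ f g).re := by
  rw [L2.inner_def, L2.inner_def]
  exact integral_re (L2.integrable_inner (𝕜 := ℂ) f g)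

/-- Weak convergence over `ℝ` controls real parts of complex inner products; the imaginary part
against `f` is the real part against `i f`. -/
lemma tendsto_inner_fst {x : ℕ → PairSpace} {x₀ : PairSpace}
    (hweak : ∀ y, Tendsto (fun n => inner ℝ y (x n)) atTop (𝓝 (inner ℝ y x₀))) (f : L2) :
    Tendsto (fun n => inner ℂ f (x n).fst) atTop (𝓝 (inner ℂ f x₀.fst)) := by
  have hre : ∀ f : L2, Tendsto (fun n => (inner ℂ f (x n).fst).re) atTop
      (𝓝 (inner ℂ f x₀.fst).re) := fun f => by
    have := hweak (WithLp.toLp 2 (f, 0))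
    simpa only [WithLp.prod_inner_apply, inner_zero_left, add_zero, inner_L2_real_eq] using! this
  have him : ∀ h : L2, (inner ℂ f h).im = (inner ℂ (Complex.I • f) h).re := fun h => by
    rw [inner_smul_left]; simp
  have h2 : Tendsto (fun n => (inner ℂ f (x n).fst).im) atTop (𝓝 (inner ℂ f x₀.fst).im) := by
    simp only [him]; exact hre _
  have h3 := ((Complex.continuous_ofReal.tendsto _).comp (hre f)).add
    (((Complex.continuous_ofReal.tendsto _).comp h2).mul_const Complex.I)
  rw [Complex.re_add_im] at h3
  refine h3.congr fun n => ?_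
  simp only [Function.comp_apply, Complex.re_add_im]

lemma exists_subseq_tendsto_ae {x : ℕ → PairSpace} {x₀ : PairSpace}
    (h : Tendsto x atTop (𝓝 x₀)) : ∃ φ : ℕ → ℕ, StrictMono φ ∧
      ∀ᵐ p, Tendsto (fun n => ((x (φ n)).snd p, (x (φ n)).fst p)) atTop
        (𝓝 (x₀.snd p, x₀.fst p)) := by
  have hc := (WithLp.prod_continuous_ofLp 2 L2 (Lp ℝ 2 (volume : Measure Space))).tendsto x₀
  have h1 : Tendsto (fun n => (x n).fst) atTop (𝓝 x₀.fst) :=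
    (continuous_fst.tendsto _).comp (hc.comp h)
  have h2 : Tendsto (fun n => (x n).snd) atTop (𝓝 x₀.snd) :=
    (continuous_snd.tendsto _).comp (hc.comp h)
  obtain ⟨φ, hφ, hφlim⟩ := (tendstoInMeasure_of_tendsto_Lp h1).exists_seq_tendsto_ae
  obtain ⟨ψ, hψ, hψlim⟩ := (tendstoInMeasure_of_tendsto_Lp
    (h2.comp hφ.tendsto_atTop)).exists_seq_tendsto_ae
  refine ⟨φ ∘ ψ, hφ.comp hψ, ?_⟩
  filter_upwards [hφlim, hψlim] with p hp hp'
  exact hp'.prodMk_nhds (hp.comp hψ.tendsto_atTop)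

/-- The compensated free energy density, which is nonnegative. -/
def compensatedDensity (μ T : ℝ) (p : Space) (g : ℝ) (a : ℂ) : ℝ :=
  freeDensity μ T p g a + freeBound μ T p

lemma continuous_freeDensity (μ T : ℝ) :
    Continuous fun z : Space × ℝ × ℂ => freeDensity μ T z.1 z.2.1 z.2.2 := by
  unfold freeDensity
  have : Continuous fun z : Space × ℝ × ℂ => evenEntropy z.2.1 z.2.2 :=
    continuous_evenEntropy.comp continuous_snd
  fun_prop

lemma aemeasurable_compensatedDensity (μ : ℝ) {T : ℝ} (hT : 0 ≤ T) {g : Space → ℝ} {a : Space → ℂ}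
    (hg : AEStronglyMeasurable g volume) (ha : AEStronglyMeasurable a volume) :
    AEStronglyMeasurable (fun p => compensatedDensity μ T p (g p) (a p)) volume :=
  ((continuous_freeDensity μ T).comp_aestronglyMeasurable (f := fun p => (p, g p, a p))
    (aestronglyMeasurable_id.prodMk (hg.prodMk ha))).add (integrable_freeBound μ hT).1

lemma compensatedDensity_ge (μ : ℝ) {T : ℝ} (hT : 0 ≤ T) (p : Space) {g : ℝ} {a : ℂ}
    (h : spread g a ≤ 1 / 2) : ‖p‖ ^ 2 * g / 2 ≤ compensatedDensity μ T p g a :=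
  freeDensity_add_freeBound_ge μ hT p h

lemma compensatedDensity_nonneg (μ : ℝ) {T : ℝ} (hT : 0 ≤ T) (p : Space) {g : ℝ} {a : ℂ}
    (h : spread g a ≤ 1 / 2) : 0 ≤ compensatedDensity μ T p g a := by
  have := ((pairConstraint_self_iff g a).2 h).nonneg_left
  exact le_trans (by positivity) (compensatedDensity_ge μ hT p h)

lemma compensatedDensity_convex (μ : ℝ) {T : ℝ} (hT : 0 ≤ T) (p : Space) {g g' : ℝ} {a a' : ℂ}
    (h : spread g a ≤ 1 / 2) (h' : spread g' a' ≤ 1 / 2) {s t : ℝ} (hs : 0 ≤ s) (ht : 0 ≤ t)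
    (hst : s + t = 1) : compensatedDensity μ T p (s * g + t * g') (s * a + t * a') ≤
      s * compensatedDensity μ T p g a + t * compensatedDensity μ T p g' a' := by
  have := mul_le_mul_of_nonneg_left (evenEntropy_concave h h' hs ht hst) hT
  have e : freeBound μ T p = s * freeBound μ T p + t * freeBound μ T p := by
    rw [← add_mul, hst, one_mul]
  unfold compensatedDensity freeDensity
  linarith

/-- Sublevel sets of the compensated free energy among even states. -/
def energySublevel (μ T c : ℝ) : Set PairSpace :=
  {x | (∀ᵐ p, x.fst (-p) = x.fst p) ∧ (∀ᵐ p, x.snd (-p) = x.snd p) ∧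
    (∀ᵐ p, spread (x.snd p) (x.fst p) ≤ 1 / 2) ∧
    ∫⁻ p, ENNReal.ofReal (compensatedDensity μ T p (x.snd p) (x.fst p)) ≤ ENNReal.ofReal c}

/-- Along an almost everywhere convergent subsequence the constraints pass to the limit pointwise,
and the energy bound by Fatou's lemma. -/
lemma isClosed_energySublevel (μ : ℝ) {T : ℝ} (hT : 0 ≤ T) (c : ℝ) :
    IsClosed (energySublevel μ T c) := by
  refine IsSeqClosed.isClosed fun x x₀ hx hlim => ?_
  obtain ⟨φ, -, hφ⟩ := exists_subseq_tendsto_ae hlim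
  have hφ' := ae_comp_neg hφ
  have h1 : ∀ᵐ p, ∀ n, (x (φ n)).fst (-p) = (x (φ n)).fst p := ae_all_iff.2 fun n => (hx (φ n)).1
  have h2 : ∀ᵐ p, ∀ n, (x (φ n)).snd (-p) = (x (φ n)).snd p :=
    ae_all_iff.2 fun n => (hx (φ n)).2.1
  have h3 : ∀ᵐ p, ∀ n, spread ((x (φ n)).snd p) ((x (φ n)).fst p) ≤ 1 / 2 :=
    ae_all_iff.2 fun n => (hx (φ n)).2.2.1
  refine ⟨?_, ?_, ?_, ?_⟩
  · filter_upwards [hφ, hφ', h1] with p hp hp' hn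
    refine tendsto_nhds_unique ((continuous_snd.tendsto _).comp hp') ?_
    refine ((continuous_snd.tendsto _).comp hp).congr fun n => ?_
    exact (hn n).symm
  · filter_upwards [hφ, hφ', h2] with p hp hp' hn
    refine tendsto_nhds_unique ((continuous_fst.tendsto _).comp hp') ?_
    refine ((continuous_fst.tendsto _).comp hp).congr fun n => ?_
    exact (hn n).symm
  · filter_upwards [hφ, h3] with p hp hn
    exact le_of_tendsto' ((continuous_spread.tendsto _).comp hp) hn
  · have hF := lintegral_liminf_le' (μ := (volume : Measure Space)) (u := atTop)
      (f := fun n p => ENNReal.ofReal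
        (compensatedDensity μ T p ((x (φ n)).snd p) ((x (φ n)).fst p)))
      (fun n => (aemeasurable_compensatedDensity μ hT (Lp.memLp _).1
        (Lp.memLp _).1).aemeasurable.ennreal_ofReal)
    have hle : liminf (fun n => ∫⁻ p, ENNReal.ofReal
        (compensatedDensity μ T p ((x (φ n)).snd p) ((x (φ n)).fst p))) atTop ≤
        ENNReal.ofReal c := by
      refine (liminf_le_liminf (Eventually.of_forall fun n => (hx (φ n)).2.2.2)).trans ?_
      simp
    refine le_trans (lintegral_mono_ae ?_) (hF.trans hle)
    filter_upwards [hφ] with p hp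
    have hcont : Continuous fun z : ℝ × ℂ => compensatedDensity μ T p z.1 z.2 := by
      unfold compensatedDensity
      exact ((continuous_freeDensity μ T).comp (continuous_const.prodMk continuous_id)).add
        continuous_const
    have ht := (ENNReal.continuous_ofReal.tendsto _).comp ((hcont.tendsto _).comp hp)
    exact ht.liminf_eq.ge

lemma coeFn_combination (x y : PairSpace) (s t : ℝ) :
    (∀ᵐ p, (s • x + t • y).fst p = s * x.fst p + t * y.fst p) ∧
    ∀ᵐ p, (s • x + t • y).snd p = s * x.snd p + t * y.snd p := by
  constructor
  · change ∀ᵐ p, (s • x.fst + t • y.fst : L2) p = _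
    filter_upwards [Lp.coeFn_add (s • x.fst) (t • y.fst), Lp.coeFn_smul s x.fst,
      Lp.coeFn_smul t y.fst] with p h1 h2 h3
    rw [h1, Pi.add_apply, h2, h3]
    simp
  · change ∀ᵐ p, (s • x.snd + t • y.snd : Lp ℝ 2 (volume : Measure Space)) p = _
    filter_upwards [Lp.coeFn_add (s • x.snd) (t • y.snd), Lp.coeFn_smul s x.snd,
      Lp.coeFn_smul t y.snd] with p h1 h2 h3
    rw [h1, Pi.add_apply, h2, h3]
    simp

lemma convex_energySublevel (μ : ℝ) {T : ℝ} (hT : 0 ≤ T) (c : ℝ) :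
    Convex ℝ (energySublevel μ T c) := by
  intro x hx y hy s t hs ht hst
  obtain ⟨hf, hg⟩ := coeFn_combination x y s t
  have hf' := ae_comp_neg hf
  have hg' := ae_comp_neg hg
  obtain ⟨x1, x2, x3, x4⟩ := hx
  obtain ⟨y1, y2, y3, y4⟩ := hy
  refine ⟨?_, ?_, ?_, ?_⟩
  · filter_upwards [hf, hf', x1, y1] with p h1 h2 h3 h4
    rw [h1, h2, h3, h4]
  · filter_upwards [hg, hg', x2, y2] with p h1 h2 h3 h4
    rw [h1, h2, h3, h4]
  · filter_upwards [hf, hg, x3, y3] with p h1 h2 h3 h4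
    rw [h1, h2]
    refine (spread_convex hs ht hst).trans ?_
    have : t = 1 - s := by linarith
    nlinarith
  · have hm := (aemeasurable_compensatedDensity μ hT (Lp.memLp x.snd).1
      (Lp.memLp x.fst).1).aemeasurable.ennreal_ofReal
    calc _ ≤ ∫⁻ p, (ENNReal.ofReal s *
          ENNReal.ofReal (compensatedDensity μ T p (x.snd p) (x.fst p)) +
          ENNReal.ofReal t * ENNReal.ofReal (compensatedDensity μ T p (y.snd p) (y.fst p))) := by
          refine lintegral_mono_ae ?_
          filter_upwards [hf, hg, x3, y3] with p h1 h2 h3 h4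
          rw [h1, h2, ← ENNReal.ofReal_mul hs, ← ENNReal.ofReal_mul ht]
          exact (ENNReal.ofReal_le_ofReal
            (compensatedDensity_convex μ hT p h3 h4 hs ht hst)).trans ENNReal.ofReal_add_le
      _ = ENNReal.ofReal s * (∫⁻ p, ENNReal.ofReal
            (compensatedDensity μ T p (x.snd p) (x.fst p))) +
          ENNReal.ofReal t * ∫⁻ p, ENNReal.ofReal
            (compensatedDensity μ T p (y.snd p) (y.fst p)) := by
          rw [lintegral_add_left' (hm.const_mul _), lintegral_const_mul' _ _ (by finiteness),
            lintegral_const_mul' _ _ (by finiteness)]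
      _ ≤ ENNReal.ofReal s * ENNReal.ofReal c + ENNReal.ofReal t * ENNReal.ofReal c := by
          gcongr
      _ = ENNReal.ofReal c := by
          rw [← add_mul, ← ENNReal.ofReal_add hs ht, hst, ENNReal.ofReal_one, one_mul]

/-! ### Coercivity and existence of minimizers. -/

/-- The compensated free energy of an even state. -/
def compensatedEnergy (μ T : ℝ) (g : Space → ℝ) (α : L2) : ℝ :=
  ∫ p, compensatedDensity μ T p (g p) (unitaryFourier α p)

namespace IsEvenPair

variable {g : Space → ℝ} {α : L2}

lemma nonneg (h : IsEvenPair g α) : ∀ᵐ p, 0 ≤ g p :=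
  h.pairConstraint.mono fun _ hp => hp.nonneg_left

lemma le_one (h : IsEvenPair g α) : ∀ᵐ p, g p ≤ 1 :=
  h.pairConstraint.mono fun _ hp => hp.le_one_left

lemma integrable_compensatedDensity (h : IsEvenPair g α) (μ : ℝ) {T : ℝ} (hT : 0 ≤ T) :
    Integrable fun p => compensatedDensity μ T p (g p) (unitaryFourier α p) :=
  (h.integrable_freeDensity μ T).add (integrable_freeBound μ hT)

lemma functional_eq_compensated (h : IsEvenPair g α) (V : Space → ℝ) (μ : ℝ) {T : ℝ}
    (hT : 0 ≤ T) : functional V μ T ⟨g, α⟩ =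
      compensatedEnergy μ T g α - (∫ p, freeBound μ T p) + potentialEnergy V α := by
  have : compensatedEnergy μ T g α = (∫ p, freeDensity μ T p (g p) (unitaryFourier α p)) +
      ∫ p, freeBound μ T p :=
    integral_add (h.integrable_freeDensity μ T) (integrable_freeBound μ hT)
  rw [h.functional_eq, this]; ring

lemma integral_sq_mul_le (h : IsEvenPair g α) (μ : ℝ) {T : ℝ} (hT : 0 ≤ T) :
    ∫ p, ‖p‖ ^ 2 * g p ≤ 2 * compensatedEnergy μ T g α := by
  have : ∫ p, ‖p‖ ^ 2 * g p / 2 ≤ compensatedEnergy μ T g α := by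
    refine integral_mono_ae ((integrable_sq_mul_of_weighted h.integrable_weighted).div_const 2)
      (h.integrable_compensatedDensity μ hT) ?_
    filter_upwards [h.spread_le] with p hp
    exact compensatedDensity_ge μ hT p hp
  rw [integral_div] at this
  linarith

lemma integral_sq_mul_nonneg (h : IsEvenPair g α) : 0 ≤ ∫ p, ‖p‖ ^ 2 * g p := by
  refine integral_nonneg_of_ae ?_
  filter_upwards [h.nonneg] with p hp
  simp only [Pi.zero_apply]; positivity

lemma kinetic_le (h : IsEvenPair g α) : kinetic α ≤ ∫ p, ‖p‖ ^ 2 * g p := by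
  refine integral_mono_ae h.kinetic_alpha (integrable_sq_mul_of_weighted h.integrable_weighted) ?_
  filter_upwards [h.pairConstraint] with p hp
  have := hp.norm_sq_le
  gcongr

lemma norm_sq_le (h : IsEvenPair g α) : ‖α‖ ^ 2 ≤ ∫ p, g p := by
  rw [norm_sq_eq_integral_unitaryFourier]
  refine integral_mono_ae (integrable_norm_sq _) (integrable_of_weighted h.integrable_weighted) ?_
  filter_upwards [h.pairConstraint] with p hp
  exact hp.norm_sq_le

/-- Inside the ball `g ≤ 1`, outside it `1 ≤ δ p²`. This lets the term `C ‖α‖²` of the form bound be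
absorbed by the kinetic energy. -/
lemma integral_le (h : IsEvenPair g α) {δ : ℝ} (hδ : 0 < δ) :
    ∫ p, g p ≤ δ * (∫ p, ‖p‖ ^ 2 * g p) +
      (volume (momentumBall (1 / Real.sqrt δ))).toReal := by
  have hi : Integrable ((momentumBall (1 / Real.sqrt δ)).indicator fun _ : Space => (1 : ℝ)) := by
    rw [integrable_indicator_iff measurableSet_closedBall]
    exact integrableOn_const (isCompact_closedBall _ _).measure_lt_top.ne
  have hk := integrable_sq_mul_of_weighted h.integrable_weighted
  have e : (volume (momentumBall (1 / Real.sqrt δ))).toReal =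
      ∫ p, (momentumBall (1 / Real.sqrt δ)).indicator (fun _ : Space => (1 : ℝ)) p := by
    rw [integral_indicator measurableSet_closedBall]
    simp [Measure.real]
  rw [e, ← integral_const_mul, ← integral_add (hk.const_mul δ) hi]
  refine integral_mono_ae (integrable_of_weighted h.integrable_weighted)
    ((hk.const_mul δ).add hi) ?_
  filter_upwards [h.nonneg, h.le_one] with p h0 h1
  by_cases hp : p ∈ momentumBall (1 / Real.sqrt δ)
  · rw [Set.indicator_of_mem hp]
    have : 0 ≤ δ * (‖p‖ ^ 2 * g p) := by positivity
    linarith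
  · rw [Set.indicator_of_notMem hp]
    have hp' : 1 / Real.sqrt δ < ‖p‖ := by simpa using hp
    have hs : 0 < Real.sqrt δ := Real.sqrt_pos.2 hδ
    have h2 : (1 / Real.sqrt δ) ^ 2 ≤ ‖p‖ ^ 2 := by gcongr
    rw [div_pow, Real.sq_sqrt hδ.le, one_pow, div_le_iff₀ hδ] at h2
    nlinarith

end IsEvenPair

/-- The BCS functional controls the free energy. -/
lemma exists_coercive {V : Space → ℝ} (hV : MemLp V (3 / 2) volume) (μ : ℝ) {T : ℝ} (hT : 0 ≤ T) :
    ∃ C : ℝ, ∀ (g : Space → ℝ) (α : L2), IsEvenPair g α →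
      compensatedEnergy μ T g α ≤ 2 * (functional V μ T ⟨g, α⟩ + C) := by
  obtain ⟨C, hC0, hC⟩ := exists_potentialEnergy_bound hV (ε := 1 / 8) (by norm_num)
  -- Chosen so that `C δ ≤ 1/8`. The potential energy then costs at most `(1/8 + 1/8) ∫ p² g` plus a
  -- constant, and `∫ p² g` is at most twice the compensated energy, so half of that energy
  -- survives.
  set δ : ℝ := 1 / (8 * (C + 1)) with hδ
  have hδ0 : 0 < δ := by positivity
  refine ⟨(∫ p, freeBound μ T p) + C * (volume (momentumBall (1 / Real.sqrt δ))).toReal,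
    fun g α h => ?_⟩
  have h1 := (abs_le.1 (hC α h.kinetic_alpha)).1
  have h2 := h.kinetic_le
  have h3 := h.norm_sq_le.trans (h.integral_le hδ0)
  have h4 := mul_le_mul_of_nonneg_left h3 hC0
  have h5 := h.integral_sq_mul_le μ hT
  have h6 := h.integral_sq_mul_nonneg
  have h7 : C * δ ≤ 1 / 8 := by
    rw [hδ, mul_one_div, div_le_div_iff₀ (by positivity) (by norm_num)]; linarith
  have h8 := mul_le_mul_of_nonneg_right h7 h6
  rw [h.functional_eq_compensated V μ hT]
  linarith

lemma IsEvenPair.memLp {g : Space → ℝ} {α : L2} (h : IsEvenPair g α) : MemLp g 2 volume := by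
  rw [memLp_two_iff_integrable_sq (aestronglyMeasurable_of_weighted h.integrable_weighted)]
  refine (integrable_of_weighted h.integrable_weighted).mono'
    ((aestronglyMeasurable_of_weighted h.integrable_weighted).pow 2) ?_
  filter_upwards [h.nonneg, h.le_one] with p h0 h1
  rw [Real.norm_of_nonneg (by positivity)]
  nlinarith

/-- The point of the Hilbert space defined by an even state. -/
def IsEvenPair.point {g : Space → ℝ} {α : L2} (h : IsEvenPair g α) : PairSpace :=
  WithLp.toLp 2 (unitaryFourier α, h.memLp.toLp g)

lemma IsEvenPair.point_fst {g : Space → ℝ} {α : L2} (h : IsEvenPair g α) :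
    h.point.fst = unitaryFourier α := rfl

lemma IsEvenPair.point_snd {g : Space → ℝ} {α : L2} (h : IsEvenPair g α) :
    h.point.snd =ᵐ[volume] g := h.memLp.coeFn_toLp

lemma IsEvenPair.norm_point_sq_le {g : Space → ℝ} {α : L2} (h : IsEvenPair g α) :
    ‖h.point‖ ^ 2 ≤ 2 * ∫ p, g p := by
  rw [WithLp.prod_norm_sq_eq_of_L2]
  have h1 : ‖h.point.snd‖ ^ 2 ≤ ∫ p, g p := by
    rw [← real_inner_self_eq_norm_sq, L2.inner_def]
    refine integral_mono_ae (L2.integrable_inner _ _)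
      (integrable_of_weighted h.integrable_weighted) ?_
    filter_upwards [h.point_snd, h.nonneg, h.le_one] with p hp h0 h1
    rw [hp]
    simp only [RCLike.inner_apply, conj_trivial]
    nlinarith
  have h2 : ‖h.point.fst‖ ^ 2 ≤ ∫ p, g p := by
    rw [h.point_fst, LinearIsometryEquiv.norm_map]; exact h.norm_sq_le
  linarith

lemma IsEvenPair.point_mem {g : Space → ℝ} {α : L2} (h : IsEvenPair g α) (μ : ℝ) {T : ℝ}
    (hT : 0 ≤ T) {c : ℝ} (hc : compensatedEnergy μ T g α ≤ c) :
    h.point ∈ energySublevel μ T c := by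
  have hs := h.point_snd
  have hs' := ae_comp_neg hs
  refine ⟨h.even_right, ?_, ?_, ?_⟩
  · filter_upwards [hs, hs', h.even_left] with p h1 h2 h3
    rw [h1, h2, h3]
  · filter_upwards [hs, h.spread_le] with p h1 h2
    rw [h1]; exact h2
  · have e : ∫⁻ p, ENNReal.ofReal (compensatedDensity μ T p (h.point.snd p) (h.point.fst p)) =
        ENNReal.ofReal (compensatedEnergy μ T g α) := by
      rw [compensatedEnergy, ofReal_integral_eq_lintegral_ofReal
        (h.integrable_compensatedDensity μ hT)
        (h.spread_le.mono fun p hp => compensatedDensity_nonneg μ hT p hp)]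
      refine lintegral_congr_ae ?_
      filter_upwards [hs] with p h1
      rw [h1, h.point_fst]
    rw [e]
    exact ENNReal.ofReal_le_ofReal hc

/-- Weighted integrability of `g` is recovered from the energy: `(1 + p²) g` is at most four times
the compensated density outside the unit ball, and at most `2` inside. -/
lemma isEvenPair_of_mem {μ T c : ℝ} (hT : 0 ≤ T) {x : PairSpace} (hx : x ∈ energySublevel μ T c) :
    IsEvenPair x.snd (unitaryFourier.symm x.fst) := by
  obtain ⟨h1, h2, h3, h4⟩ := hx
  refine ⟨?_, h2, by simpa using h1, by simpa using h3⟩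
  have hm := (Lp.memLp x.snd).1
  have hi : Integrable fun p => compensatedDensity μ T p (x.snd p) (x.fst p) := by
    refine ⟨aemeasurable_compensatedDensity μ hT hm (Lp.memLp x.fst).1, ?_⟩
    rw [hasFiniteIntegral_iff_ofReal (h3.mono fun p hp => compensatedDensity_nonneg μ hT p hp)]
    exact h4.trans_lt ENNReal.ofReal_lt_top
  have hb : Integrable ((momentumBall 1).indicator fun _ : Space => (2 : ℝ)) := by
    rw [integrable_indicator_iff measurableSet_closedBall]
    exact integrableOn_const (isCompact_closedBall _ _).measure_lt_top.ne
  refine ((hi.const_mul 4).add hb).mono' ((by fun_prop : Continuous fun p : Space =>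
    1 + ‖p‖ ^ 2).aestronglyMeasurable.mul hm) ?_
  filter_upwards [h3] with p hp
  have hc := (pairConstraint_self_iff _ _).2 hp
  have h0 := hc.nonneg_left
  have h1 := hc.le_one_left
  have h2 := compensatedDensity_ge μ hT p hp
  rw [Real.norm_of_nonneg (by positivity)]
  simp only [Pi.add_apply]
  by_cases hp1 : p ∈ momentumBall 1
  · rw [Set.indicator_of_mem hp1]
    have : ‖p‖ ^ 2 ≤ 1 := by
      have : ‖p‖ ≤ 1 := by simpa using hp1
      nlinarith [norm_nonneg p]
    have : 0 ≤ ‖p‖ ^ 2 * x.snd p := by positivity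
    nlinarith
  · rw [Set.indicator_of_notMem hp1]
    have : 1 ≤ ‖p‖ ^ 2 := by
      have : 1 < ‖p‖ := by simpa using hp1
      nlinarith
    nlinarith

lemma compensatedEnergy_le_of_mem {μ T c : ℝ} (hT : 0 ≤ T) (hc : 0 ≤ c) {x : PairSpace}
    (hx : x ∈ energySublevel μ T c) :
    compensatedEnergy μ T x.snd (unitaryFourier.symm x.fst) ≤ c := by
  have h := isEvenPair_of_mem hT hx
  rw [← ENNReal.ofReal_le_ofReal_iff hc, compensatedEnergy,
    ofReal_integral_eq_lintegral_ofReal (h.integrable_compensatedDensity μ hT)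
      (h.spread_le.mono fun p hp => compensatedDensity_nonneg μ hT p hp)]
  simpa using hx.2.2.2

lemma isEvenPair_zero : IsEvenPair (fun _ => 0) 0 := by
  have h0 : (unitaryFourier (0 : L2) : Space → ℂ) =ᵐ[volume] 0 := by
    rw [map_zero]; exact Lp.coeFn_zero _ _ _
  refine ⟨by simp, by simp, ?_, ?_⟩
  · filter_upwards [h0, ae_comp_neg h0] with p h1 h2
    rw [h1, h2]; rfl
  · filter_upwards [h0] with p h1
    rw [h1, spread, Pi.zero_apply, norm_zero]
    rw [show ((0 : ℝ) - 1 / 2) ^ 2 + 0 ^ 2 = (1 / 2) ^ 2 by norm_num, Real.sqrt_sq (by norm_num)]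

lemma bddBelow_functional {V : Space → ℝ} (hV : MemLp V (3 / 2) volume) (μ : ℝ) {T : ℝ}
    (hT : 0 ≤ T) : BddBelow (functional V μ T '' domain) := by
  obtain ⟨C, hC⟩ := exists_coercive hV μ hT
  refine ⟨-C, ?_⟩
  rintro _ ⟨Γ, hΓ, rfl⟩
  have hE := isEvenPair_evenPart hΓ
  have h1 := hC _ _ hE
  have h2 := functional_evenPart_le hΓ V μ hT
  have h3 := hE.integral_sq_mul_le μ hT
  have h4 := hE.integral_sq_mul_nonneg
  linarith

/-- The BCS functional attains its minimum. -/
lemma exists_isMinimizer {V : Space → ℝ} (hV : MemLp V (3 / 2) volume) (μ : ℝ) {T : ℝ}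
    (hT : 0 ≤ T) : ∃ Γ, IsMinimizer V μ T Γ := by
  obtain ⟨C, hC⟩ := exists_coercive hV μ hT
  have hbdd := bddBelow_functional hV μ hT
  have hne : (functional V μ T '' domain).Nonempty := ⟨_, _, isEvenPair_zero.mem_domain, rfl⟩
  set m := sInf (functional V μ T '' domain) with hm
  obtain ⟨u, -, hu, hmem⟩ := exists_seq_tendsto_sInf hne hbdd
  choose Γ hΓ hΓu using hmem
  have hE : ∀ n, IsEvenPair (evenPart (Γ n).gammaHat) (Γ n).alpha := fun n =>
    isEvenPair_evenPart (hΓ n)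
  set F : ℕ → ℝ := fun n => functional V μ T ⟨evenPart (Γ n).gammaHat, (Γ n).alpha⟩ with hF
  have hFlim : Tendsto F atTop (𝓝 m) := by
    refine tendsto_of_tendsto_of_tendsto_of_le_of_le tendsto_const_nhds hu (fun n => ?_)
      (fun n => ?_)
    · exact csInf_le hbdd ⟨_, (hE n).mem_domain, rfl⟩
    · rw [← hΓu n]; exact functional_evenPart_le (hΓ n) V μ hT
  obtain ⟨M, hM⟩ := hFlim.bddAbove_range
  -- The maximum with zero is needed because sublevels are stated through `ENNReal.ofReal`.
  set c₀ := max 0 (2 * (M + C)) with hc₀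
  have hI : ∀ n, compensatedEnergy μ T (evenPart (Γ n).gammaHat) (Γ n).alpha ≤ c₀ := fun n => by
    refine (hC _ _ (hE n)).trans (le_trans ?_ (le_max_right _ _))
    have : F n ≤ M := hM ⟨n, rfl⟩
    linarith
  set v := (volume (momentumBall (1 / Real.sqrt 1))).toReal with hv
  have hv0 : 0 ≤ v := ENNReal.toReal_nonneg
  set R := 2 * c₀ + v with hR
  have hRall : ∀ (g : Space → ℝ) (α : L2), IsEvenPair g α → compensatedEnergy μ T g α ≤ c₀ →
      ∫ p, g p ≤ R ∧ ‖α‖ ^ 2 ≤ R ∧ kinetic α ≤ R := by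
    intro g α h hle
    have h1 := h.integral_sq_mul_le μ hT
    have h2 := h.integral_le one_pos
    have h3 := h.kinetic_le
    have h4 := h.norm_sq_le
    refine ⟨?_, ?_, ?_⟩ <;> linarith
  have hnorm : ∀ n, ‖(hE n).point‖ ≤ Real.sqrt (2 * R) := fun n => by
    refine Real.le_sqrt_of_sq_le ((hE n).norm_point_sq_le.trans ?_)
    linarith [(hRall _ _ (hE n) (hI n)).1]
  obtain ⟨x₀, φ, hφ, hweak⟩ := exists_weakly_convergent_subseq hnorm
  -- This crude level already shows that the weak limit is an even state of bounded kinetic energy,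
  -- as the convergence of the potential energy requires. The sharp level comes afterwards.
  have hmem0 : x₀ ∈ energySublevel μ T c₀ :=
    mem_of_weakly_tendsto (isClosed_energySublevel μ hT c₀) (convex_energySublevel μ hT c₀)
      (Eventually.of_forall fun n => (hE (φ n)).point_mem μ hT (hI (φ n))) hweak
  have hc₀0 : 0 ≤ c₀ := le_max_left _ _
  have hE0 := isEvenPair_of_mem hT hmem0
  have hI0 := compensatedEnergy_le_of_mem hT hc₀0 hmem0
  set α₀ := unitaryFourier.symm x₀.fst with hα₀
  have hpot : Tendsto (fun n => potentialEnergy V (Γ (φ n)).alpha) atTop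
      (𝓝 (potentialEnergy V α₀)) := by
    refine tendsto_potentialEnergy hV (fun f => ?_) (fun n => (hE (φ n)).kinetic_alpha)
      hE0.kinetic_alpha (fun n => (hRall _ _ (hE (φ n)) (hI (φ n))).2.1)
      (hRall _ _ hE0 hI0).2.1 (fun n => (hRall _ _ (hE (φ n)) (hI (φ n))).2.2)
      (hRall _ _ hE0 hI0).2.2
    rw [hα₀, LinearIsometryEquiv.apply_symm_apply]
    exact tendsto_inner_fst hweak f
  set B := ∫ p, freeBound μ T p with hB
  set ℓ := m - potentialEnergy V α₀ + B with hℓ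
  have hIlim : Tendsto (fun n => compensatedEnergy μ T (evenPart (Γ (φ n)).gammaHat)
      (Γ (φ n)).alpha) atTop (𝓝 ℓ) := by
    refine (((hFlim.comp hφ.tendsto_atTop).sub hpot).add_const B).congr fun n => ?_
    simp only [Function.comp_apply, hF]
    rw [(hE (φ n)).functional_eq_compensated V μ hT]
    ring
  have hℓ0 : 0 ≤ ℓ := by
    refine ge_of_tendsto' hIlim fun n => ?_
    linarith [(hE (φ n)).integral_sq_mul_le μ hT, (hE (φ n)).integral_sq_mul_nonneg]
  refine ⟨⟨x₀.snd, α₀⟩, hE0.mem_domain, fun Γ' hΓ' => ?_⟩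
  refine le_trans (le_of_forall_pos_le_add fun ε hε => ?_) (csInf_le hbdd ⟨_, hΓ', rfl⟩)
  -- The energies converge to `ℓ`, so the sequence eventually lies in this weakly closed set. This
  -- is weak lower semicontinuity of the free energy.
  have hmemε : x₀ ∈ energySublevel μ T (ℓ + ε) := by
    refine mem_of_weakly_tendsto (isClosed_energySublevel μ hT _) (convex_energySublevel μ hT _)
      ?_ hweak
    filter_upwards [hIlim.eventually (gt_mem_nhds (show ℓ < ℓ + ε by linarith))] with n hn
    exact (hE (φ n)).point_mem μ hT hn.le
  have hle := compensatedEnergy_le_of_mem hT (by linarith) hmemε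
  rw [hE0.functional_eq_compensated V μ hT]
  linarith

/-! ### Pointwise minimization in an external field. -/

lemma negMulLog_le_gibbs {s t : ℝ} (ht : 0 ≤ t) (hs : 0 < s) :
    Real.negMulLog t ≤ -t * Real.log s + s - t := by
  rcases eq_or_lt_of_le ht with h0 | h0
  · rw [← h0]; simp; exact hs.le
  · have h := Real.log_le_sub_one_of_pos (div_pos hs h0)
    rw [Real.log_div hs.ne' h0.ne'] at h
    have h2 := mul_le_mul_of_nonneg_left h ht
    have e : t * (s / t - 1) = s - t := by field_simp
    rw [e] at h2
    rw [Real.negMulLog]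
    linarith

lemma negMulLog_lt_gibbs {s t : ℝ} (ht : 0 ≤ t) (hs : 0 < s) (hst : t ≠ s) :
    Real.negMulLog t < -t * Real.log s + s - t := by
  rcases eq_or_lt_of_le ht with h0 | h0
  · rw [← h0]; simp; exact hs
  · have h := Real.log_lt_sub_one_of_pos (div_pos hs h0)
      (fun h => hst (by rw [div_eq_one_iff_eq h0.ne'] at h; exact h.symm))
    rw [Real.log_div hs.ne' h0.ne'] at h
    have h2 := mul_lt_mul_of_pos_left h h0
    have e : t * (s / t - 1) = s - t := by field_simp
    rw [e] at h2
    rw [Real.negMulLog]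
    linarith

/-- The strict Gibbs inequality for two-point distributions. -/
lemma binEntropy_lt_gibbs {x y : ℝ} (hx0 : 0 ≤ x) (hx1 : x ≤ 1) (hy0 : 0 < y) (hy1 : y < 1)
    (hxy : x ≠ y) :
    Real.binEntropy x < -x * Real.log y - (1 - x) * Real.log (1 - y) := by
  rw [Real.binEntropy_eq_negMulLog_add_negMulLog_one_sub]
  have h1 := negMulLog_lt_gibbs hx0 hy0 hxy
  have h2 := negMulLog_le_gibbs (sub_nonneg.2 hx1) (sub_pos.2 hy1)
  linarith

/-- The spread of the pointwise minimizer of the linearized functional at energy `E`. -/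
def equilibriumSpread (T E : ℝ) : ℝ := if T = 0 then 1 / 2 else Real.tanh (E / (2 * T)) / 2

lemma equilibriumSpread_le (T E : ℝ) : equilibriumSpread T E ≤ 1 / 2 := by
  unfold equilibriumSpread
  split_ifs
  · rfl
  · linarith [Real.tanh_lt_one (E / (2 * T))]

lemma equilibriumSpread_nonneg {T E : ℝ} (hT : 0 ≤ T) (hE : 0 ≤ E) :
    0 ≤ equilibriumSpread T E := by
  unfold equilibriumSpread
  split_ifs
  · norm_num
  · rw [Real.tanh_eq_sinh_div_cosh]
    have h1 := Real.sinh_nonneg_iff.2 (show 0 ≤ E / (2 * T) by positivity)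
    have h2 := Real.cosh_pos (E / (2 * T))
    positivity

lemma measurable_equilibriumSpread (T : ℝ) : Measurable (equilibriumSpread T) := by
  unfold equilibriumSpread
  split_ifs
  · exact measurable_const
  · have h : Measurable Real.tanh := by
      have : Real.tanh = fun x => Real.sinh x / Real.cosh x := by
        ext x; exact Real.tanh_eq_sinh_div_cosh x
      rw [this]
      exact Real.continuous_sinh.measurable.div Real.continuous_cosh.measurable
    exact (h.comp (measurable_id.div_const _)).div_const _

lemma log_half_add_half_tanh (u : ℝ) :
    Real.log (1 / 2 + Real.tanh u / 2) = u - Real.log (2 * Real.cosh u) := by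
  have hc := Real.cosh_pos u
  rw [Real.tanh_eq_sinh_div_cosh, show 1 / 2 + Real.sinh u / Real.cosh u / 2 =
    Real.exp u / (2 * Real.cosh u) by rw [← Real.cosh_add_sinh]; field_simp,
    Real.log_div (Real.exp_pos _).ne' (by positivity), Real.log_exp]

/-- The equilibrium spread is the unique minimizer of the free energy at a given energy. -/
lemma free_energy_spread_lt {T E r : ℝ} (hT : 0 ≤ T) (hE : 0 < E) (hr0 : 0 ≤ r) (hr1 : r ≤ 1 / 2)
    (hr : r ≠ equilibriumSpread T E) :
    E * r + T * Real.binEntropy (1 / 2 + r) <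
      E * equilibriumSpread T E + T * Real.binEntropy (1 / 2 + equilibriumSpread T E) := by
  unfold equilibriumSpread at *
  split_ifs at * with h0
  · rw [h0, zero_mul, zero_mul, add_zero, add_zero]
    exact mul_lt_mul_of_pos_left (lt_of_le_of_ne hr1 hr) hE
  · have hT' : 0 < T := lt_of_le_of_ne hT (Ne.symm h0)
    set u := E / (2 * T) with hu
    have hEu : E = 2 * T * u := by rw [hu]; field_simp
    have h1 := Real.tanh_lt_one u
    have h2 := Real.neg_one_lt_tanh u
    have l1 := log_half_add_half_tanh u
    have l2 := log_half_add_half_tanh (-u)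
    rw [Real.tanh_neg, Real.cosh_neg,
      show 1 / 2 + -Real.tanh u / 2 = 1 - (1 / 2 + Real.tanh u / 2) by ring] at l2
    -- For this reference `y` one has `log y - log (1 - y) = 2u = E/T`, so the linear terms of Gibbs
    -- reproduce the energy `E r`.
    have g := binEntropy_lt_gibbs (x := 1 / 2 + r) (y := 1 / 2 + Real.tanh u / 2) (by linarith)
      (by linarith) (by linarith) (by linarith) (fun h => hr (by linarith))
    have e : Real.binEntropy (1 / 2 + Real.tanh u / 2) =
        -(1 / 2 + Real.tanh u / 2) * Real.log (1 / 2 + Real.tanh u / 2) -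
          (1 - (1 / 2 + Real.tanh u / 2)) * Real.log (1 - (1 / 2 + Real.tanh u / 2)) := by
      rw [Real.binEntropy_eq_negMulLog_add_negMulLog_one_sub, Real.negMulLog, Real.negMulLog]
      ring
    rw [l1, l2] at g e
    rw [e, hEu]
    have g2 := mul_lt_mul_of_pos_left g hT'
    nlinarith

/-- Energy of a state against the external field `(e, Δ)`, without the entropy. -/
lemma neg_le_field_energy {e x E : ℝ} {D a : ℂ} (hE : 0 ≤ E) (hE2 : E ^ 2 = e ^ 2 + ‖D‖ ^ 2)
    {s : ℝ} (hs : 0 ≤ s) (hs2 : s ^ 2 = x ^ 2 + ‖a‖ ^ 2) :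
    -(E * s) ≤ e * x + (conj D * a).re := by
  have h1 : -(‖D‖ * ‖a‖) ≤ (conj D * a).re := by
    have := (abs_le.1 (Complex.abs_re_le_norm (conj D * a))).1
    rwa [norm_mul, RCLike.norm_conj] at this
  -- Cauchy-Schwarz for the vectors `(e, D)` and `(x, a)`, of lengths `E` and `s`.
  have h2 : |e| * |x| + ‖D‖ * ‖a‖ ≤ E * s := by
    refine abs_le_of_sq_le_sq' ?_ (by positivity) |>.2
    have : (E * s) ^ 2 = (|e| ^ 2 + ‖D‖ ^ 2) * (|x| ^ 2 + ‖a‖ ^ 2) := by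
      rw [mul_pow, hE2, hs2, sq_abs, sq_abs]
    rw [this]
    nlinarith [sq_nonneg (|e| * ‖a‖ - ‖D‖ * |x|)]
  have h3 := neg_abs_le (e * x)
  rw [abs_mul] at h3
  linarith

/-- Equality in Cauchy-Schwarz: the squared length of `E (x, a) + s (e, D)` expands to zero. -/
lemma eq_of_field_energy_eq {e x E : ℝ} {D a : ℂ} (hE : 0 < E) (hE2 : E ^ 2 = e ^ 2 + ‖D‖ ^ 2)
    {s : ℝ} (hs2 : s ^ 2 = x ^ 2 + ‖a‖ ^ 2)
    (h : e * x + (conj D * a).re = -(E * s)) : a = -((s / E : ℝ) : ℂ) * D := by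
  have hD : ‖D‖ ^ 2 = D.re ^ 2 + D.im ^ 2 := by rw [Complex.sq_norm, Complex.normSq_apply]; ring
  have ha : ‖a‖ ^ 2 = a.re ^ 2 + a.im ^ 2 := by rw [Complex.sq_norm, Complex.normSq_apply]; ring
  have hre : (conj D * a).re = D.re * a.re + D.im * a.im := by simp
  have key : (E * x + s * e) ^ 2 + ((E * a.re + s * D.re) ^ 2 + (E * a.im + s * D.im) ^ 2) = 0 := by
    have : (E * x + s * e) ^ 2 + ((E * a.re + s * D.re) ^ 2 + (E * a.im + s * D.im) ^ 2) =
        E ^ 2 * (x ^ 2 + ‖a‖ ^ 2) + s ^ 2 * (e ^ 2 + ‖D‖ ^ 2) +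
          2 * E * s * (e * x + (conj D * a).re) := by
      rw [hD, ha, hre]; ring
    rw [this, ← hs2, ← hE2, h]; ring
  have k1 : E * a.re + s * D.re = 0 := by
    refine pow_eq_zero_iff two_ne_zero |>.1 ?_
    nlinarith [sq_nonneg (E * x + s * e), sq_nonneg (E * a.re + s * D.re),
      sq_nonneg (E * a.im + s * D.im)]
  have k2 : E * a.im + s * D.im = 0 := by
    refine pow_eq_zero_iff two_ne_zero |>.1 ?_
    nlinarith [sq_nonneg (E * x + s * e), sq_nonneg (E * a.re + s * D.re),
      sq_nonneg (E * a.im + s * D.im)]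
  apply Complex.ext
  · rw [← Complex.ofReal_neg, Complex.re_ofReal_mul]
    field_simp
    linarith
  · rw [← Complex.ofReal_neg, Complex.im_ofReal_mul]
    field_simp
    linarith

/-- The density of the BCS functional linearized in the interaction at the gap `D`. -/
def linearizedDensity (μ T : ℝ) (D : ℂ) (p : Space) (g : ℝ) (a : ℂ) : ℝ :=
  freeDensity μ T p g a + (conj D * a).re

/-- Momentum distribution of the thermal equilibrium state with gap function `Δ`. -/
def equilibriumDensity (μ T : ℝ) (Δ : Space → ℂ) (p : Space) : ℝ :=
  1 / 2 - equilibriumSpread T (energy μ Δ p) / energy μ Δ p * (‖p‖ ^ 2 - μ)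

/-- Pair wave function of the thermal equilibrium state with gap function `Δ`. -/
def equilibriumPair (μ T : ℝ) (Δ : Space → ℂ) (p : Space) : ℂ :=
  -((equilibriumSpread T (energy μ Δ p) / energy μ Δ p : ℝ) : ℂ) * Δ p

lemma energy_nonneg (μ : ℝ) (Δ : Space → ℂ) (p : Space) : 0 ≤ energy μ Δ p := Real.sqrt_nonneg _

lemma energy_sq (μ : ℝ) (Δ : Space → ℂ) (p : Space) :
    energy μ Δ p ^ 2 = (‖p‖ ^ 2 - μ) ^ 2 + ‖Δ p‖ ^ 2 := Real.sq_sqrt (by positivity)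

lemma energy_neg {μ : ℝ} {Δ : Space → ℂ} (hΔ : ∀ p, Δ (-p) = Δ p) (p : Space) :
    energy μ Δ (-p) = energy μ Δ p := by
  simp only [energy, norm_neg, hΔ]

/-- A zero of the energy has `p² = μ`, so it lies on a sphere, a null set. The conventions at zero
energy thus never matter under an integral. -/
lemma ae_energy_pos (μ : ℝ) (Δ : Space → ℂ) : ∀ᵐ p, 0 < energy μ Δ p := by
  have h : volume (Metric.sphere (0 : Space) (Real.sqrt μ)) = 0 := Measure.addHaar_sphere _ _ _
  filter_upwards [measure_eq_zero_iff_ae_notMem.1 h] with p hp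
  refine lt_of_le_of_ne (energy_nonneg μ Δ p) fun h0 => hp ?_
  have h1 := energy_sq μ Δ p
  rw [← h0] at h1
  have h2 : ‖p‖ ^ 2 - μ = 0 := by
    refine pow_eq_zero_iff two_ne_zero |>.1 ?_
    nlinarith [sq_nonneg (‖p‖ ^ 2 - μ), sq_nonneg ‖Δ p‖]
  rw [mem_sphere_zero_iff_norm, show μ = ‖p‖ ^ 2 by linarith, Real.sqrt_sq (norm_nonneg p)]

lemma spread_equilibrium {μ T : ℝ} {Δ : Space → ℂ} (hT : 0 ≤ T) {p : Space}
    (hp : 0 < energy μ Δ p) :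
    spread (equilibriumDensity μ T Δ p) (equilibriumPair μ T Δ p) =
      equilibriumSpread T (energy μ Δ p) := by
  have h0 := equilibriumSpread_nonneg hT hp.le
  rw [← sq_eq_sq₀ (spread_nonneg _ _) h0, spread_sq, equilibriumPair, equilibriumDensity, norm_mul,
    norm_neg, Complex.norm_real, Real.norm_of_nonneg (by positivity), mul_pow, div_pow]
  have e := energy_sq μ Δ p
  set E := energy μ Δ p
  set ρ := equilibriumSpread T E
  calc _ = ρ ^ 2 / E ^ 2 * ((‖p‖ ^ 2 - μ) ^ 2 + ‖Δ p‖ ^ 2) := by ring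
    _ = ρ ^ 2 := by rw [← e]; field_simp

lemma linearizedDensity_equilibrium {μ T : ℝ} {Δ : Space → ℂ} (hT : 0 ≤ T) {p : Space}
    (hp : 0 < energy μ Δ p) :
    linearizedDensity μ T (Δ p) p (equilibriumDensity μ T Δ p) (equilibriumPair μ T Δ p) =
      (‖p‖ ^ 2 - μ) / 2 - (energy μ Δ p * equilibriumSpread T (energy μ Δ p) +
        T * Real.binEntropy (1 / 2 + equilibriumSpread T (energy μ Δ p))) := by
  have h1 : (conj (Δ p) * equilibriumPair μ T Δ p).re =
      -(equilibriumSpread T (energy μ Δ p) / energy μ Δ p * ‖Δ p‖ ^ 2) := by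
    rw [equilibriumPair, mul_left_comm, Complex.conj_mul', ← Complex.ofReal_neg,
      ← Complex.ofReal_pow, ← Complex.ofReal_mul, Complex.ofReal_re]
    ring
  rw [linearizedDensity, h1, freeDensity, evenEntropy, spread_equilibrium hT hp, equilibriumDensity]
  have e := energy_sq μ Δ p
  set E := energy μ Δ p
  set ρ := equilibriumSpread T E
  have : ρ / E * ((‖p‖ ^ 2 - μ) ^ 2 + ‖Δ p‖ ^ 2) = E * ρ := by rw [← e]; field_simp
  linarith

/-- The equilibrium state minimizes the linearized density, and its pair wave function is
determined by this property. -/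
lemma linearizedDensity_ge {μ T : ℝ} {Δ : Space → ℂ} (hT : 0 ≤ T) {p : Space}
    (hp : 0 < energy μ Δ p) {g : ℝ} {a : ℂ} (h : spread g a ≤ 1 / 2) :
    linearizedDensity μ T (Δ p) p (equilibriumDensity μ T Δ p) (equilibriumPair μ T Δ p) ≤
        linearizedDensity μ T (Δ p) p g a ∧
      (linearizedDensity μ T (Δ p) p g a ≤
        linearizedDensity μ T (Δ p) p (equilibriumDensity μ T Δ p) (equilibriumPair μ T Δ p) →
        a = equilibriumPair μ T Δ p) := by
  rw [linearizedDensity_equilibrium hT hp, linearizedDensity, freeDensity, evenEntropy]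
  -- Two independent optimizations: the direction of `(g - 1/2, a)` at fixed spread, then the spread
  -- itself. Uniqueness of `a` needs equality in both.
  have hC := neg_le_field_energy (a := a) (x := g - 1 / 2) hp.le (energy_sq μ Δ p)
    (spread_nonneg g a) (spread_sq g a)
  have hlt := free_energy_spread_lt hT hp (spread_nonneg g a) h
  have hle : energy μ Δ p * spread g a + T * Real.binEntropy (1 / 2 + spread g a) ≤
      energy μ Δ p * equilibriumSpread T (energy μ Δ p) +
        T * Real.binEntropy (1 / 2 + equilibriumSpread T (energy μ Δ p)) := by
    by_cases hr : spread g a = equilibriumSpread T (energy μ Δ p)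
    · rw [hr]
    · exact (hlt hr).le
  refine ⟨by linarith, fun hge => ?_⟩
  have hr : spread g a = equilibriumSpread T (energy μ Δ p) := by
    by_contra hr
    linarith [hlt hr]
  rw [hr] at hge hC
  rw [equilibriumPair]
  refine eq_of_field_energy_eq (x := g - 1 / 2) hp (energy_sq μ Δ p) (hr ▸ spread_sq g a) ?_
  linarith

/-- Links `K` to the equilibrium state: `1/K` is twice the equilibrium spread over the energy, at `T
= 0` as well. -/
lemma div_K_eq {μ T : ℝ} {Δ : Space → ℂ} {p : Space} (hp : 0 < energy μ Δ p) :
    Δ p / (K μ T Δ p : ℂ) = -2 * equilibriumPair μ T Δ p := by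
  have h : (K μ T Δ p)⁻¹ = 2 * (equilibriumSpread T (energy μ Δ p) / energy μ Δ p) := by
    rw [K, equilibriumSpread]
    split_ifs with h0 h1
    · field_simp
    · exact absurd h1 hp.ne'
    · rw [inv_div]; ring
  rw [div_eq_mul_inv, ← Complex.ofReal_inv, h, equilibriumPair]
  push_cast
  ring

lemma measurable_energy (μ : ℝ) {Δ : Space → ℂ} (hΔ : Continuous Δ) : Measurable (energy μ Δ) := by
  have : Continuous (energy μ Δ) := by unfold energy; fun_prop
  exact this.measurable

lemma measurable_equilibriumDensity (μ T : ℝ) {Δ : Space → ℂ} (hΔ : Continuous Δ) :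
    Measurable (equilibriumDensity μ T Δ) := by
  have h := measurable_energy μ hΔ
  have h2 : Measurable fun p : Space => ‖p‖ ^ 2 - μ := by fun_prop
  exact measurable_const.sub
    ((((measurable_equilibriumSpread T).comp h).div h).mul h2)

lemma measurable_equilibriumPair (μ T : ℝ) {Δ : Space → ℂ} (hΔ : Continuous Δ) :
    Measurable (equilibriumPair μ T Δ) := by
  have h := measurable_energy μ hΔ
  exact (Complex.measurable_ofReal.comp (((measurable_equilibriumSpread T).comp h).div h)).neg.mul
    hΔ.measurable

/-! ### Evenness of the gap field. -/

/-- Reflection of square-integrable functions. -/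
def reflection : L2 → L2 :=
  Lp.compMeasurePreserving Neg.neg (Measure.measurePreserving_neg (volume : Measure Space))

lemma coeFn_reflection (f : L2) : reflection f =ᵐ[volume] fun x => f (-x) :=
  Lp.coeFn_compMeasurePreserving f (Measure.measurePreserving_neg (volume : Measure Space))

lemma continuous_reflection : Continuous reflection :=
  (Lp.isometry_compMeasurePreserving
    (Measure.measurePreserving_neg (volume : Measure Space))).continuous

lemma fourierIntegral_comp_neg (f : Space → ℂ) (p : Space) :
    fourierIntegral (fun x => f (-x)) p = fourierIntegral f (-p) := by
  rw [fourierIntegral, fourierIntegral, ← integral_neg_eq_self]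
  simp [planeWave]

/-- The Fourier transform commutes with reflection. -/
lemma unitaryFourier_reflection (f : L2) :
    unitaryFourier (reflection f) = reflection (unitaryFourier f) := by
  refine congrFun ((SchwartzMap.denseRange_toLpCLM (E := Space) (F := ℂ)
    (μ := volume) (p := 2) (by norm_num)).equalizer
    (g := fun f => unitaryFourier (reflection f))
    (h := fun f => reflection (unitaryFourier f))
    (unitaryFourier.continuous.comp continuous_reflection)
    (continuous_reflection.comp unitaryFourier.continuous) (funext fun φ => ?_)) f
  simp only [Function.comp_apply]
  set ψ : L2 := SchwartzMap.toLpCLM ℝ ℂ 2 volume φ with hψ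
  have hint : Integrable (ψ : Space → ℂ) :=
    (φ.integrable (μ := volume)).congr (φ.coeFn_toLp 2 volume).symm
  have hr := coeFn_reflection ψ
  have hint' : Integrable (reflection ψ : Space → ℂ) := hint.comp_neg.congr hr.symm
  refine Lp.ext ?_
  filter_upwards [unitaryFourier_ae_eq hint', coeFn_reflection (unitaryFourier ψ),
    ae_comp_neg (unitaryFourier_ae_eq hint)] with p h1 h2 h3
  rw [h1, h2, h3, fourierIntegral_congr hr, fourierIntegral_comp_neg]

lemma ae_even_of_unitaryFourier {α : L2}
    (h : ∀ᵐ p, unitaryFourier α (-p) = unitaryFourier α p) : ∀ᵐ x, α (-x) = α x := by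
  have h1 : reflection α = α := by
    apply unitaryFourier.injective
    rw [unitaryFourier_reflection]
    refine Lp.ext ?_
    filter_upwards [coeFn_reflection (unitaryFourier α), h] with p h1 h2
    rw [h1, h2]
  filter_upwards [coeFn_reflection α] with x hx
  rw [← hx, h1]

/-- `Vα` is even when both factors are. This makes the equilibrium state in the field `Δ` an
admissible even competitor. -/
lemma gapField_neg {V : Space → ℝ} (hV : ∀ᵐ x, V (-x) = V x) {α : L2}
    (h : ∀ᵐ p, unitaryFourier α (-p) = unitaryFourier α p) (p : Space) :
    gapField V α (-p) = gapField V α p := by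
  rw [gapField, gapField, ← fourierIntegral_comp_neg]
  congr 1
  refine fourierIntegral_congr ?_ p
  filter_upwards [hV, ae_even_of_unitaryFourier h] with x h1 h2
  rw [h1, h2]

/-! ### First variation and the Euler-Lagrange equation. -/

lemma unitaryFourier_segment (α α' : L2) (t : ℝ) :
    (unitaryFourier (α + (t : ℂ) • (α' - α)) : Space → ℂ) =ᵐ[volume]
      fun p => ((1 - t : ℝ) : ℂ) * unitaryFourier α p + (t : ℂ) * unitaryFourier α' p := by
  rw [map_add, map_smul, map_sub]
  filter_upwards [Lp.coeFn_add (unitaryFourier α) ((t : ℂ) • (unitaryFourier α' - unitaryFourier α)),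
    Lp.coeFn_smul (t : ℂ) (unitaryFourier α' - unitaryFourier α),
    Lp.coeFn_sub (unitaryFourier α') (unitaryFourier α)] with p h1 h2 h3
  rw [h1, Pi.add_apply, h2, Pi.smul_apply, h3, Pi.sub_apply, smul_eq_mul]
  push_cast
  ring

lemma unitaryFourier_sub_ae (α α' : L2) :
    (unitaryFourier (α' - α) : Space → ℂ) =ᵐ[volume]
      fun p => unitaryFourier α' p - unitaryFourier α p := by
  rw [map_sub]
  exact Lp.coeFn_sub _ _

/-- Even states form a convex set. -/
lemma IsEvenPair.segment {g g' : Space → ℝ} {α α' : L2} (h : IsEvenPair g α)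
    (h' : IsEvenPair g' α') {t : ℝ} (ht0 : 0 ≤ t) (ht1 : t ≤ 1) :
    IsEvenPair (fun p => (1 - t) * g p + t * g' p) (α + (t : ℂ) • (α' - α)) := by
  have hU := unitaryFourier_segment α α' t
  refine ⟨?_, ?_, ?_, ?_⟩
  · refine ((h.integrable_weighted.const_mul (1 - t)).add
      (h'.integrable_weighted.const_mul t)).congr (Eventually.of_forall fun p => ?_)
    simp only [Pi.add_apply]; ring
  · filter_upwards [h.even_left, h'.even_left] with p h1 h2
    rw [h1, h2]
  · filter_upwards [hU, ae_comp_neg hU, h.even_right, h'.even_right] with p h1 h2 h3 h4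
    rw [h1, h2, h3, h4]
  · filter_upwards [hU, h.spread_le, h'.spread_le] with p h1 h2 h3
    rw [h1]
    refine (spread_convex (sub_nonneg.2 ht1) ht0 (by ring)).trans ?_
    nlinarith

lemma freeDensity_convex (μ : ℝ) {T : ℝ} (hT : 0 ≤ T) (p : Space) {g g' : ℝ} {a a' : ℂ}
    (h : spread g a ≤ 1 / 2) (h' : spread g' a' ≤ 1 / 2) {s t : ℝ} (hs : 0 ≤ s) (ht : 0 ≤ t)
    (hst : s + t = 1) :
    freeDensity μ T p (s * g + t * g') (s * a + t * a') ≤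
      s * freeDensity μ T p g a + t * freeDensity μ T p g' a' := by
  have := mul_le_mul_of_nonneg_left (evenEntropy_concave h h' hs ht hst) hT
  unfold freeDensity
  linarith

/-- The gap field is bounded, being the transform of an integrable function. -/
lemma integrable_conj_gapField_mul {V : Space → ℝ} (hV : MemLp V (3 / 2) volume) {α : L2}
    (hα : Integrable fun p => ‖p‖ ^ 2 * ‖unitaryFourier α p‖ ^ 2) {b : Space → ℂ}
    (hb : Integrable b) : Integrable fun p => conj (gapField V α p) * b p := by
  refine hb.bdd_mul (c := 2 * (fourierConst * ∫ x, ‖(V x : ℂ) * α x‖))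
    (Complex.continuous_conj.comp (continuous_gapField hV hα)).aestronglyMeasurable
    (Eventually.of_forall fun p => ?_)
  rw [RCLike.norm_conj, gapField, norm_mul, Complex.norm_ofNat]
  gcongr
  exact norm_fourierIntegral_le _ p

/-- First variation of the BCS functional at an even minimizer. -/
lemma linearized_variation_nonneg {V : Space → ℝ} (hV : MemLp V (3 / 2) volume) {μ T : ℝ}
    (hT : 0 ≤ T) {g g' : Space → ℝ} {α α' : L2} (h : IsEvenPair g α) (h' : IsEvenPair g' α')
    (hmin : IsMinimizer V μ T ⟨g, α⟩)
    (hint : Integrable (unitaryFourier (α' - α) : Space → ℂ)) :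
    Integrable (fun p => linearizedDensity μ T (gapField V α p) p (g' p) (unitaryFourier α' p) -
      linearizedDensity μ T (gapField V α p) p (g p) (unitaryFourier α p)) ∧
    0 ≤ ∫ p, (linearizedDensity μ T (gapField V α p) p (g' p) (unitaryFourier α' p) -
      linearizedDensity μ T (gapField V α p) p (g p) (unitaryFourier α p)) := by
  have hsub := unitaryFourier_sub_ae α α'
  have hI := h.integrable_freeDensity μ T
  have hI' := h'.integrable_freeDensity μ T
  have hlin := integrable_conj_gapField_mul hV h.kinetic_alpha hint
  have hae : (fun p => linearizedDensity μ T (gapField V α p) p (g' p) (unitaryFourier α' p) -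
      linearizedDensity μ T (gapField V α p) p (g p) (unitaryFourier α p)) =ᵐ[volume]
      fun p => (freeDensity μ T p (g' p) (unitaryFourier α' p) -
        freeDensity μ T p (g p) (unitaryFourier α p)) +
        (conj (gapField V α p) * unitaryFourier (α' - α) p).re := by
    filter_upwards [hsub] with p hp
    rw [hp, mul_sub, Complex.sub_re, linearizedDensity, linearizedDensity]
    ring
  have hβ : Integrable fun p => ‖p‖ ^ 2 * ‖unitaryFourier (α' - α) p‖ ^ 2 := by
    refine ((h.kinetic_alpha.const_mul 2).add (h'.kinetic_alpha.const_mul 2)).mono'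
      ((by fun_prop : Continuous fun p : Space => ‖p‖ ^ 2).aestronglyMeasurable.mul
        ((Lp.memLp (unitaryFourier (α' - α))).1.norm.pow 2)) ?_
    filter_upwards [hsub] with p hp
    rw [hp, Real.norm_of_nonneg (by positivity)]
    have h1 := norm_sub_le (unitaryFourier α' p) (unitaryFourier α p)
    have h2 : ‖unitaryFourier α' p - unitaryFourier α p‖ ^ 2 ≤
        2 * ‖unitaryFourier α p‖ ^ 2 + 2 * ‖unitaryFourier α' p‖ ^ 2 := by
      refine (pow_le_pow_left₀ (norm_nonneg _) h1 2).trans ?_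
      nlinarith [sq_nonneg (‖unitaryFourier α p‖ - ‖unitaryFourier α' p‖)]
    have h3 := mul_le_mul_of_nonneg_left h2 (sq_nonneg ‖p‖)
    simp only [Pi.add_apply]
    linarith
  refine ⟨((hI'.sub hI).add hlin.re).congr hae.symm, ?_⟩
  set A := ∫ p, freeDensity μ T p (g p) (unitaryFourier α p) with hA
  set A' := ∫ p, freeDensity μ T p (g' p) (unitaryFourier α' p) with hA'
  set L := (∫ p, conj (gapField V α p) * unitaryFourier (α' - α) p).re with hL
  have heq : ∫ p, (linearizedDensity μ T (gapField V α p) p (g' p) (unitaryFourier α' p) -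
      linearizedDensity μ T (gapField V α p) p (g p) (unitaryFourier α p)) = A' - A + L := by
    rw [integral_congr_ae hae, integral_add (f := fun p =>
      freeDensity μ T p (g' p) (unitaryFourier α' p) - freeDensity μ T p (g p) (unitaryFourier α p))
      (g := fun p => (conj (gapField V α p) * unitaryFourier (α' - α) p).re)
      (hI'.sub hI) hlin.re, integral_sub hI' hI]
    congr 1
    exact integral_re hlin
  rw [heq]
  -- Minimality at the point `t` of the segment, with the free part estimated by convexity, divided
  -- by `t`. Only the quadratic part of the potential energy leaves an error, and it is of order
  -- `t`.
  have hstep : ∀ t : ℝ, 0 < t → t ≤ 1 →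
      -(t * potentialEnergy V (α' - α)) ≤ A' - A + L := by
    intro t ht0 ht1
    have ht := h.segment h' ht0.le ht1
    have hle := hmin.2 _ ht.mem_domain
    rw [h.functional_eq, ht.functional_eq, potentialEnergy_add_smul hV h.kinetic_alpha hβ hint t]
      at hle
    have hmono : ∫ p, freeDensity μ T p ((1 - t) * g p + t * g' p)
        (unitaryFourier (α + (t : ℂ) • (α' - α)) p) ≤ (1 - t) * A + t * A' := by
      rw [hA, hA', ← integral_const_mul, ← integral_const_mul,
        ← integral_add (hI.const_mul _) (hI'.const_mul _)]
      refine integral_mono_ae (ht.integrable_freeDensity μ T)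
        ((hI.const_mul _).add (hI'.const_mul _)) ?_
      filter_upwards [unitaryFourier_segment α α' t, h.spread_le, h'.spread_le] with p h1 h2 h3
      rw [h1]
      exact freeDensity_convex μ hT p h2 h3 (sub_nonneg.2 ht1) ht0.le (by ring)
    have h0 : 0 ≤ t * (A' - A + L + t * potentialEnergy V (α' - α)) := by
      rw [← hA, ← hL] at hle
      nlinarith
    have := nonneg_of_mul_nonneg_right h0 ht0
    linarith
  have hlim : Tendsto (fun t : ℝ => -(t * potentialEnergy V (α' - α))) (𝓝[>] 0) (𝓝 0) := by
    have : Continuous fun t : ℝ => -(t * potentialEnergy V (α' - α)) := by fun_prop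
    simpa using (this.tendsto 0).mono_left nhdsWithin_le_nhds
  refine le_of_tendsto hlim ?_
  filter_upwards [Ioc_mem_nhdsGT (zero_lt_one' ℝ)] with t ht
  exact hstep t ht.1 ht.2

/-- An even state can be replaced inside a ball by another one. -/
lemma IsEvenPair.exists_replace {g g₁ : Space → ℝ} {α : L2} {a₁ : Space → ℂ} (h : IsEvenPair g α)
    (hg : Measurable g₁) (ha : Measurable a₁) (hg_even : ∀ p, g₁ (-p) = g₁ p)
    (ha_even : ∀ p, a₁ (-p) = a₁ p) (hs : ∀ᵐ p, spread (g₁ p) (a₁ p) ≤ 1 / 2) (R : ℝ) :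
    ∃ (g' : Space → ℝ) (α' : L2), IsEvenPair g' α' ∧
      Integrable (unitaryFourier (α' - α) : Space → ℂ) ∧
      (∀ p ∈ momentumBall R, g' p = g₁ p) ∧ (∀ p ∉ momentumBall R, g' p = g p) ∧
      ∀ᵐ p, (p ∈ momentumBall R → unitaryFourier α' p = a₁ p) ∧
        (p ∉ momentumBall R → unitaryFourier α' p = unitaryFourier α p) := by
  classical
  set B := momentumBall R with hB
  have hBm : MeasurableSet B := measurableSet_closedBall
  have hBfin : volume B < ∞ := (isCompact_closedBall _ _).measure_lt_top
  have : IsFiniteMeasure ((volume : Measure Space).restrict B) :=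
    ⟨by rwa [Measure.restrict_apply_univ]⟩
  -- The region of replacement is symmetric, so evenness survives.
  have hBneg : ∀ p, -p ∈ B ↔ p ∈ B := fun p => by simp [hB, momentumBall]
  have hbound_a : ∀ᵐ p, ‖a₁ p‖ ≤ 1 / 2 := hs.mono fun p hp => (norm_le_spread _ _).trans hp
  have hbound_g : ∀ᵐ p, |g₁ p| ≤ 1 := hs.mono fun p hp => by
    have := abs_le.1 ((abs_sub_half_le_spread _ _).trans hp)
    exact abs_le.2 ⟨by linarith, by linarith⟩
  have hmem : MemLp (B.piecewise a₁ (unitaryFourier α)) 2 volume :=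
    MemLp.piecewise hBm (MemLp.of_bound ha.aestronglyMeasurable (1 / 2)
      (ae_restrict_of_ae hbound_a)) ((Lp.memLp (unitaryFourier α)).restrict _)
  have hU : (unitaryFourier (unitaryFourier.symm (hmem.toLp _)) : Space → ℂ) =ᵐ[volume]
      B.piecewise a₁ (unitaryFourier α) := by
    rw [LinearIsometryEquiv.apply_symm_apply]
    exact hmem.coeFn_toLp
  refine ⟨B.piecewise g₁ g, unitaryFourier.symm (hmem.toLp _), ⟨?_, ?_, ?_, ?_⟩, ?_,
    fun p hp => Set.piecewise_eq_of_mem _ _ _ hp, fun p hp => Set.piecewise_eq_of_notMem _ _ _ hp,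
    ?_⟩
  · have h1 : IntegrableOn (fun p => (1 + ‖p‖ ^ 2) * g₁ p) B := by
      refine Measure.integrableOn_of_bounded (M := 1 + R ^ 2) hBfin.ne
        ((by fun_prop : Measurable fun p : Space => 1 + ‖p‖ ^ 2).mul hg).aestronglyMeasurable ?_
      filter_upwards [ae_restrict_of_ae hbound_g, ae_restrict_mem hBm] with p hp hpB
      have hpR : ‖p‖ ≤ R := by simpa [hB, momentumBall] using hpB
      rw [norm_mul, Real.norm_of_nonneg (by positivity : (0 : ℝ) ≤ 1 + ‖p‖ ^ 2), Real.norm_eq_abs]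
      have : (1 + ‖p‖ ^ 2) * |g₁ p| ≤ (1 + R ^ 2) * 1 := by gcongr
      linarith
    refine (Integrable.piecewise hBm h1 h.integrable_weighted.integrableOn).congr
      (Eventually.of_forall fun p => ?_)
    by_cases hp : p ∈ B
    · simp only [Set.piecewise_eq_of_mem _ _ _ hp]
    · simp only [Set.piecewise_eq_of_notMem _ _ _ hp]
  · filter_upwards [h.even_left] with p h1
    by_cases hp : p ∈ B
    · rw [Set.piecewise_eq_of_mem _ _ _ hp, Set.piecewise_eq_of_mem _ _ _ ((hBneg p).2 hp), hg_even]
    · rw [Set.piecewise_eq_of_notMem _ _ _ hp,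
        Set.piecewise_eq_of_notMem _ _ _ (fun h => hp ((hBneg p).1 h)), h1]
  · filter_upwards [h.even_right, hU, ae_comp_neg hU] with p h1 h2 h3
    rw [h2, h3]
    by_cases hp : p ∈ B
    · rw [Set.piecewise_eq_of_mem _ _ _ hp, Set.piecewise_eq_of_mem _ _ _ ((hBneg p).2 hp), ha_even]
    · rw [Set.piecewise_eq_of_notMem _ _ _ hp,
        Set.piecewise_eq_of_notMem _ _ _ (fun h => hp ((hBneg p).1 h)), h1]
  · filter_upwards [h.spread_le, hU, hs] with p h1 h2 h3
    rw [h2]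
    by_cases hp : p ∈ B
    · rwa [Set.piecewise_eq_of_mem _ _ _ hp, Set.piecewise_eq_of_mem _ _ _ hp]
    · rwa [Set.piecewise_eq_of_notMem _ _ _ hp, Set.piecewise_eq_of_notMem _ _ _ hp]
  -- Both pair functions are bounded by `1/2`, so on a ball the difference is integrable; this is
  -- why the replacement is local.
  · have h1 : IntegrableOn (fun p => a₁ p - unitaryFourier α p) B := by
      refine Measure.integrableOn_of_bounded (M := 1) hBfin.ne
        (ha.aestronglyMeasurable.sub (Lp.memLp _).1) ?_
      filter_upwards [ae_restrict_of_ae hbound_a, ae_restrict_of_ae h.spread_le] with p hp hp'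
      have := norm_sub_le (a₁ p) (unitaryFourier α p)
      have := norm_le_spread (g p) (unitaryFourier α p)
      linarith
    refine ((integrable_indicator_iff hBm).2 h1).congr ?_
    filter_upwards [unitaryFourier_sub_ae α (unitaryFourier.symm (hmem.toLp _)), hU] with p h2 h3
    rw [h2, h3]
    by_cases hp : p ∈ B
    · rw [Set.indicator_of_mem hp, Set.piecewise_eq_of_mem _ _ _ hp]
    · rw [Set.indicator_of_notMem hp, Set.piecewise_eq_of_notMem _ _ _ hp, sub_self]
  · filter_upwards [hU] with p hp
    exact ⟨fun h => by rw [hp, Set.piecewise_eq_of_mem _ _ _ h],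
      fun h => by rw [hp, Set.piecewise_eq_of_notMem _ _ _ h]⟩

/-- Euler–Lagrange equation: the pair wave function of a minimizer is the equilibrium pair wave
function in its own gap field. -/
lemma IsMinimizer.alpha_eq {V : Space → ℝ} (hV : MemLp V (3 / 2) volume)
    (hV_even : ∀ᵐ x, V (-x) = V x) {μ T : ℝ} (hT : 0 ≤ T) {Γ : State}
    (hΓ : IsMinimizer V μ T Γ) :
    (unitaryFourier Γ.alpha : Space → ℂ) =ᵐ[volume] equilibriumPair μ T (gapField V Γ.alpha) := by
  have h := isEvenPair_evenPart hΓ.1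
  -- Symmetrization keeps `α`, the only part of the state that the conclusion concerns.
  have hmin : IsMinimizer V μ T ⟨evenPart Γ.gammaHat, Γ.alpha⟩ :=
    ⟨h.mem_domain, fun Γ' hΓ' => (functional_evenPart_le hΓ.1 V μ hT).trans (hΓ.2 Γ' hΓ')⟩
  set Δ := gapField V Γ.alpha with hΔ
  have hcont : Continuous Δ := continuous_gapField hV h.kinetic_alpha
  have hneg : ∀ p, Δ (-p) = Δ p := gapField_neg hV_even h.even_right
  have hpos := ae_energy_pos μ Δ
  have hs : ∀ᵐ p, spread (equilibriumDensity μ T Δ p) (equilibriumPair μ T Δ p) ≤ 1 / 2 :=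
    hpos.mono fun p hp => (spread_equilibrium hT hp).trans_le (equilibriumSpread_le _ _)
  have hball : ∀ n : ℕ, ∀ᵐ p, p ∈ momentumBall n →
      unitaryFourier Γ.alpha p = equilibriumPair μ T Δ p := by
    intro n
    obtain ⟨g', α', h', hint, hg1, hg2, hα'⟩ := h.exists_replace
      (measurable_equilibriumDensity μ T hcont) (measurable_equilibriumPair μ T hcont)
      (fun p => by rw [equilibriumDensity, equilibriumDensity, energy_neg hneg, norm_neg])
      (fun p => by rw [equilibriumPair, equilibriumPair, energy_neg hneg, hneg]) hs n
    obtain ⟨hi, h0⟩ := linearized_variation_nonneg hV hT h h' hmin hint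
    have hle : ∀ᵐ p, 0 ≤ -(linearizedDensity μ T (Δ p) p (g' p) (unitaryFourier α' p) -
        linearizedDensity μ T (Δ p) p (evenPart Γ.gammaHat p) (unitaryFourier Γ.alpha p)) := by
      filter_upwards [hα', h.spread_le, hpos] with p h1 h2 h3
      by_cases hp : p ∈ momentumBall (n : ℝ)
      · rw [h1.1 hp, hg1 p hp]
        linarith [(linearizedDensity_ge hT h3 h2).1]
      · rw [h1.2 hp, hg2 p hp, sub_self, neg_zero]
    -- Pointwise the equilibrium state does at least as well, yet the integrated variation is
    -- nonnegative; so the densities agree almost everywhere and uniqueness applies.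
    have hzero := (integral_eq_zero_iff_of_nonneg_ae hle hi.neg).1
      (le_antisymm (by rw [integral_neg]; linarith) (integral_nonneg_of_ae hle))
    filter_upwards [hzero, hα', h.spread_le, hpos] with p h1 h2 h3 h4 hp
    simp only [Pi.zero_apply] at h1
    rw [h2.1 hp, hg1 p hp] at h1
    exact (linearizedDensity_ge hT h4 h3).2 (by linarith)
  filter_upwards [ae_all_iff.2 hball] with p hp
  obtain ⟨n, hn⟩ := exists_nat_ge ‖p‖
  exact hp n (by simpa [momentumBall] using hn)

/-! ### The gap equation. -/

lemma inv_two_pi_rpow_eq : 1 / (2 * Real.pi) ^ (3 / 2 : ℝ) = fourierConst := by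
  rw [fourierConst, Real.rpow_neg (by positivity), one_div]

lemma integrable_gap_integrand {Vhat : Space → ℂ} (hVhat : MemLp Vhat 3 volume) {Γ : State}
    (hΓ : Γ ∈ domain) (p : Space) : Integrable fun q => Vhat (p - q) * Γ.alphaHat q := by
  refine (integrable_convolution_integrand hVhat (integrable_kinetic hΓ) p).congr ?_
  filter_upwards [alphaHat_ae_eq Γ] with q hq
  rw [hq]

lemma gap_eq_gapField {V : Space → ℝ} (hV : MemLp V (3 / 2) volume)
    {Vhat : Space → ℂ} (hVhat : MemLp Vhat 3 volume)
    (h : Tendsto (fun n => eLpNorm (fourierIntegral (complexTruncation V n) - Vhat) 3 volume) atTop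
        (𝓝 0)) {Γ : State} (hΓ : Γ ∈ domain) : gap Vhat Γ = gapField V Γ.alpha := by
  ext p
  have e : ∫ q, Vhat (p - q) * Γ.alphaHat q = ∫ q, Vhat (p - q) * unitaryFourier Γ.alpha q := by
    refine integral_congr_ae ?_
    filter_upwards [alphaHat_ae_eq Γ] with q hq
    rw [hq]
  rw [gap, gapField, fourierIntegral_potential_mul hV hVhat h (integrable_kinetic hΓ), e,
    ← inv_two_pi_rpow_eq]
  push_cast
  ring

/-- Almost everywhere `Δ/K = -2 α̂`, so the left side is `-2` times the normalized convolution of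
`V̂` with `α̂`, which is `-Δ`. An almost everywhere identity under the integral suffices for every
`p`. -/
lemma gapEquation_of_isMinimizer {V : Space → ℝ} (hV : MemLp V (3 / 2) volume)
    (hV_even : ∀ᵐ x, V (-x) = V x) {μ T : ℝ} (hT : 0 ≤ T)
    {Vhat : Space → ℂ} (hVhat : MemLp Vhat 3 volume)
    (h : Tendsto (fun n => eLpNorm (fourierIntegral (complexTruncation V n) - Vhat) 3 volume) atTop
        (𝓝 0)) {Γ : State} (hΓ : IsMinimizer V μ T Γ) :
    GapEquation Vhat μ T (gap Vhat Γ) := by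
  have hα := integrable_kinetic hΓ.1
  rw [gap_eq_gapField hV hVhat h hΓ.1]
  intro p
  set Δ := gapField V Γ.alpha with hΔ
  have hae : (fun q => -2 * (Vhat (p - q) * unitaryFourier Γ.alpha q)) =ᵐ[volume]
      fun q => Vhat (p - q) * (Δ q / (K μ T Δ q : ℂ)) := by
    filter_upwards [hΓ.alpha_eq hV hV_even hT, ae_energy_pos μ Δ] with q h1 h2
    rw [div_K_eq h2, h1]
    ring
  refine ⟨((integrable_convolution_integrand hVhat hα p).const_mul _).congr hae, ?_⟩
  rw [← integral_congr_ae hae, integral_const_mul, inv_two_pi_rpow_eq, hΔ, gapField,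
    fourierIntegral_potential_mul hV hVhat h hα]
  ring

end

end BCS


theorem proposition3p1 (V : BCS.Space → ℝ)
    (hV : MeasureTheory.MemLp V (3 / 2) MeasureTheory.volume)
    (hV_even : ∀ᵐ x ∂(MeasureTheory.volume : MeasureTheory.Measure BCS.Space), V (-x) = V x)
    (μ T : ℝ) (hT : 0 ≤ T) :
    -- the functional is well defined on the domain: its three integrals converge
    (∀ Γ ∈ BCS.domain,
      MeasureTheory.Integrable (fun p : BCS.Space => (‖p‖ ^ 2 - μ) * Γ.gammaHat p) ∧
      MeasureTheory.Integrable (fun x : BCS.Space => ‖Γ.alpha x‖ ^ 2 * V x) ∧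
      MeasureTheory.Integrable Γ.entropyDensity) ∧
    BddBelow (BCS.functional V μ T '' BCS.domain) ∧
    (∃ Γ, BCS.IsMinimizer V μ T Γ) ∧
    ∃ Vhat : BCS.Space → ℂ, BCS.IsFourierTransform V Vhat ∧
      (∀ Γ ∈ BCS.domain, ∀ p : BCS.Space,
        MeasureTheory.Integrable (fun q : BCS.Space => Vhat (p - q) * Γ.alphaHat q)) ∧
      ∀ Γ, BCS.IsMinimizer V μ T Γ → BCS.GapEquation Vhat μ T (BCS.gap Vhat Γ) := by
  obtain ⟨Vhat, hVhat, h⟩ := BCS.exists_fourierTransform_limit hV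
  exact ⟨fun Γ hΓ => ⟨BCS.integrable_dispersion_mul_of_weighted hΓ.1 μ,
      BCS.integrable_norm_sq_mul hV (BCS.integrable_kinetic hΓ), BCS.integrable_entropyDensity hΓ⟩,
    BCS.bddBelow_functional hV μ hT, BCS.exists_isMinimizer hV μ hT, Vhat,
    BCS.isFourierTransform_of_tendsto hV hVhat h,
    fun Γ hΓ p => BCS.integrable_gap_integrand hVhat hΓ p,
    fun Γ hΓ => BCS.gapEquation_of_isMinimizer hV hV_even hT hVhat h hΓ⟩
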